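/- Let $d\in\mathbb N$. Let $(M_p)_{p\in\mathbb N}$, $(A_p)_{p\in\mathbb N}$ be sequences of positive numbers with $M_0=M_1=A_0=A_1=1$. Assume that both satisfy (M.1) $M_p^2\le M_{p-1}M_{p+1}$ for $p\ge 1$, and (M.2) $M_p\le c_0H^p\min_{0\le q\le p}M_{p-q}M_q$ for $p\in\mathbb N$, with some $c_0,H\ge1$; that $M_p$ satisfies (M.5) there are $s>0$ and $c_0\ge 1$ with $\sum_{q=p+1}^\infty M_{q-1}^s/M_q^s\le c_0\,p\,M_p^s/M_{p+1}^s$ for all $p\ge1$; and that $A_p$ satisfies (M.6) $p!\le c_0L_0^pA_p$ for $p\in\mathbb N$, with some $c_0,L_0>0$. Put $A(\rho)=\sup_p\ln_+(\rho^p/A_p)$ and $M_\alpha=M_{|\alpha|}$ for multi-indices $\alpha$. For $h>0$ let $\mathcal S^{M_p,h}_{A_p,h}$ be the Banach space of all $\varphi\in C^\infty(\mathbb R^d)$ with $$\sigma_h(\varphi)=\sup_{\alpha,x}\frac{h^{|\alpha|}e^{A(h|x|)}|D^\alpha\varphi(x)|}{M_\alpha}<\infty .$$ Let $\mathcal S^*_\dagger$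 denote $\mathcal S^{(M_p)}_{(A_p)}(\mathbb R^d)=\varprojlim_{h\to\infty}\mathcal S^{M_p,h}_{A_p,h}$ (Beurling case) or $\mathcal S^{\{M_p\}}_{\{A_p\}}(\mathbb R^d)=\varinjlim_{h\to0}\mathcal S^{M_p,h}_{A_p,h}$ (Roumieu case), as locally convex spaces, and let $\mathcal S'^*_\dagger$ be its strong dual. The symbol $\hookrightarrow$ stands for a continuous and dense inclusion, and $T_kf=f(\cdot+k)$. Let $E$ be a complex Banach space such that (I) $\mathcal S^*_\dagger\hookrightarrow E\hookrightarrow\mathcal S'^*_\dagger$, where the composition is the canonical inclusion; (II) $T_k(E)\subseteq E$ for all $k\in\mathbb R^d$; (III) there exist $\tau,C>0$ (in the Roumieu case: for every $\tau>0$ there exists $C>0$) such that $\|T_kg\|_E\le C\|g\|_Ee^{A(\tau|k|)}$ for all $k\in\mathbb R^d$ and $g\in E$. Let $\omega(k)=\|T_{-k}\|_{\mathcal L(E)}$ and let $L^1_\omega$ be the Beurling algebra (under convolution) of all measurable $u$ with $\|u\|_{1,\omega}=\int_{\mathbb R^d}|u(x)|\,\omega(x)\,dx<\infty$. For $m>0$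 let $$\mathcal D^{M_p,m}_E=\Big\{\varphi\in E : D^\alpha\varphi\in E\ \text{for all }\alpha,\ \|\varphi\|_{E,m}=\sup_\alpha\frac{m^{|\alpha|}\|D^\alpha\varphi\|_E}{M_\alpha}<\infty\Big\},$$ where $D^\alpha$ is taken in $\mathcal S'^*_\dagger$. As locally convex spaces, let $\mathcal D^*_E$ be $\varprojlim_{m\to\infty}\mathcal D^{M_p,m}_E$ in the Beurling case and $\varinjlim_{m\to0}\mathcal D^{M_p,m}_E$ in the Roumieu case. Then the following holds. (a) $\mathcal S^*_\dagger\hookrightarrow\mathcal D^*_E\hookrightarrow E\hookrightarrow\mathcal S'^*_\dagger$, with continuous and dense inclusions. (b) Convolution $\mathcal S^*_\dagger\times\mathcal S^*_\dagger\to\mathcal S^*_\dagger$ has a unique extension to a continuous bilinear map $*:L^1_\omega\times E\to E$. It restricts to a (jointly) continuous bilinear map $*:L^1_\omega\times\mathcal D^*_E\to\mathcal D^*_E$, and $\mathcal D^*_E$ is thereby a topological module over the Beurling algebra $L^1_\omega$: for $u,v\in L^1_\omega$ one has $u*v\in L^1_\omega$, $\|u*v\|_{1,\omega}\le\|u\|_{1,\omega}\|v\|_{1,\omega}$,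 and $(u*v)*\varphi=u*(v*\varphi)$ for $\varphi\in\mathcal D^*_E$. (c) In both cases, for each $m>0$, convolution is also a continuous bilinear map $L^1_\omega\times\mathcal D^{M_p,m}_E\to\mathcal D^{M_p,m}_E$, and $$\|u*\varphi\|_{E,m}\le\|u\|_{1,\omega}\|\varphi\|_{E,m},\qquad u\in L^1_\omega,\ \varphi\in\mathcal D^{M_p,m}_E .$$ -/

import Mathlib

open MeasureTheory Topology Filter
open scoped ENNReal NNReal

noncomputable section

namespace UltraTI

/-! ### Weight sequences -/

/-- A pair of weight sequences `M`, `A`: `M` satisfies (M.1), (M.2), (M.5), and `A` satisfies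
(M.1), (M.2), (M.6). -/
structure WeightSeqs where
  M : ℕ → ℝ
  A : ℕ → ℝ
  M_pos : ∀ p, 0 < M p
  A_pos : ∀ p, 0 < A p
  M_zero : M 0 = 1
  M_one : M 1 = 1
  A_zero : A 0 = 1
  A_one : A 1 = 1
  /-- (M.1) for `M`. -/
  M_logConvex : ∀ p, M (p + 1) ^ 2 ≤ M p * M (p + 2)
  /-- (M.1) for `A`. -/
  A_logConvex : ∀ p, A (p + 1) ^ 2 ≤ A p * A (p + 2)
  /-- (M.2) for `M`. -/
  M_stable : ∃ c₀ H : ℝ, 1 ≤ c₀ ∧ 1 ≤ H ∧ ∀ p q, M (p + q) ≤ c₀ * H ^ (p + q) * (M p * M q)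
  /-- (M.2) for `A`. -/
  A_stable : ∃ c₀ H : ℝ, 1 ≤ c₀ ∧ 1 ≤ H ∧ ∀ p q, A (p + q) ≤ c₀ * H ^ (p + q) * (A p * A q)
  /-- (M.5) for `M`: some power `M ^ s`, `s > 0`, is strongly non-quasianalytic; the summation
  index `q ≥ p + 1` is written as `q = p + 1 + k`. -/
  M_strongNQA : ∃ s : ℝ, 0 < s ∧ ∃ c₀ : ℝ, 1 ≤ c₀ ∧ ∀ p : ℕ, 1 ≤ p →
    Summable (fun k : ℕ => M (p + k) ^ s / M (p + k + 1) ^ s) ∧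
    ∑' k : ℕ, M (p + k) ^ s / M (p + k + 1) ^ s ≤ c₀ * p * (M p ^ s / M (p + 1) ^ s)
  /-- (M.6) for `A`. -/
  A_factorial : ∃ c₀ L₀ : ℝ, 0 < c₀ ∧ 0 < L₀ ∧ ∀ p : ℕ, (p.factorial : ℝ) ≤ c₀ * L₀ ^ p * A p

/-- The two cases: Beurling, `(M_p)`-`(A_p)`, and Roumieu, `{M_p}`-`{A_p}`. -/
inductive UltraClass
  | beurling
  | roumieu

/-- The associated function `ρ ↦ sup_p log₊ (ρ ^ p / N p)` of a sequence `N`. -/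
def assocFun (N : ℕ → ℝ) (ρ : ℝ) : ℝ := ⨆ p : ℕ, Real.posLog (ρ ^ p / N p)

theorem WeightSeqs.bddAbove_assoc (W : WeightSeqs) {ρ : ℝ} (hρ : 0 ≤ ρ) :
    BddAbove (Set.range fun p : ℕ => Real.posLog (ρ ^ p / W.A p)) := by
  obtain ⟨c, L, hc, hL, h⟩ := W.A_factorial
  refine ⟨Real.log (max 1 (c * Real.exp (L * ρ))), ?_⟩
  rintro _ ⟨p, rfl⟩
  have hA := W.A_pos p
  have h0 : 0 ≤ ρ ^ p / W.A p := by positivity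
  simp only
  rw [Real.posLog_eq_log_max_one h0]
  refine Real.log_le_log (by positivity) (max_le_max le_rfl ?_)
  have h1 : (L * ρ) ^ p / (p.factorial : ℝ) ≤ Real.exp (L * ρ) :=
    Real.pow_div_factorial_le_exp (x := L * ρ) (by positivity) p
  rw [div_le_iff₀ (by positivity)] at h1
  rw [div_le_iff₀ hA]
  have h2 : ρ ^ p * (p.factorial : ℝ) ≤ c * Real.exp (L * ρ) * W.A p * (p.factorial : ℝ) := by
    calc ρ ^ p * (p.factorial : ℝ) ≤ ρ ^ p * (c * L ^ p * W.A p) := by gcongr; exact h p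
      _ = c * (L * ρ) ^ p * W.A p := by rw [mul_pow]; ring
      _ ≤ c * (Real.exp (L * ρ) * (p.factorial : ℝ)) * W.A p := by gcongr
      _ = _ := by ring
  exact le_of_mul_le_mul_right h2 (by positivity)

theorem WeightSeqs.assoc_mono (W : WeightSeqs) {ρ μ : ℝ} (hρ : 0 ≤ ρ) (h : ρ ≤ μ) :
    assocFun W.A ρ ≤ assocFun W.A μ := by
  refine ciSup_mono (W.bddAbove_assoc (hρ.trans h)) fun p => ?_
  have hA := W.A_pos p
  refine Real.posLog_le_posLog (by positivity) ?_
  gcongr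

theorem WeightSeqs.assoc_nonneg (W : WeightSeqs) (ρ : ℝ) : 0 ≤ assocFun W.A ρ :=
  Real.iSup_nonneg fun _ => Real.posLog_nonneg

theorem WeightSeqs.assoc_add_le (W : WeightSeqs) {ρ μ : ℝ} (hρ : 0 ≤ ρ) (hμ : 0 ≤ μ) :
    assocFun W.A (ρ + μ) ≤ assocFun W.A (2 * ρ) + assocFun W.A (2 * μ) := by
  rcases le_total ρ μ with h | h
  · have := W.assoc_mono (add_nonneg hρ hμ) (show ρ + μ ≤ 2 * μ by linarith)
    linarith [W.assoc_nonneg (2 * ρ)]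
  · have := W.assoc_mono (add_nonneg hρ hμ) (show ρ + μ ≤ 2 * ρ by linarith)
    linarith [W.assoc_nonneg (2 * μ)]

/-! ### Scales of extended norms and their projective and inductive limits -/

/-- A family of seminorms with values in `[0, ∞]`, indexed by a real parameter (only positive
parameters matter) and increasing in it. -/
structure NormScale (V : Type*) [AddCommGroup V] [Module ℂ V] where
  toFun : ℝ → V → ℝ≥0∞
  add_le : ∀ h u v, toFun h (u + v) ≤ toFun h u + toFun h v
  smul_le : ∀ h (a : ℂ) v, toFun h (a • v) ≤ ‖a‖ₑ * toFun h v
  mono : ∀ {h₁ h₂ : ℝ}, 0 < h₁ → h₁ ≤ h₂ → ∀ v, toFun h₁ v ≤ toFun h₂ v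

namespace NormScale

variable {V : Type*} [AddCommGroup V] [Module ℂ V] (N : NormScale V)

theorem map_zero (h : ℝ) : N.toFun h 0 = 0 := by
  have := N.smul_le h 0 0
  simpa using this

/-- The elements whose norm with parameter `h` is finite. -/
def stepSubmodule (h : ℝ) : Submodule ℂ V where
  carrier := {v | N.toFun h v < ∞}
  zero_mem' := by simp [N.map_zero]
  add_mem' hu hv := (N.add_le _ _ _).trans_lt (ENNReal.add_lt_top.2 ⟨hu, hv⟩)
  smul_mem' a v hv := (N.smul_le _ a v).trans_lt (ENNReal.mul_lt_top (by simp) hv)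

/-- The normed space of all elements whose norm with parameter `h` is finite. -/
def Step (h : ℝ) : Type _ := ↥(N.stepSubmodule h)

instance (h : ℝ) : AddCommGroup (N.Step h) := inferInstanceAs (AddCommGroup ↥(N.stepSubmodule h))
instance (h : ℝ) : Module ℂ (N.Step h) := inferInstanceAs (Module ℂ ↥(N.stepSubmodule h))

/-- The inclusion of a step into the ambient space. -/
def stepIncl (h : ℝ) : N.Step h →ₗ[ℂ] V := (N.stepSubmodule h).subtype

/-- The norm with parameter `h`, on a space of elements on which it is finite. -/
def toSeminorm {X : Type*} [AddCommGroup X] [Module ℂ X] (i : X →ₗ[ℂ] V) (h : ℝ)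
    (hi : ∀ x, N.toFun h (i x) < ∞) : Seminorm ℂ X :=
  Seminorm.ofSMulLE (fun x => (N.toFun h (i x)).toReal) (by simp [N.map_zero])
    (fun x y => by
      rw [← ENNReal.toReal_add (hi x).ne (hi y).ne, map_add]
      exact ENNReal.toReal_mono (ENNReal.add_lt_top.2 ⟨hi x, hi y⟩).ne (N.add_le _ _ _))
    (fun a x => by
      have h1 := ENNReal.toReal_mono (ENNReal.mul_lt_top (by simp) (hi x)).ne
        (N.smul_le h a (i x))
      simpa [ENNReal.toReal_mul] using h1)

instance (h : ℝ) : SeminormedAddCommGroup (N.Step h) :=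
  (N.toSeminorm (N.stepIncl h) h fun x => x.2).toSeminormedAddCommGroup

instance (h : ℝ) : NormedSpace ℂ (N.Step h) where
  norm_smul_le a x :=
    (map_smul_eq_mul (N.toSeminorm (N.stepIncl h) h fun x => x.2) a x).le

/-- The underlying vector space of the limit: in the Beurling case the intersection, in the Roumieu
case the union, of all steps. -/
def limSubmodule : UltraClass → Submodule ℂ V
  | .beurling =>
    { carrier := {v | ∀ h, 0 < h → N.toFun h v < ∞}
      zero_mem' := fun h _ => (N.stepSubmodule h).zero_mem
      add_mem' := fun hu hv h hh => (N.stepSubmodule h).add_mem (hu h hh) (hv h hh)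
      smul_mem' := fun a _ hv h hh => (N.stepSubmodule h).smul_mem a (hv h hh) }
  | .roumieu =>
    { carrier := {v | ∃ h, 0 < h ∧ N.toFun h v < ∞}
      zero_mem' := ⟨1, one_pos, (N.stepSubmodule 1).zero_mem⟩
      add_mem' := by
        rintro u v ⟨h, hh, hu⟩ ⟨k, hk, hv⟩
        have hm : 0 < min h k := lt_min hh hk
        exact ⟨min h k, hm, (N.stepSubmodule _).add_mem
          ((N.mono hm (min_le_left _ _) u).trans_lt hu)
          ((N.mono hm (min_le_right _ _) v).trans_lt hv)⟩
      smul_mem' := by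
        rintro a v ⟨h, hh, hv⟩
        exact ⟨h, hh, (N.stepSubmodule h).smul_mem a hv⟩ }

/-- The limit of the scale: the projective limit of the steps as `h → ∞` (Beurling), the locally
convex inductive limit of the steps as `h → 0` (Roumieu). -/
def Lim (c : UltraClass) : Type _ := ↥(N.limSubmodule c)

instance (c : UltraClass) : AddCommGroup (N.Lim c) :=
  inferInstanceAs (AddCommGroup ↥(N.limSubmodule c))
instance (c : UltraClass) : Module ℂ (N.Lim c) :=
  inferInstanceAs (Module ℂ ↥(N.limSubmodule c))

/-- The inclusion of the limit into the ambient space. -/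
def limIncl (c : UltraClass) : N.Lim c →ₗ[ℂ] V := (N.limSubmodule c).subtype

/-- A set of seminorms that generates the topology of the limit. Beurling: the norms of all the
steps. Roumieu: all seminorms whose restriction to each step is continuous (these generate the
finest locally convex topology for which the inclusions of the steps are continuous). -/
def limSeminorms : (c : UltraClass) → Set (Seminorm ℂ (N.Lim c))
  | .beurling => Set.range fun h : {h : ℝ // 0 < h} =>
      N.toSeminorm (N.limIncl .beurling) h.1 fun x => x.2 h.1 h.2
  | .roumieu => {p | ∀ h, 0 < h → ∃ C : ℝ≥0, ∀ x : N.Lim .roumieu,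
      N.toFun h (N.limIncl .roumieu x) < ∞ →
        p x ≤ C * (N.toFun h (N.limIncl .roumieu x)).toReal}

instance (c : UltraClass) : Nonempty ↥(N.limSeminorms c) := by
  cases c with
  | beurling => exact ⟨⟨_, ⟨⟨1, one_pos⟩, rfl⟩⟩⟩
  | roumieu => exact ⟨⟨0, fun h _ => ⟨0, fun x _ => by simp⟩⟩⟩

/-- The generating seminorms of the limit, as a family. -/
def limFamily (c : UltraClass) : SeminormFamily ℂ (N.Lim c) ↥(N.limSeminorms c) := fun p => p.1

instance (c : UltraClass) : TopologicalSpace (N.Lim c) :=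
  (N.limFamily c).moduleFilterBasis.topology

theorem withSeminorms (c : UltraClass) : WithSeminorms (N.limFamily c) := ⟨rfl⟩

instance (c : UltraClass) : IsTopologicalAddGroup (N.Lim c) :=
  (N.withSeminorms c).topologicalAddGroup

instance (c : UltraClass) : ContinuousSMul ℂ (N.Lim c) := (N.withSeminorms c).continuousSMul

/-- A linear map that only rescales the parameter acts on the limits. -/
def mapLim (c : UltraClass) (L : V →ₗ[ℂ] V) (K : ℝ) (hK : 0 < K)
    (hL : ∀ h, 0 < h → ∀ v, N.toFun (K * h) v < ∞ → N.toFun h (L v) < ∞) :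
    N.Lim c →ₗ[ℂ] N.Lim c :=
  L.restrict (p := N.limSubmodule c) (q := N.limSubmodule c) (by
    intro v hv
    cases c with
    | beurling => exact fun h hh => hL h hh v (hv _ (mul_pos hK hh))
    | roumieu =>
      obtain ⟨h, hh, hv⟩ := hv
      refine ⟨h / K, div_pos hh hK, hL _ (div_pos hh hK) v ?_⟩
      rwa [mul_div_cancel₀ h hK.ne'])

end NormScale

/-! ### Smooth functions, partial derivatives and translations -/

/-- The space of smooth complex-valued functions on `ℝ^d`. -/
def Smooth (d : ℕ) : Submodule ℂ (EuclideanSpace ℝ (Fin d) → ℂ) where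
  carrier := {f | ContDiff ℝ (⊤ : ℕ∞) f}
  zero_mem' := show ContDiff ℝ (⊤ : ℕ∞) (fun _ => (0 : ℂ)) from contDiff_const
  add_mem' := by
    intro f g hf hg
    exact ContDiff.add (show ContDiff ℝ (⊤ : ℕ∞) f from hf) hg
  smul_mem' := by
    intro a f hf
    exact (contDiff_const (c := a)).smul (show ContDiff ℝ (⊤ : ℕ∞) f from hf)

variable {d : ℕ}

theorem Smooth.contDiff (f : Smooth d) : ContDiff ℝ (⊤ : ℕ∞) f.1 := f.2

/-- The partial derivative in the `i`-th coordinate. -/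
def partialDeriv (i : Fin d) : Smooth d →ₗ[ℂ] Smooth d where
  toFun f := ⟨fun x => fderiv ℝ f.1 x (EuclideanSpace.single i 1),
    ContDiff.clm_apply (ContDiff.fderiv_right (m := (⊤ : ℕ∞)) (Smooth.contDiff f) (by simp)) contDiff_const⟩
  map_add' f g := by
    ext x
    have hf : DifferentiableAt ℝ f.1 x := ((Smooth.contDiff f).differentiable (by simp)) x
    have hg : DifferentiableAt ℝ g.1 x := ((Smooth.contDiff g).differentiable (by simp)) x
    change fderiv ℝ (f.1 + g.1) x _ = _
    rw [fderiv_add hf hg]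
    rfl
  map_smul' a f := by
    ext x
    have hf : DifferentiableAt ℝ f.1 x := ((Smooth.contDiff f).differentiable (by simp)) x
    change fderiv ℝ (a • f.1) x _ = _
    rw [fderiv_const_smul hf]
    rfl

theorem partialDeriv_comm (i j : Fin d) : Commute (partialDeriv i) (partialDeriv j) := by
  refine LinearMap.ext fun f => Subtype.ext (funext fun x => ?_)
  have hs : IsSymmSndFDerivAt ℝ f.1 x :=
    ContDiffAt.isSymmSndFDerivAt (n := 2)
      ((Smooth.contDiff f).of_le (WithTop.coe_le_coe.2 le_top)).contDiffAt (by simp)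
  have hd : DifferentiableAt ℝ (fderiv ℝ f.1) x :=
    (ContDiff.fderiv_right (m := (⊤ : ℕ∞)) (Smooth.contDiff f) (by simp)).differentiable (by simp) x
  have key : ∀ k l : Fin d, ((partialDeriv k * partialDeriv l) f).1 x =
      fderiv ℝ (fderiv ℝ f.1) x (EuclideanSpace.single k 1) (EuclideanSpace.single l 1) := by
    intro k l
    change fderiv ℝ (fun y => fderiv ℝ f.1 y (EuclideanSpace.single l 1)) x _ = _
    rw [fderiv_clm_apply hd (differentiableAt_const _)]
    simp
  rw [key i j, key j i]
  exact hs _ _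

/-- The partial derivative `∂^α = ∂₁^(α₁) ⋯ ∂_d^(α_d)`. -/
def multiDeriv (α : Fin d → ℕ) : Smooth d →ₗ[ℂ] Smooth d :=
  ((List.finRange d).map fun i => partialDeriv i ^ α i).prod

theorem multiDeriv_add (α β : Fin d → ℕ) (f : Smooth d) :
    multiDeriv α (multiDeriv β f) = multiDeriv (α + β) f := by
  have hc : ∀ (l : List (Fin d)) (i : Fin d) (n : ℕ) (γ : Fin d → ℕ),
      Commute ((l.map fun j => partialDeriv j ^ γ j).prod) (partialDeriv i ^ n) := by
    intro l i n γ
    refine Commute.list_prod_left _ _ fun y hy => ?_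
    obtain ⟨j, _, rfl⟩ := List.mem_map.1 hy
    exact (partialDeriv_comm j i).pow_pow _ _
  have key : ∀ l : List (Fin d), (l.map fun i => partialDeriv i ^ α i).prod *
      (l.map fun i => partialDeriv i ^ β i).prod =
      (l.map fun i => partialDeriv i ^ (α + β) i).prod := by
    intro l
    induction l with
    | nil => simp
    | cons i l ih =>
      simp only [List.map_cons, List.prod_cons, Pi.add_apply, pow_add]
      rw [mul_assoc, ← mul_assoc _ (partialDeriv i ^ β i), (hc l i (β i) α).eq, mul_assoc, ih]
      simp only [mul_assoc, Pi.add_apply, pow_add]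
  exact LinearMap.congr_fun (key (List.finRange d)) f

/-- The translation `T_k f = f (· + k)` of smooth functions. -/
def translateSmooth (k : EuclideanSpace ℝ (Fin d)) : Smooth d →ₗ[ℂ] Smooth d where
  toFun f := ⟨fun x => f.1 (x + k), ContDiff.comp (g := f.1) (Smooth.contDiff f) (contDiff_id.add contDiff_const)⟩
  map_add' _ _ := rfl
  map_smul' _ _ := rfl

theorem multiDeriv_translate (k : EuclideanSpace ℝ (Fin d)) (α : Fin d → ℕ) (f : Smooth d) :
    multiDeriv α (translateSmooth k f) = translateSmooth k (multiDeriv α f) := by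
  have h1 : ∀ i : Fin d, Commute (partialDeriv i) (translateSmooth k) := by
    intro i
    refine LinearMap.ext fun f => Subtype.ext (funext fun x => ?_)
    change fderiv ℝ (fun y => f.1 (y + k)) x _ = fderiv ℝ f.1 (x + k) _
    rw [fderiv_comp_add_right]
  have h2 : Commute (multiDeriv α) (translateSmooth k) := by
    refine Commute.list_prod_left _ _ fun y hy => ?_
    obtain ⟨j, _, rfl⟩ := List.mem_map.1 hy
    exact (h1 j).pow_left _
  exact LinearMap.congr_fun h2.eq f

/-! ### The test function space `S^*_†` -/

/-- The norms
`σ_h(φ) = sup_α sup_x h^|α| e^(A(h|x|)) |∂^α φ(x)| / M_|α|`. -/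
def gsScale (W : WeightSeqs) (d : ℕ) : NormScale (Smooth d) where
  toFun h φ := ⨆ (α : Fin d → ℕ) (x : EuclideanSpace ℝ (Fin d)),
    ENNReal.ofReal (h ^ (∑ i, α i) * Real.exp (assocFun W.A (h * ‖x‖)) / W.M (∑ i, α i)) *
      ‖(multiDeriv α φ).1 x‖ₑ
  add_le h u v := by
    refine iSup₂_le fun α x => ?_
    rw [map_add]
    refine (mul_le_mul_right (enorm_add_le ((multiDeriv α u).1 x) ((multiDeriv α v).1 x)) _).trans ?_
    rw [mul_add]
    exact add_le_add (le_iSup₂_of_le α x le_rfl) (le_iSup₂_of_le α x le_rfl)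
  smul_le h a v := by
    refine iSup₂_le fun α x => ?_
    have : (multiDeriv α (a • v)).1 x = a * (multiDeriv α v).1 x := by rw [map_smul]; rfl
    rw [this, enorm_mul, mul_left_comm]
    gcongr
    exact le_iSup₂_of_le α x le_rfl
  mono {h₁ h₂} h0 h v := by
    refine iSup₂_mono fun α x => ?_
    have hM := W.M_pos (∑ i, α i)
    have h2 : 0 < h₂ := h0.trans_le h
    have := W.assoc_mono (ρ := h₁ * ‖x‖) (μ := h₂ * ‖x‖) (by positivity) (by gcongr)
    gcongr

/-- The test function space `S^*_†(ℝ^d)`: `S^(M_p)_(A_p)(ℝ^d)` in the Beurling case and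
`S^{M_p}_{A_p}(ℝ^d)` in the Roumieu case. -/
abbrev TestSpace (W : WeightSeqs) (c : UltraClass) (d : ℕ) : Type := (gsScale W d).Lim c

/-- The ultradistribution space `S'^*_†(ℝ^d)`, the strong dual of `S^*_†(ℝ^d)`. -/
abbrev UltraDist (W : WeightSeqs) (c : UltraClass) (d : ℕ) : Type :=
  StrongDual ℂ (TestSpace W c d)

namespace TestSpace

variable {W : WeightSeqs} {c : UltraClass}

/-- The function underlying a test function. -/
def fn (φ : TestSpace W c d) : EuclideanSpace ℝ (Fin d) → ℂ := ((gsScale W d).limIncl c φ).1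

/-- The translation `T_k φ = φ (· + k)` of test functions. -/
def translate (k : EuclideanSpace ℝ (Fin d)) : TestSpace W c d →ₗ[ℂ] TestSpace W c d :=
  (gsScale W d).mapLim c (translateSmooth k) 2 two_pos (by
    intro h hh v hv
    refine lt_of_le_of_lt (b := ENNReal.ofReal (Real.exp (assocFun W.A (2 * (h * ‖k‖)))) *
      (gsScale W d).toFun (2 * h) v) (iSup₂_le fun α x => ?_)
      (ENNReal.mul_lt_top ENNReal.ofReal_lt_top hv)
    rw [multiDeriv_translate]
    have h1 : (translateSmooth k (multiDeriv α v)).1 x = (multiDeriv α v).1 (x + k) := rfl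
    rw [h1]
    have hM := W.M_pos (∑ i, α i)
    have h2 : assocFun W.A (h * ‖x‖) ≤
        assocFun W.A (2 * (h * ‖k‖)) + assocFun W.A (2 * h * ‖x + k‖) := by
      refine (W.assoc_mono (by positivity) (?_ : h * ‖x‖ ≤ h * ‖k‖ + h * ‖x + k‖)).trans ?_
      · rw [← mul_add]
        gcongr
        have := norm_sub_le (x + k) k
        rw [add_sub_cancel_right] at this
        linarith
      · rw [mul_assoc 2 h]
        exact W.assoc_add_le (by positivity) (by positivity)
    refine le_trans ?_ (mul_le_mul_right (le_iSup₂_of_le α (x + k) le_rfl) _)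
    rw [← mul_assoc, ← ENNReal.ofReal_mul (by positivity)]
    gcongr
    rw [← mul_div_assoc]
    refine div_le_div_of_nonneg_right ?_ hM.le
    calc h ^ (∑ i, α i) * Real.exp (assocFun W.A (h * ‖x‖))
        ≤ (2 * h) ^ (∑ i, α i) * Real.exp
          (assocFun W.A (2 * (h * ‖k‖)) + assocFun W.A (2 * h * ‖x + k‖)) := by
          gcongr
          linarith
      _ = _ := by rw [Real.exp_add]; ring)

/-- The partial derivative `∂^β` of test functions. -/
def deriv (β : Fin d → ℕ) : TestSpace W c d →ₗ[ℂ] TestSpace W c d :=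
  (gsScale W d).mapLim c (multiDeriv β) W.M_stable.choose_spec.choose
    (by linarith [W.M_stable.choose_spec.choose_spec.2.1]) (by
    intro h hh v hv
    generalize hH' : W.M_stable.choose_spec.choose = H at hv
    obtain ⟨hc, hH, hs⟩ := W.M_stable.choose_spec.choose_spec
    rw [hH'] at hH hs
    generalize W.M_stable.choose = c₀ at hc hs
    refine lt_of_le_of_lt (b := ENNReal.ofReal (c₀ * W.M (∑ i, β i) / h ^ (∑ i, β i)) *
      (gsScale W d).toFun (H * h) v) (iSup₂_le fun α x => ?_)
      (ENNReal.mul_lt_top ENNReal.ofReal_lt_top hv)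
    rw [multiDeriv_add]
    refine le_trans ?_ (mul_le_mul_right (le_iSup₂_of_le (α + β) x le_rfl) _)
    have hsum : ∑ i, (α + β) i = ∑ i, α i + ∑ i, β i := Finset.sum_add_distrib
    rw [hsum]
    generalize ∑ i, α i = a
    generalize ∑ i, β i = b
    have hMa := W.M_pos a
    have hMb := W.M_pos b
    have hMab := W.M_pos (a + b)
    rw [← mul_assoc, ← ENNReal.ofReal_mul (by positivity)]
    gcongr
    have h1 : assocFun W.A (h * ‖x‖) ≤ assocFun W.A (H * h * ‖x‖) := by
      refine W.assoc_mono (by positivity) ?_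
      gcongr
      exact le_mul_of_one_le_left hh.le hH
    calc h ^ a * Real.exp (assocFun W.A (h * ‖x‖)) / W.M a
        ≤ h ^ a * Real.exp (assocFun W.A (H * h * ‖x‖)) / W.M a := by gcongr
      _ = h ^ a * Real.exp (assocFun W.A (H * h * ‖x‖)) / (W.M a * W.M (a + b)) *
          W.M (a + b) := by field_simp
      _ ≤ h ^ a * Real.exp (assocFun W.A (H * h * ‖x‖)) / (W.M a * W.M (a + b)) *
          (c₀ * H ^ (a + b) * (W.M a * W.M b)) := by gcongr; exact hs a b
      _ = _ := by
        rw [mul_pow, pow_add h]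
        field_simp)

end TestSpace

/-! ### Translation-invariant Banach spaces of ultradistributions -/

/-- `E`, a complex normed space (completeness is a separate assumption where it is needed), is a
translation-invariant Banach space of ultradistributions of class `*-†`; it is given with the dense
continuous inclusions `S^*_† ↪ E ↪ S'^*_†`, whose composition is the canonical inclusion. -/
structure TIBSpace (W : WeightSeqs) (c : UltraClass) (d : ℕ) (E : Type*)
    [NormedAddCommGroup E] [NormedSpace ℂ E] where
  ofTest : TestSpace W c d →L[ℂ] E
  toUltra : E →L[ℂ] UltraDist W c d
  ofTest_injective : Function.Injective ofTest
  ofTest_dense : DenseRange ofTest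
  toUltra_injective : Function.Injective toUltra
  toUltra_dense : DenseRange toUltra
  toUltra_ofTest : ∀ φ ψ : TestSpace W c d,
    toUltra (ofTest φ) ψ = ∫ x, TestSpace.fn φ x * TestSpace.fn ψ x
  /-- (II): `T_k g ∈ E` for `g ∈ E`, where `⟨T_k g, φ⟩ = ⟨g, T_{-k} φ⟩`. -/
  translate_mem : ∀ (k : EuclideanSpace ℝ (Fin d)) (g : E), ∃ g' : E,
    ∀ φ, toUltra g' φ = toUltra g (TestSpace.translate (-k) φ)
  /-- (III): `‖T_k g‖ ≤ C ‖g‖ e^(A(τ|k|))`, for some `τ` and `C` in the Beurling case, and for every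
  `τ` with some `C` in the Roumieu case. -/
  translate_bound :
    let P : ℝ → ℝ → Prop := fun τ C => ∀ (k : EuclideanSpace ℝ (Fin d)) (g g' : E),
      (∀ φ, toUltra g' φ = toUltra g (TestSpace.translate (-k) φ)) →
        ‖g'‖ ≤ C * ‖g‖ * Real.exp (assocFun W.A (τ * ‖k‖))
    match c with
    | .beurling => ∃ τ C : ℝ, 0 < τ ∧ 0 < C ∧ P τ C
    | .roumieu => ∀ τ : ℝ, 0 < τ → ∃ C : ℝ, 0 < C ∧ P τ C

namespace TIBSpace

variable {W : WeightSeqs} {c : UltraClass} {E : Type*} [NormedAddCommGroup E] [NormedSpace ℂ E]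
  (X : TIBSpace W c d E)

theorem eq_of_toUltra {g g' : E} (h : ∀ φ, X.toUltra g φ = X.toUltra g' φ) : g = g' :=
  X.toUltra_injective (ContinuousLinearMap.ext h)

theorem exists_translate_bound (k : EuclideanSpace ℝ (Fin d)) : ∃ C : ℝ, ∀ g g' : E,
    (∀ φ, X.toUltra g' φ = X.toUltra g (TestSpace.translate (-k) φ)) → ‖g'‖ ≤ C * ‖g‖ := by
  have hb := X.translate_bound
  have key : ∃ τ C : ℝ, ∀ g g' : E,
      (∀ φ, X.toUltra g' φ = X.toUltra g (TestSpace.translate (-k) φ)) →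
        ‖g'‖ ≤ C * ‖g‖ * Real.exp (assocFun W.A (τ * ‖k‖)) := by
    cases c with
    | beurling =>
      obtain ⟨τ, C, _, _, h⟩ := hb
      exact ⟨τ, C, h k⟩
    | roumieu =>
      obtain ⟨C, _, h⟩ := hb 1 one_pos
      exact ⟨1, C, h k⟩
  obtain ⟨τ, C, h⟩ := key
  exact ⟨C * Real.exp (assocFun W.A (τ * ‖k‖)), fun g g' hg => (h g g' hg).trans_eq (by ring)⟩

/-- The translation operator `T_k` on `E`. -/
def translate (k : EuclideanSpace ℝ (Fin d)) : E →L[ℂ] E :=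
  LinearMap.mkContinuous
    { toFun := fun g => (X.translate_mem k g).choose
      map_add' := fun g g' => X.eq_of_toUltra fun φ => by
        rw [(X.translate_mem k (g + g')).choose_spec φ, map_add, map_add,
          add_apply, add_apply,
          (X.translate_mem k g).choose_spec φ, (X.translate_mem k g').choose_spec φ]
      map_smul' := fun a g => X.eq_of_toUltra fun φ => by
        rw [(X.translate_mem k (a • g)).choose_spec φ, map_smul, map_smul,
          smul_apply, smul_apply,
          (X.translate_mem k g).choose_spec φ]
        rfl }
    (X.exists_translate_bound k).choose
    (fun g => (X.exists_translate_bound k).choose_spec g _ (X.translate_mem k g).choose_spec)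

theorem toUltra_translate (k : EuclideanSpace ℝ (Fin d)) (g : E) (φ : TestSpace W c d) :
    X.toUltra (X.translate k g) φ = X.toUltra g (TestSpace.translate (-k) φ) :=
  (X.translate_mem k g).choose_spec φ

/-- The weight function `ω(k) = ‖T_{-k}‖` of `E`. -/
def weight (k : EuclideanSpace ℝ (Fin d)) : ℝ := ‖X.translate (-k)‖

/-- The measure `ω(x) dx`. -/
def weightMeasure : Measure (EuclideanSpace ℝ (Fin d)) :=
  volume.withDensity fun x => ENNReal.ofReal (X.weight x)

/-- The Beurling algebra `L¹_ω`, with norm `‖u‖_{1,ω} = ∫ |u(x)| ω(x) dx`. -/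
abbrev Beurling : Type := Lp ℂ 1 X.weightMeasure

/-- `g'` is the ultradistributional derivative `∂^α g`:
`⟨∂^α g, φ⟩ = (-1)^|α| ⟨g, ∂^α φ⟩` for all test functions `φ`. -/
def IsDeriv (α : Fin d → ℕ) (g g' : E) : Prop :=
  ∀ φ, X.toUltra g' φ = (-1) ^ (∑ i, α i) * X.toUltra g (TestSpace.deriv α φ)

theorem IsDeriv.unique {α : Fin d → ℕ} {g g₁ g₂ : E} (h₁ : X.IsDeriv α g g₁)
    (h₂ : X.IsDeriv α g g₂) : g₁ = g₂ :=
  X.eq_of_toUltra fun φ => (h₁ φ).trans (h₂ φ).symm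

/-- `‖g‖_{E,m} = sup_α m^|α| ‖∂^α g‖_E / M_|α|`, with value `∞` if some derivative of `g` is not in
`E`. (The family `G` of derivatives is unique if it exists.) -/
def derivNorm (m : ℝ) (g : E) : ℝ≥0∞ :=
  ⨅ (G : (Fin d → ℕ) → E) (_ : ∀ α, X.IsDeriv α g (G α)),
    ⨆ α, ENNReal.ofReal (m ^ (∑ i, α i) / W.M (∑ i, α i)) * ‖G α‖ₑ

theorem derivNorm_eq (m : ℝ) {g : E} {G : (Fin d → ℕ) → E} (hG : ∀ α, X.IsDeriv α g (G α)) :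
    X.derivNorm m g =
      ⨆ α, ENNReal.ofReal (m ^ (∑ i, α i) / W.M (∑ i, α i)) * ‖G α‖ₑ := by
  refine le_antisymm (iInf₂_le G hG) (le_iInf₂ fun G' hG' => ?_)
  rw [show G = G' from funext fun α => (hG α).unique X (hG' α)]

theorem derivNorm_eq_top (m : ℝ) {g : E} (h : ¬ ∃ G : (Fin d → ℕ) → E, ∀ α, X.IsDeriv α g (G α)) :
    X.derivNorm m g = ∞ := by
  simp only [derivNorm, iInf_eq_top]
  exact fun G hG => (h ⟨G, hG⟩).elim

/-- The norms `‖·‖_{E,m}` on `E`. -/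
def derivScale : NormScale E where
  toFun := X.derivNorm
  add_le m u v := by
    by_cases hu : ∃ G : (Fin d → ℕ) → E, ∀ α, X.IsDeriv α u (G α)
    swap
    · simp [X.derivNorm_eq_top m hu]
    by_cases hv : ∃ G : (Fin d → ℕ) → E, ∀ α, X.IsDeriv α v (G α)
    swap
    · simp [X.derivNorm_eq_top m hv]
    obtain ⟨G, hG⟩ := hu
    obtain ⟨G', hG'⟩ := hv
    have hs : ∀ α, X.IsDeriv α (u + v) (G α + G' α) := fun α φ => by
      rw [map_add, map_add, add_apply, add_apply, hG α φ, hG' α φ, mul_add]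
    rw [X.derivNorm_eq m hG, X.derivNorm_eq m hG', X.derivNorm_eq m hs]
    refine iSup_le fun α => ?_
    refine (mul_le_mul_right (enorm_add_le (G α) (G' α)) _).trans ?_
    rw [mul_add]
    exact add_le_add (le_iSup_of_le α le_rfl) (le_iSup_of_le α le_rfl)
  smul_le m a v := by
    by_cases hv : ∃ G : (Fin d → ℕ) → E, ∀ α, X.IsDeriv α v (G α)
    · obtain ⟨G, hG⟩ := hv
      have hs : ∀ α, X.IsDeriv α (a • v) (a • G α) := fun α φ => by
        rw [map_smul, map_smul, smul_apply, smul_apply, hG α φ, smul_eq_mul, smul_eq_mul]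
        ring
      rw [X.derivNorm_eq m hG, X.derivNorm_eq m hs]
      refine iSup_le fun α => ?_
      rw [enorm_smul, mul_left_comm]
      gcongr
      exact le_iSup_of_le α le_rfl
    · rw [X.derivNorm_eq_top m hv]
      rcases eq_or_ne a 0 with rfl | ha
      · have hs : ∀ α, X.IsDeriv α ((0 : ℂ) • v) 0 := fun α φ => by simp
        rw [X.derivNorm_eq m (G := fun _ => 0) hs]
        simp
      · simp [ha]
  mono {m₁ m₂} h0 h v := by
    refine iInf₂_mono fun G hG => iSup_mono fun α => ?_
    have hM := W.M_pos (∑ i, α i)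
    gcongr

/-- The Banach space `D^{M_p,m}_E` with norm `‖·‖_{E,m}`. -/
abbrev DStep (m : ℝ) : Type _ := X.derivScale.Step m

/-- The test function space `D^*_E`: the projective limit of the spaces `D^{M_p,m}_E` as `m → ∞` in
the Beurling case and their locally convex inductive limit as `m → 0` in the Roumieu case. -/
abbrev DSpace : Type _ := X.derivScale.Lim c

/-- The inclusion of `D^{M_p,m}_E` into `E`. -/
abbrev inclStep (m : ℝ) : X.DStep m →ₗ[ℂ] E := X.derivScale.stepIncl m

/-- The inclusion of `D^*_E` into `E`. -/
abbrev incl : X.DSpace →ₗ[ℂ] E := X.derivScale.limIncl c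

/-- `w` is the convolution product `u * v` in the Beurling algebra:
`w(x) = ∫ u(y) v(x - y) dy` for almost all `x`. -/
def IsConvolution (u v w : X.Beurling) : Prop :=
  w =ᵐ[X.weightMeasure] fun x => ∫ y, u y * v (x - y)

/-- A continuous bilinear map `L¹_ω × E → E` extends the convolution of test functions: for all
`φ, ψ ∈ S^*_†` one has `φ ∈ L¹_ω`, `φ * ψ ∈ S^*_†`, and `(φ, ψ)` is mapped to `φ * ψ`. -/
def ExtendsConvolution (conv : X.Beurling →L[ℂ] E →L[ℂ] E) : Prop :=
  ∀ φ ψ : TestSpace W c d, ∃ (u : X.Beurling) (χ : TestSpace W c d),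
    u =ᵐ[X.weightMeasure] TestSpace.fn φ ∧
    (∀ x, TestSpace.fn χ x = ∫ y, TestSpace.fn φ y * TestSpace.fn ψ (x - y)) ∧
    conv u (X.ofTest ψ) = X.ofTest χ

end TIBSpace

end UltraTI

end

/-! The module action is the Bochner integral `u * g = ∫ u(y) T_{-y} g dy` in `E`. Translations are
strongly continuous on `E`: this is a direct estimate on test functions, and it passes to all of `E`
because test functions are dense and `‖T_k‖` is bounded for `k` near `0`. Hence the weight `ω` is a
supremum of continuous functions, so it is measurable; it is also positive and submultiplicative,
and `‖u * g‖ ≤ ‖u‖_{1,ω} ‖g‖` is immediate (`norm_conv_le`). Fubini identifies the integral with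
ordinary convolution on test functions (`conv_ofTest`) and gives associativity (`conv_convolution`).

Derivatives commute with translations, so `∂^α (u * g) = u * ∂^α g`, and every norm `‖·‖_{E,m}`
obeys the same inequality with the same `m` (`derivNorm_conv_le`). This settles the steps. Because
the parameter is not changed, it also gives joint continuity on the limit, including the inductive
one (`continuous_bilinear`).

Density and uniqueness rest on an approximate identity of test functions. The class of `M` may be
quasianalytic, so cut-off functions are not available. The mollifier is the Fourier transform of
`exp(-z^n)` with `n` a large even integer: strong non-quasianalyticity of a power of `M` yields `p!
≤ C L^p M_p^n` for every `L > 0`, which controls all derivatives. Shifting the contour gives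
exponential decay of every rate, and this beats `e^{A(h|x|)}` because `A` grows at most linearly.
The mollifier thus has all norms `σ_h` finite and serves both classes (`exists_approxIdentity`).

For `g` in `D^*_E` the regularizations `ψ_n * g` converge to `g` in `D^*_E`
(`tendsto_derivNorm_conv_approx`). They need not be test functions, but they lie in the closure of
the test functions: `g ↦ ψ * g` is continuous from `E` to `D^*_E`, as derivatives may fall on `ψ`,
and it maps test functions to test functions (`regularize_mem_closure`). Uniqueness of the extension
follows from density of test functions in `E` and in `L¹_ω` (`denseRange_toBeurling`). -/

noncomputable section

namespace UltraTI

/-! ### Quantifiers over the steps -/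

/-- `P` holds for all positive parameters (Beurling), for some positive parameter (Roumieu). -/
def UltraClass.ProjInd : UltraClass → (ℝ → Prop) → Prop
  | .beurling, P => ∀ h, 0 < h → P h
  | .roumieu, P => ∃ h, 0 < h ∧ P h

/-- `P` holds for some positive parameter (Beurling), for all positive parameters (Roumieu). -/
def UltraClass.IndProj : UltraClass → (ℝ → Prop) → Prop
  | .beurling, P => ∃ h, 0 < h ∧ P h
  | .roumieu, P => ∀ h, 0 < h → P h

namespace UltraClass

variable {c : UltraClass} {P Q : ℝ → Prop}

/-- Membership in a limit is a `ProjInd` statement, a continuity estimate on it an `IndProj` one.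
The two quantifiers are dual in both classes, so a common parameter exists; `K` pays for estimates
that rescale the parameter. -/
theorem ProjInd.exists_and (hP : c.ProjInd P) (hQ : c.IndProj Q) {K : ℝ} (hK : 0 < K) :
    ∃ h, 0 < h ∧ P (K * h) ∧ Q h := by
  cases c with
  | beurling =>
    obtain ⟨h, hh, hQ⟩ := hQ
    exact ⟨h, hh, hP _ (mul_pos hK hh), hQ⟩
  | roumieu =>
    obtain ⟨h, hh, hP⟩ := hP
    exact ⟨h / K, div_pos hh hK, by rwa [mul_div_cancel₀ h hK.ne'], hQ _ (div_pos hh hK)⟩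

theorem ProjInd.rescale (hP : c.ProjInd P) {K : ℝ} (hK : 0 < K)
    (hPQ : ∀ h, 0 < h → P (K * h) → Q h) : c.ProjInd Q := by
  cases c with
  | beurling => exact fun h hh => hPQ h hh (hP _ (mul_pos hK hh))
  | roumieu =>
    obtain ⟨h, hh, hP⟩ := hP
    exact ⟨h / K, div_pos hh hK, hPQ _ (div_pos hh hK) (by rwa [mul_div_cancel₀ h hK.ne'])⟩

theorem IndProj.rescale (hP : c.IndProj P) {K : ℝ} (hK : 0 < K)
    (hPQ : ∀ h, 0 < h → P h → Q (K * h)) : c.IndProj Q := by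
  cases c with
  | beurling =>
    obtain ⟨h, hh, hP⟩ := hP
    exact ⟨K * h, mul_pos hK hh, hPQ h hh hP⟩
  | roumieu =>
    intro h hh
    have := hPQ _ (div_pos hh hK) (hP _ (div_pos hh hK))
    rwa [mul_div_cancel₀ h hK.ne'] at this

theorem ProjInd.and (hP : c.ProjInd P) (hQ : c.ProjInd Q)
    (mP : ∀ h k, 0 < h → h ≤ k → P k → P h) (mQ : ∀ h k, 0 < h → h ≤ k → Q k → Q h) :
    c.ProjInd fun h => P h ∧ Q h := by
  cases c with
  | beurling => exact fun h hh => ⟨hP h hh, hQ h hh⟩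
  | roumieu =>
    obtain ⟨h, hh, hP⟩ := hP
    obtain ⟨k, hk, hQ⟩ := hQ
    have hm := lt_min hh hk
    exact ⟨min h k, hm, mP _ _ hm (min_le_left _ _) hP, mQ _ _ hm (min_le_right _ _) hQ⟩

theorem projInd_of_forall (hP : ∀ h, 0 < h → P h) : c.ProjInd P := by
  cases c with
  | beurling => exact hP
  | roumieu => exact ⟨1, one_pos, hP 1 one_pos⟩

end UltraClass

/-! ### Continuity in projective and inductive limits. -/

namespace NormScale

variable {V : Type*} [AddCommGroup V] [Module ℂ V] (N : NormScale V) {c : UltraClass}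

theorem mem_limSubmodule_iff (v : V) :
    v ∈ N.limSubmodule c ↔ c.ProjInd fun h => N.toFun h v < ∞ := by
  cases c <;> rfl

theorem lim_finite (x : N.Lim c) : c.ProjInd fun h => N.toFun h (N.limIncl c x) < ∞ :=
  (N.mem_limSubmodule_iff _).1 x.2

theorem limIncl_injective : Function.Injective (N.limIncl c) := Subtype.val_injective

theorem seminorm_le_step (p : N.limSeminorms .roumieu) {h : ℝ} (hh : 0 < h) :
    ∃ C : ℝ≥0, C ≠ 0 ∧ ∀ x : N.Lim .roumieu,
      ENNReal.ofReal (p.1 x) ≤ C * N.toFun h (N.limIncl .roumieu x) := by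
  obtain ⟨C, hC⟩ := p.2 h hh
  -- The constant has to be nonzero: `0 * ∞ = 0` in `[0, ∞]`, and the bound would fail outside the
  -- step.
  refine ⟨C + 1, by positivity, fun x => ?_⟩
  by_cases hx : N.toFun h (N.limIncl .roumieu x) < ∞
  · calc ENNReal.ofReal (p.1 x)
        ≤ ENNReal.ofReal (C * (N.toFun h (N.limIncl .roumieu x)).toReal) :=
          ENNReal.ofReal_le_ofReal (hC x hx)
      _ = C * N.toFun h (N.limIncl .roumieu x) := by
          rw [ENNReal.ofReal_mul C.coe_nonneg, ENNReal.ofReal_toReal hx.ne,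
            ENNReal.ofReal_coe_nnreal]
      _ ≤ _ := by gcongr; simp
  · rw [not_lt, top_le_iff] at hx
    rw [hx, ENNReal.mul_top (by simp)]
    exact le_top

/-- With `seminorm_continuous_of_bound` this describes the continuous seminorms of both classes at
once: domination by a step norm, for one parameter (Beurling) or for each (Roumieu). A finite
supremum of generators is absorbed by the largest parameter, respectively by the largest constant.
-/
theorem exists_bound_of_continuous (p : Seminorm ℂ (N.Lim c)) (hp : Continuous p) :
    c.IndProj fun h => ∃ C : ℝ≥0, C ≠ 0 ∧ ∀ x : N.Lim c,
      ENNReal.ofReal (p x) ≤ C * N.toFun h (N.limIncl c x) := by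
  obtain ⟨s, C, hC, hs⟩ := Seminorm.bound_of_continuous (N.withSeminorms c) p hp
  have red : ∀ (h : ℝ) (D : ℝ≥0), D ≠ 0 → (∀ x : N.Lim c,
      ENNReal.ofReal ((s.sup (N.limFamily c)) x) ≤ D * N.toFun h (N.limIncl c x)) →
      ∃ C : ℝ≥0, C ≠ 0 ∧ ∀ x : N.Lim c,
        ENNReal.ofReal (p x) ≤ C * N.toFun h (N.limIncl c x) := by
    refine fun h D hD hx => ⟨C * D, mul_ne_zero hC hD, fun x => ?_⟩
    refine (ENNReal.ofReal_le_ofReal (hs x)).trans ?_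
    rw [smul_apply, NNReal.smul_def, smul_eq_mul, ENNReal.ofReal_mul C.coe_nonneg,
      ENNReal.ofReal_coe_nnreal, ENNReal.coe_mul, mul_assoc]
    gcongr
    exact hx x
  clear hs
  cases c with
  | beurling =>
    suffices H : ∃ h, 0 < h ∧ ∀ x : N.Lim .beurling,
        ENNReal.ofReal ((s.sup (N.limFamily .beurling)) x) ≤
          N.toFun h (N.limIncl .beurling x) by
      obtain ⟨h, hh, H⟩ := H
      exact ⟨h, hh, red h 1 one_ne_zero (by simpa using H)⟩
    clear red
    induction s using Finset.cons_induction with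
    | empty => exact ⟨1, one_pos, fun x => by simp [Seminorm.bot_eq_zero]⟩
    | cons i s hi ih =>
      obtain ⟨h, hh, H⟩ := ih
      obtain ⟨_, ⟨⟨k, hk⟩, rfl⟩⟩ := i
      refine ⟨max h k, lt_max_of_lt_left hh, fun x => ?_⟩
      rw [Finset.sup_cons, Seminorm.sup_apply, ENNReal.ofReal_max]
      refine max_le ?_ ((H x).trans (N.mono hh (le_max_left _ _) _))
      refine le_trans ?_ (N.mono hk (le_max_right _ _) _)
      exact ENNReal.ofReal_toReal_le
  | roumieu =>
    intro h hh
    suffices H : ∃ D : ℝ≥0, D ≠ 0 ∧ ∀ x : N.Lim .roumieu,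
        ENNReal.ofReal ((s.sup (N.limFamily .roumieu)) x) ≤
          D * N.toFun h (N.limIncl .roumieu x) by
      obtain ⟨D, hD, H⟩ := H
      exact red h D hD H
    clear red
    induction s using Finset.cons_induction with
    | empty => exact ⟨1, one_ne_zero, fun x => by simp [Seminorm.bot_eq_zero]⟩
    | cons i s hi ih =>
      obtain ⟨D, hD, H⟩ := ih
      obtain ⟨D', hD', H'⟩ := N.seminorm_le_step i hh
      refine ⟨max D D', (lt_max_of_lt_left (pos_iff_ne_zero.2 hD)).ne', fun x => ?_⟩
      rw [Finset.sup_cons, Seminorm.sup_apply, ENNReal.ofReal_max]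
      refine max_le ((H' x).trans ?_) ((H x).trans ?_)
      · gcongr; exact le_max_right _ _
      · gcongr; exact le_max_left _ _

theorem seminorm_continuous_of_bound {p : Seminorm ℂ (N.Lim c)}
    (hp : c.IndProj fun h => ∃ C : ℝ≥0, C ≠ 0 ∧ ∀ x : N.Lim c,
      ENNReal.ofReal (p x) ≤ C * N.toFun h (N.limIncl c x)) : Continuous p := by
  have key : ∀ (h : ℝ) (C : ℝ≥0), (∀ x : N.Lim c,
      ENNReal.ofReal (p x) ≤ C * N.toFun h (N.limIncl c x)) →
      ∀ x : N.Lim c, N.toFun h (N.limIncl c x) < ∞ →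
        p x ≤ C * (N.toFun h (N.limIncl c x)).toReal := by
    intro h C hC x hx
    have := ENNReal.toReal_mono (ENNReal.mul_lt_top (by simp) hx).ne (hC x)
    rwa [ENNReal.toReal_ofReal (apply_nonneg p x), ENNReal.toReal_mul, ENNReal.coe_toReal] at this
  cases c with
  | beurling =>
    obtain ⟨h, hh, C, -, hC⟩ := hp
    have hc := (N.withSeminorms .beurling).continuous_seminorm ⟨_, ⟨⟨h, hh⟩, rfl⟩⟩
    refine Seminorm.continuous_of_le (q := C • N.limFamily .beurling ⟨_, ⟨⟨h, hh⟩, rfl⟩⟩)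
      (hc.const_smul C) fun x => ?_
    exact key h C hC x (x.2 h hh)
  | roumieu =>
    refine (N.withSeminorms .roumieu).continuous_seminorm ⟨p, fun h hh => ?_⟩
    obtain ⟨C, -, hC⟩ := hp h hh
    exact ⟨C, key h C hC⟩

theorem continuous_seminorm_family (i : N.limSeminorms c) : Continuous (N.limFamily c i) :=
  (N.withSeminorms c).continuous_seminorm i

/-- Convergence of the step norms implies convergence in the limit. -/
theorem tendsto_lim {ι : Type*} {F : Filter ι} {u : ι → N.Lim c} {x : N.Lim c}
    (h : c.ProjInd fun h => Tendsto (fun i => N.toFun h (N.limIncl c (u i - x))) F (𝓝 0)) :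
    Tendsto u F (𝓝 x) := by
  rw [(N.withSeminorms c).tendsto_nhds]
  intro i ε hε
  obtain ⟨k, -, hk, C, hC, hb⟩ := h.exists_and
    (N.exists_bound_of_continuous _ (N.continuous_seminorm_family i)) one_pos
  rw [one_mul] at hk
  have ht : Tendsto (fun i => (C : ℝ≥0∞) * N.toFun k (N.limIncl c (u i - x))) F (𝓝 0) := by
    simpa using ENNReal.Tendsto.const_mul hk (Or.inr (by simp : (C : ℝ≥0∞) ≠ ∞))
  filter_upwards [ht.eventually (gt_mem_nhds (ENNReal.ofReal_pos.2 hε))] with j hj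
  exact (ENNReal.ofReal_lt_ofReal_iff hε).1 ((hb _).trans_lt hj)

/-- A bilinear map that does not increase the step norms is jointly continuous. -/
theorem continuous_bilinear {U : Type*} [NormedAddCommGroup U] [NormedSpace ℂ U]
    (B : U →ₗ[ℂ] N.Lim c →ₗ[ℂ] N.Lim c)
    (hB : ∀ h, 0 < h → ∀ u x,
      N.toFun h (N.limIncl c (B u x)) ≤ ‖u‖ₑ * N.toFun h (N.limIncl c x)) :
    Continuous fun q : U × N.Lim c => B q.1 q.2 := by
  -- Joint continuity on an inductive limit is not automatic from the steps. It follows once every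
  -- continuous `p` admits a continuous `q` with `p (B u x) ≤ ‖u‖ * q x`.
  have key : ∀ p : Seminorm ℂ (N.Lim c), Continuous p → ∃ q : Seminorm ℂ (N.Lim c),
      Continuous q ∧ ∀ u x, p (B u x) ≤ ‖u‖ * q x := by
    intro p hp
    have hb := N.exists_bound_of_continuous p hp
    have hle : ∀ h, 0 < h → ∀ C : ℝ≥0, (∀ x : N.Lim c,
        ENNReal.ofReal (p x) ≤ C * N.toFun h (N.limIncl c x)) →
        ∀ (u : Metric.closedBall (0 : U) 1) (x : N.Lim c),
          ENNReal.ofReal (p (B u x)) ≤ C * N.toFun h (N.limIncl c x) := by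
      intro h hh C hC u x
      refine (hC _).trans ?_
      gcongr
      refine (hB h hh u x).trans (mul_le_of_le_one_left' ?_)
      have : ‖(u : U)‖ ≤ 1 := mem_closedBall_zero_iff.1 u.2
      rw [← ofReal_norm]
      exact ENNReal.ofReal_le_one.2 this
    have hbdd : ∀ x, BddAbove (Set.range fun u : Metric.closedBall (0 : U) 1 =>
        (p.comp (B u)) x) := by
      intro x
      obtain ⟨h, hh, hx, C, -, hC⟩ := (N.lim_finite x).exists_and hb one_pos
      rw [one_mul] at hx
      refine ⟨(C * N.toFun h (N.limIncl c x)).toReal, ?_⟩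
      rintro _ ⟨u, rfl⟩
      have := ENNReal.toReal_mono (ENNReal.mul_lt_top (by simp) hx).ne (hle h hh C hC u x)
      rwa [ENNReal.toReal_ofReal (apply_nonneg p _)] at this
    have hbdd' := Seminorm.bddAbove_range_iff.2 hbdd
    -- This supremum inherits each bound of `p` by a step norm, with the same constant, because `B
    -- u` does not increase step norms when `‖u‖ ≤ 1`. So it is continuous.
    refine ⟨⨆ u : Metric.closedBall (0 : U) 1, p.comp (B u), ?_, fun u x => ?_⟩
    · refine N.seminorm_continuous_of_bound ?_
      have : Nonempty (Metric.closedBall (0 : U) 1) := ⟨⟨0, by simp⟩⟩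
      refine hb.rescale one_pos fun h hh ⟨C, hC0, hC⟩ => ⟨C, hC0, fun x => ?_⟩
      rw [one_mul, Seminorm.iSup_apply hbdd']
      by_cases hx : N.toFun h (N.limIncl c x) = ∞
      · rw [hx, ENNReal.mul_top (by simpa using hC0)]
        exact le_top
      rw [ENNReal.ofReal_le_iff_le_toReal (ENNReal.mul_ne_top (by simp) hx)]
      refine ciSup_le fun u => ?_
      have := ENNReal.toReal_mono (ENNReal.mul_ne_top (by simp) hx) (hle h hh C hC u x)
      rwa [ENNReal.toReal_ofReal (apply_nonneg p _)] at this
    · rw [Seminorm.iSup_apply hbdd']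
      rcases eq_or_ne u 0 with rfl | hu
      · simp
      have hn : 0 < ‖u‖ := norm_pos_iff.2 hu
      have h1 := le_ciSup (hbdd x) ⟨((‖u‖⁻¹ : ℝ) : ℂ) • u, by
        simp [norm_smul, inv_mul_cancel₀ hn.ne']⟩
      have h2 : p (B (((‖u‖⁻¹ : ℝ) : ℂ) • u) x) = ‖u‖⁻¹ * p (B u x) := by
        rw [map_smul, LinearMap.smul_apply, map_smul_eq_mul]
        simp
      simp only [Seminorm.comp_apply] at h1 ⊢
      rw [h2, inv_mul_le_iff₀ hn] at h1
      exact h1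
  rw [continuous_iff_continuousAt]
  rintro ⟨u₀, x₀⟩
  rw [ContinuousAt, (N.withSeminorms c).tendsto_nhds]
  intro i ε hε
  obtain ⟨q, hq, hpq⟩ := key _ (N.continuous_seminorm_family i)
  have h1 : Tendsto (fun z : U × N.Lim c => ‖z.1 - u₀‖ * q z.2 + ‖u₀‖ * q (z.2 - x₀))
      (𝓝 (u₀, x₀)) (𝓝 (‖u₀ - u₀‖ * q x₀ + ‖u₀‖ * q (x₀ - x₀))) := by
    refine Continuous.tendsto (f := fun z : U × N.Lim c =>
      ‖z.1 - u₀‖ * q z.2 + ‖u₀‖ * q (z.2 - x₀)) ?_ (u₀, x₀)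
    have := hq.comp (continuous_snd (X := U) (Y := N.Lim c))
    have := hq.comp ((continuous_snd (X := U) (Y := N.Lim c)).sub
      (continuous_const (y := x₀)))
    fun_prop
  simp only [sub_self, norm_zero, zero_mul, _root_.map_zero, mul_zero, add_zero] at h1
  filter_upwards [h1.eventually (gt_mem_nhds hε)] with z hz
  refine lt_of_le_of_lt ?_ hz
  have : B z.1 z.2 - B u₀ x₀ = B (z.1 - u₀) z.2 + B u₀ (z.2 - x₀) := by
    simp only [map_sub, LinearMap.sub_apply]; abel
  rw [this]
  exact (map_add_le_add _ _ _).trans (add_le_add (hpq _ _) (hpq _ _))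

end NormScale

end UltraTI

namespace UltraTI

/-! ### The associated function -/

namespace WeightSeqs

variable (W : WeightSeqs)

/-- `e^{A(ρ)}`. -/
def expA (ρ : ℝ) : ℝ := Real.exp (assocFun W.A ρ)

theorem expA_pos (ρ : ℝ) : 0 < W.expA ρ := Real.exp_pos _

theorem one_le_expA (ρ : ℝ) : 1 ≤ W.expA ρ := Real.one_le_exp (W.assoc_nonneg ρ)

theorem expA_mono {ρ μ : ℝ} (hρ : 0 ≤ ρ) (h : ρ ≤ μ) : W.expA ρ ≤ W.expA μ :=
  Real.exp_le_exp.2 (W.assoc_mono hρ h)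

theorem expA_add_le {ρ μ : ℝ} (hρ : 0 ≤ ρ) (hμ : 0 ≤ μ) :
    W.expA (ρ + μ) ≤ W.expA (2 * ρ) * W.expA (2 * μ) := by
  rw [expA, expA, expA, ← Real.exp_add]
  exact Real.exp_le_exp.2 (W.assoc_add_le hρ hμ)

theorem measurable_expA : Measurable W.expA := by
  refine Real.measurable_exp.comp (Measurable.iSup fun p => ?_)
  simp only [Real.posLog_def]
  fun_prop

theorem pow_div_le_expA {ρ : ℝ} (hρ : 0 ≤ ρ) (p : ℕ) : ρ ^ p / W.A p ≤ W.expA ρ := by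
  have hA := W.A_pos p
  rcases le_or_gt (ρ ^ p / W.A p) 0 with h | h
  · exact h.trans (W.expA_pos ρ).le
  · rw [expA, ← Real.log_le_iff_le_exp h]
    exact (le_max_right 0 (Real.log (ρ ^ p / W.A p))).trans (le_ciSup (W.bddAbove_assoc hρ) p)

/-- Together with `pow_div_le_expA` this reduces estimates of `e^{A(ρ)}` to estimates of the single
quotients `ρ^p / A_p`; `1 ≤ B` accounts for the truncated logarithm. -/
theorem expA_le_of_forall {ρ B : ℝ} (hB : 1 ≤ B) (hρ : 0 ≤ ρ) (h : ∀ p, ρ ^ p / W.A p ≤ B) :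
    W.expA ρ ≤ B := by
  rw [expA, ← Real.le_log_iff_exp_le (by linarith)]
  refine ciSup_le fun p => ?_
  have hA := W.A_pos p
  rw [Real.posLog_eq_log_max_one (by positivity)]
  exact Real.log_le_log (by positivity) (max_le hB (h p))

/-- By `A_factorial` the quotient `ρ^p / A_p` is at most `c (L ρ)^p / p!`, a term of an exponential
series. So exponential decay of every rate beats every `e^{A(h|x|)}`. -/
theorem exists_expA_le_exp : ∃ C L : ℝ, 0 < C ∧ 0 < L ∧ ∀ ρ, 0 ≤ ρ →
    W.expA ρ ≤ C * Real.exp (L * ρ) := by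
  obtain ⟨c, L, hc, hL, h⟩ := W.A_factorial
  refine ⟨1 + c, L, by positivity, hL, fun ρ hρ => W.expA_le_of_forall ?_ hρ fun p => ?_⟩
  · have : 1 ≤ Real.exp (L * ρ) := Real.one_le_exp (by positivity)
    nlinarith
  have hA := W.A_pos p
  have h1 : (L * ρ) ^ p / (p.factorial : ℝ) ≤ Real.exp (L * ρ) :=
    Real.pow_div_factorial_le_exp (x := L * ρ) (by positivity) p
  rw [div_le_iff₀ (by positivity)] at h1
  rw [div_le_iff₀ hA]
  have h2 : ρ ^ p * (p.factorial : ℝ) ≤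
      ((1 + c) * Real.exp (L * ρ) * W.A p) * (p.factorial : ℝ) := by
    calc ρ ^ p * (p.factorial : ℝ) ≤ ρ ^ p * (c * L ^ p * W.A p) := by gcongr; exact h p
      _ = c * (L * ρ) ^ p * W.A p := by rw [mul_pow]; ring
      _ ≤ (1 + c) * (Real.exp (L * ρ) * (p.factorial : ℝ)) * W.A p := by gcongr; linarith
      _ = _ := by ring
  exact le_of_mul_le_mul_right h2 (by positivity)

/-- Stability of `A` gives `ρ^p ρ^q / (A_p A_q) ≤ c (H ρ)^(p+q) / A_(p+q)`. Later, enlarging the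
parameter by `H` buys a spare factor `e^{-A}`, which is integrable. -/
theorem exists_expA_sq_le : ∃ C H : ℝ, 1 ≤ C ∧ 1 ≤ H ∧ ∀ ρ, 0 ≤ ρ →
    W.expA ρ * W.expA ρ ≤ C * W.expA (H * ρ) := by
  obtain ⟨c, H, hc, hH, h⟩ := W.A_stable
  refine ⟨c, H, hc, hH, fun ρ hρ => ?_⟩
  have hE := W.expA_pos ρ
  have hEH : W.expA ρ ≤ W.expA (H * ρ) := W.expA_mono hρ (le_mul_of_one_le_left hρ hH)
  have h1 : W.expA ρ ≤ c * W.expA (H * ρ) :=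
    hEH.trans (le_mul_of_one_le_left (W.expA_pos _).le hc)
  have key : ∀ p q, (ρ ^ p / W.A p) * (ρ ^ q / W.A q) ≤ c * W.expA (H * ρ) := by
    intro p q
    have hp := W.A_pos p
    have hq := W.A_pos q
    have hpq := W.A_pos (p + q)
    calc (ρ ^ p / W.A p) * (ρ ^ q / W.A q) = ρ ^ (p + q) / (W.A p * W.A q) := by
          rw [pow_add]; field_simp
      _ ≤ c * ((H * ρ) ^ (p + q) / W.A (p + q)) := by
          rw [mul_div_assoc', div_le_div_iff₀ (by positivity) hpq, mul_pow]
          calc ρ ^ (p + q) * W.A (p + q) ≤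
              ρ ^ (p + q) * (c * H ^ (p + q) * (W.A p * W.A q)) := by
                gcongr; exact h p q
            _ = _ := by ring
      _ ≤ _ := by
          gcongr
          exact W.pow_div_le_expA (by positivity) _
  -- The supremum over `q` is taken here with `p` fixed; the one over `p` follows at the end.
  have key2 : ∀ p, (ρ ^ p / W.A p) * W.expA ρ ≤ c * W.expA (H * ρ) := by
    intro p
    have hp := W.A_pos p
    rcases eq_or_lt_of_le (show 0 ≤ ρ ^ p / W.A p by positivity) with h0 | h0
    · rw [← h0, zero_mul]
      exact mul_nonneg (by linarith) (W.expA_pos _).le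
    rcases le_or_gt (ρ ^ p / W.A p) 1 with hx | hx
    · exact (mul_le_of_le_one_left hE.le hx).trans h1
    rw [mul_comm, ← le_div_iff₀ h0]
    refine W.expA_le_of_forall ?_ hρ fun q => ?_
    · rw [le_div_iff₀ h0, one_mul]
      exact (W.pow_div_le_expA hρ p).trans h1
    · rw [le_div_iff₀ h0, mul_comm]
      exact key p q
  rw [← le_div_iff₀ hE]
  refine W.expA_le_of_forall ?_ hρ fun p => ?_
  · rwa [le_div_iff₀ hE, one_mul]
  · rw [le_div_iff₀ hE]
    exact key2 p

/-- `e^{A(h|x|)}` dominates both `1` and `(h|x|)^(d+1) / A_(d+1)`, hence a multiple of `(1 +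
|x|)^(d+1)`. -/
theorem integrable_inv_expA {d : ℕ} {h : ℝ} (hh : 0 < h) :
    Integrable fun x : EuclideanSpace ℝ (Fin d) => (W.expA (h * ‖x‖))⁻¹ := by
  have hA := W.A_pos (d + 1)
  have hint : Integrable fun x : EuclideanSpace ℝ (Fin d) => (1 + ‖x‖) ^ (-((d : ℝ) + 1)) :=
    integrable_one_add_norm (by simp)
  refine ((hint.const_mul (2 ^ (d + 1) * (1 + W.A (d + 1) / h ^ (d + 1))))).mono'
    ((W.measurable_expA.comp (by fun_prop)).inv.aestronglyMeasurable) (ae_of_all _ fun x => ?_)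
  have hE := W.expA_pos (h * ‖x‖)
  rw [Real.norm_of_nonneg (by positivity), Real.rpow_neg (by positivity),
    show (d : ℝ) + 1 = ((d + 1 : ℕ) : ℝ) by push_cast; ring, Real.rpow_natCast,
    ← div_eq_mul_inv, inv_le_comm₀ hE (by positivity), inv_div, div_le_iff₀ (by positivity)]
  have hx := norm_nonneg x
  have h1 := W.pow_div_le_expA (ρ := h * ‖x‖) (by positivity) (d + 1)
  have h2 := W.one_le_expA (h * ‖x‖)
  rw [mul_pow, div_le_iff₀ hA] at h1
  have h3 : (1 + ‖x‖) ^ (d + 1) ≤ 2 ^ (d + 1) * (1 + ‖x‖ ^ (d + 1)) := by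
    have : (1 + ‖x‖) ^ (d + 1) ≤ (2 * max 1 ‖x‖) ^ (d + 1) := by
      gcongr
      linarith [le_max_left 1 ‖x‖, le_max_right 1 ‖x‖]
    refine this.trans ?_
    rw [mul_pow]
    gcongr
    rcases le_total 1 ‖x‖ with h | h
    · rw [max_eq_right h]; linarith
    · rw [max_eq_left h, one_pow]; linarith [pow_nonneg hx (d + 1)]
  refine h3.trans ?_
  rw [mul_left_comm]
  refine mul_le_mul_of_nonneg_left ?_ (by positivity)
  rw [mul_add, mul_one]
  refine add_le_add h2 ?_
  rw [mul_div_assoc', le_div_iff₀ (by positivity)]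
  linarith

theorem M_ratio_mono {p q : ℕ} (h : p ≤ q) :
    W.M (p + 1) / W.M p ≤ W.M (q + 1) / W.M q := by
  refine monotone_nat_of_le_succ (f := fun p => W.M (p + 1) / W.M p) (fun p => ?_) h
  have h1 := W.M_pos p
  have h2 := W.M_pos (p + 1)
  rw [div_le_div_iff₀ h1 h2]
  have := W.M_logConvex p
  nlinarith

/-- Passing from `q` to `q + 1` multiplies the left side by `M (q + 1) / M q` and the right side by
the ratio at `p + q`, which is at least as large by log-convexity. -/
theorem M_mul_le (p q : ℕ) : W.M p * W.M q ≤ W.M (p + q) := by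
  induction q with
  | zero => simp [W.M_zero]
  | succ q ih =>
    have h0 := W.M_pos q
    have h1 := W.M_pos (p + q)
    have h2 := W.M_ratio_mono (Nat.le_add_left q p)
    have h3 := W.M_pos (q + 1)
    rw [div_le_div_iff₀ h0 h1] at h2
    have h4 : W.M p * W.M q * W.M (q + 1) ≤ W.M (p + q) * W.M (q + 1) := by gcongr
    have : W.M p * W.M (q + 1) * W.M q ≤ W.M (p + (q + 1)) * W.M q := by
      rw [← add_assoc]
      linarith
    exact le_of_mul_le_mul_right this h0

theorem prod_M_le {ι : Type*} (s : Finset ι) (α : ι → ℕ) :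
    ∏ i ∈ s, W.M (α i) ≤ W.M (∑ i ∈ s, α i) := by
  induction s using Finset.cons_induction with
  | empty => simp [W.M_zero]
  | cons i s hi ih =>
    rw [Finset.prod_cons, Finset.sum_cons]
    refine le_trans ?_ (W.M_mul_le _ _)
    have := W.M_pos (α i)
    gcongr

end WeightSeqs

/-! ### Smooth functions from families of partial derivatives -/

variable {d : ℕ}

/-- The linear form with prescribed values on the coordinate vectors. -/
def gradForm (a : Fin d → ℂ) : EuclideanSpace ℝ (Fin d) →L[ℝ] ℂ :=
  ∑ i, (EuclideanSpace.proj i : EuclideanSpace ℝ (Fin d) →L[ℝ] ℝ).smulRight (a i)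

theorem gradForm_def (a : Fin d → ℂ) : gradForm a =
    ∑ i, (EuclideanSpace.proj i : EuclideanSpace ℝ (Fin d) →L[ℝ] ℝ).smulRight (a i) := rfl

theorem gradForm_apply (a : Fin d → ℂ) (v : EuclideanSpace ℝ (Fin d)) :
    gradForm a v = ∑ i, (v i : ℂ) * a i := by
  simp [gradForm]

theorem gradForm_single (a : Fin d → ℂ) (i : Fin d) :
    gradForm a (EuclideanSpace.single i 1) = a i := by
  rw [gradForm_apply, Finset.sum_eq_single i]
  · simp
  · intro j _ hj; simp [hj]
  · simp

theorem eq_gradForm (L : EuclideanSpace ℝ (Fin d) →L[ℝ] ℂ) :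
    L = gradForm fun i => L (EuclideanSpace.single i 1) := by
  refine ContinuousLinearMap.coe_injective
    ((EuclideanSpace.basisFun (Fin d) ℝ).toBasis.ext fun i => ?_)
  simp [gradForm_single]

theorem norm_gradForm_le (a : Fin d → ℂ) : ‖gradForm a‖ ≤ ∑ i, ‖a i‖ := by
  refine ContinuousLinearMap.opNorm_le_bound _ (by positivity) fun v => ?_
  rw [gradForm_apply, Finset.sum_mul]
  refine (norm_sum_le _ _).trans (Finset.sum_le_sum fun i _ => ?_)
  rw [norm_mul, mul_comm]
  gcongr
  simpa using PiLp.norm_apply_le v i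

/-- A family of functions whose members are the successive partial derivatives of each other. -/
def IsDerivFamily (G : (Fin d → ℕ) → EuclideanSpace ℝ (Fin d) → ℂ) : Prop :=
  ∀ α x, HasFDerivAt (G α) (gradForm fun i => G (α + Pi.single i 1) x) x

namespace IsDerivFamily

variable {G : (Fin d → ℕ) → EuclideanSpace ℝ (Fin d) → ℂ}

/-- The derivative of each member is built linearly from other members, so `C^n` for all members at
once gives `C^(n+1)` for all of them. -/
theorem contDiff (hG : IsDerivFamily G) (α : Fin d → ℕ) : ContDiff ℝ (⊤ : ℕ∞) (G α) := by
  refine contDiff_infty.2 fun n => ?_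
  induction n generalizing α with
  | zero =>
    exact contDiff_zero.2 (continuous_iff_continuousAt.2 fun x => (hG α x).continuousAt)
  | succ n ih =>
    push_cast
    refine contDiff_succ_iff_hasFDerivAt.2 ⟨_, ?_, hG α⟩
    unfold gradForm
    refine ContDiff.sum fun i _ => ?_
    exact (ContinuousLinearMap.smulRightL ℝ (EuclideanSpace ℝ (Fin d)) ℂ
      (EuclideanSpace.proj i)).contDiff.comp (ih _)

theorem partialDeriv_eq (hG : IsDerivFamily G) (i : Fin d) (α : Fin d → ℕ) :
    partialDeriv i ⟨G α, hG.contDiff α⟩ = ⟨G (α + Pi.single i 1), hG.contDiff _⟩ := by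
  refine Subtype.ext (funext fun x => ?_)
  change fderiv ℝ (G α) x _ = _
  rw [(hG α x).fderiv, gradForm_single]

theorem partialDeriv_pow_eq (hG : IsDerivFamily G) (i : Fin d) (n : ℕ) (α : Fin d → ℕ) :
    (partialDeriv i ^ n) ⟨G α, hG.contDiff α⟩ = ⟨G (α + Pi.single i n), hG.contDiff _⟩ := by
  induction n with
  | zero => simp
  | succ n ih =>
    rw [pow_succ', Module.End.mul_apply, ih, hG.partialDeriv_eq]
    simp only [add_assoc, ← Pi.single_add]

theorem multiDeriv_eq (hG : IsDerivFamily G) (β : Fin d → ℕ) (α : Fin d → ℕ) :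
    multiDeriv β ⟨G α, hG.contDiff α⟩ = ⟨G (α + β), hG.contDiff _⟩ := by
  have key : ∀ l : List (Fin d), (l.map fun i => partialDeriv i ^ β i).prod ⟨G α, hG.contDiff α⟩ =
      ⟨G (α + (l.map fun i => Pi.single i (β i)).sum), hG.contDiff _⟩ := by
    intro l
    induction l with
    | nil => simp
    | cons i l ih =>
      rw [List.map_cons, List.prod_cons, Module.End.mul_apply, ih, hG.partialDeriv_pow_eq]
      simp only [List.map_cons, List.sum_cons, add_assoc, 
        add_comm (Pi.single i (β i) : Fin d → ℕ)]
  have hs : ((List.finRange d).map fun i => (Pi.single i (β i) : Fin d → ℕ)).sum = β := by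
    rw [← List.ofFn_eq_map, List.sum_ofFn]
    exact Finset.univ_sum_single β
  rw [multiDeriv, key, hs]

theorem multiDeriv_zero_eq (hG : IsDerivFamily G) (β : Fin d → ℕ) :
    multiDeriv β ⟨G 0, hG.contDiff 0⟩ = ⟨G β, hG.contDiff _⟩ := by
  rw [hG.multiDeriv_eq]
  simp only [zero_add]

end IsDerivFamily

theorem multiDeriv_zero (f : Smooth d) : multiDeriv 0 f = f := by
  have : ((List.finRange d).map fun i => partialDeriv i ^ (0 : Fin d → ℕ) i).prod = 1 := by
    refine List.prod_eq_one fun x hx => ?_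
    obtain ⟨i, -, rfl⟩ := List.mem_map.1 hx
    simp
  rw [multiDeriv, this, Module.End.one_apply]

theorem multiDeriv_single (i : Fin d) (f : Smooth d) :
    multiDeriv (Pi.single i 1) f = partialDeriv i f := by
  have key : ∀ l : List (Fin d), l.Nodup →
      (l.map fun j => partialDeriv j ^ (Pi.single i 1 : Fin d → ℕ) j).prod =
        if i ∈ l then partialDeriv i else 1 := by
    intro l hl
    induction l with
    | nil => simp
    | cons j l ih =>
      rw [List.nodup_cons] at hl
      rw [List.map_cons, List.prod_cons, ih hl.2]
      rcases eq_or_ne i j with rfl | h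
      · simp [hl.1]
      · simp [h]
  rw [multiDeriv, key _ (List.nodup_finRange d), if_pos (List.mem_finRange i)]

theorem isDerivFamily_multiDeriv (f : Smooth d) :
    IsDerivFamily fun α => (multiDeriv α f).1 := by
  intro α x
  have hd : DifferentiableAt ℝ (multiDeriv α f).1 x :=
    ((Smooth.contDiff _).differentiable (by simp)) x
  convert hd.hasFDerivAt using 1
  rw [eq_gradForm (fderiv ℝ (multiDeriv α f).1 x)]
  congr 1
  funext i
  change (multiDeriv (α + Pi.single i 1) f).1 x = _
  rw [add_comm, ← multiDeriv_add, multiDeriv_single]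
  rfl

end UltraTI

namespace UltraTI

/-! ### An entire function with rapidly decreasing derivatives -/

/-- For decreasing terms, `(k - N) a_k` is at most the block sum over `[N, k)`, which is small by
the Cauchy criterion. -/
theorem tendsto_mul_of_antitone_summable {a : ℕ → ℝ} (ha : Antitone a) (h0 : ∀ k, 0 ≤ a k)
    (hs : Summable a) {ε : ℝ} (hε : 0 < ε) : ∃ N, ∀ k, N ≤ k → k * a k ≤ ε := by
  obtain ⟨s, hs⟩ := hs.vanishing (Metric.ball_mem_nhds (0 : ℝ) (half_pos (half_pos hε)))
  obtain ⟨N, hN⟩ := s.exists_nat_subset_range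
  -- From `k ≥ 2N + 2` one gets `k ≤ 2 (k - N)`, so the bound on the block sum controls `k a_k`.
  refine ⟨2 * N + 2, fun k hk => ?_⟩
  have hd : Disjoint (Finset.Ico N k) s := by
    refine Finset.disjoint_left.2 fun x hx hxs => ?_
    have := Finset.mem_range.1 (hN hxs)
    have := (Finset.mem_Ico.1 hx).1
    omega
  have h1 := hs _ hd
  rw [mem_ball_zero_iff, Real.norm_eq_abs] at h1
  have h2 : (Finset.Ico N k).card • a k ≤ ∑ i ∈ Finset.Ico N k, a i :=
    Finset.card_nsmul_le_sum _ _ _ fun i hi => ha (Finset.mem_Ico.1 hi).2.le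
  rw [Nat.card_Ico, nsmul_eq_mul, Nat.cast_sub (by omega)] at h2
  have h3 : (2 * N + 2 : ℝ) ≤ k := by exact_mod_cast hk
  have h4 := (le_abs_self _).trans h1.le
  have := h0 k
  nlinarith

/-- Put `m_q = M (q+1) / M q`. By `M_strongNQA` the series of `m_q^(-s)` converges, and its terms
decrease, so `q = o(m_q^s)`. As `m_q ≥ 1`, eventually `q + 1 ≤ L m_q^n` for `n ≥ s`, and multiplying
these inequalities gives the claim. The exponent `n` is fixed before `L`; arbitrary `L` is what
estimates for all `h` need. -/
theorem WeightSeqs.exists_factorial_le (W : WeightSeqs) : ∃ n : ℕ, Even n ∧ 2 ≤ n ∧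
    ∀ L : ℝ, 0 < L → ∃ C : ℝ, 0 < C ∧ ∀ p : ℕ, (p.factorial : ℝ) ≤ C * L ^ p * W.M p ^ n := by
  obtain ⟨s, hs, c, hc, h⟩ := W.M_strongNQA
  obtain ⟨k, hk⟩ := exists_nat_ge s
  -- Even, so that `exp(-ξ^n)` decays at both ends of the real line; at least `s`, as `k ≥ s`.
  refine ⟨2 * (k + 1), ⟨k + 1, by ring⟩, by omega, fun L hL => ?_⟩
  set n := 2 * (k + 1) with hn
  have hsum := (h 1 le_rfl).1
  have hr : ∀ q, 0 < W.M (q + 1) / W.M q := fun q => div_pos (W.M_pos _) (W.M_pos _)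
  have hr1 : ∀ q, 1 ≤ W.M (q + 1) / W.M q := fun q => by
    simpa [W.M_zero, W.M_one] using W.M_ratio_mono (Nat.zero_le q)
  have heq : ∀ q, W.M q ^ s / W.M (q + 1) ^ s = ((W.M (q + 1) / W.M q) ^ s)⁻¹ := fun q => by
    rw [Real.div_rpow (W.M_pos _).le (W.M_pos _).le, inv_div]
  have hanti : Antitone fun k : ℕ => W.M (1 + k) ^ s / W.M (1 + k + 1) ^ s := by
    intro i j hij
    simp only [heq]
    have := W.M_ratio_mono (show 1 + i ≤ 1 + j by omega)
    have := hr (1 + i)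
    gcongr
  obtain ⟨N, hN⟩ := tendsto_mul_of_antitone_summable hanti
    (fun k => by rw [heq]; exact inv_nonneg.2 (Real.rpow_nonneg (hr _).le _)) hsum
    (ε := L / 2) (by positivity)
  -- With `p = 1 + j`, the shift by `3` gives `j ≥ 2`, hence `p + 1 ≤ 2 j`; this is why `ε` was
  -- taken as `L / 2`.
  have step : ∀ p : ℕ, N + 3 ≤ p → ((p + 1 : ℕ) : ℝ) ≤ L * (W.M (p + 1) / W.M p) ^ n := by
    intro p hp
    obtain ⟨j, rfl⟩ := Nat.exists_eq_add_of_le (show 1 ≤ p by omega)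
    have h1 := hN j (by omega)
    simp only [heq] at h1
    have h2 : 0 < (W.M (1 + j + 1) / W.M (1 + j)) ^ s := Real.rpow_pos_of_pos (hr _) _
    rw [← div_eq_mul_inv, div_le_iff₀ h2] at h1
    have h3 : (W.M (1 + j + 1) / W.M (1 + j)) ^ s ≤ (W.M (1 + j + 1) / W.M (1 + j)) ^ n := by
      rw [← Real.rpow_natCast]
      refine Real.rpow_le_rpow_of_exponent_le (hr1 _) (hk.trans ?_)
      rw [hn]; push_cast
      have : (0 : ℝ) ≤ k := by positivity
      linarith
    have h4 : ((1 + j + 1 : ℕ) : ℝ) ≤ 2 * j := by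
      exact_mod_cast (by omega : 1 + j + 1 ≤ 2 * j)
    nlinarith
  have hfin : ∃ C : ℝ, 0 < C ∧ ∀ p : ℕ, p ≤ N + 3 →
      (p.factorial : ℝ) ≤ C * L ^ p * W.M p ^ n := by
    refine ⟨∑ p ∈ Finset.range (N + 4), (p.factorial : ℝ) / (L ^ p * W.M p ^ n),
      Finset.sum_pos (fun p _ => ?_) (by simp), fun p hp => ?_⟩
    · have := W.M_pos p
      positivity
    · have := W.M_pos p
      rw [mul_assoc, ← div_le_iff₀ (by positivity)]
      refine Finset.single_le_sum
        (f := fun p : ℕ => (p.factorial : ℝ) / (L ^ p * W.M p ^ n)) (fun q _ => ?_) ?_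
      · have := W.M_pos q
        positivity
      · rw [Finset.mem_range]; omega
  obtain ⟨C, hC, hfin⟩ := hfin
  refine ⟨C, hC, fun p => ?_⟩
  induction p with
  | zero => exact hfin 0 (by omega)
  | succ p ih =>
    rcases le_or_gt (p + 1) (N + 3) with hp | hp
    · exact hfin _ hp
    have h1 := step p (by omega)
    have hM := W.M_pos p
    have hrp := hr p
    rw [Nat.factorial_succ, Nat.cast_mul]
    calc ((p + 1 : ℕ) : ℝ) * (p.factorial : ℝ)
        ≤ (L * (W.M (p + 1) / W.M p) ^ n) * (C * L ^ p * W.M p ^ n) := by gcongr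
      _ = C * L ^ (p + 1) * W.M (p + 1) ^ n := by
        rw [div_pow, pow_succ]; field_simp

/-- `(1 + x)^n ≤ 3/2` for small `x`, so the shift by `a` is harmless for large `t` and bounded
otherwise. Since `3/2 < 2`, it leaves `Re (ξ + iη)^n ≥ ξ^n / 2 - C` on a strip. -/
theorem exists_add_pow_le (n : ℕ) {a : ℝ} (ha : 0 ≤ a) :
    ∃ C : ℝ, 0 ≤ C ∧ ∀ t : ℝ, 0 ≤ t → (t + a) ^ n ≤ 3 / 2 * t ^ n + C := by
  have hcont : Tendsto (fun x : ℝ => (1 + x) ^ n) (𝓝 0) (𝓝 ((1 + 0) ^ n)) :=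
    Continuous.tendsto (by fun_prop) 0
  rw [add_zero, one_pow] at hcont
  obtain ⟨δ, hδ, hball⟩ := Metric.eventually_nhds_iff.1
    (hcont.eventually (ge_mem_nhds (show (1 : ℝ) < 3 / 2 by norm_num)))
  have hδ2 : (1 + δ / 2) ^ n ≤ 3 / 2 := hball (by
    rw [Real.dist_0_eq_abs, abs_of_pos (by positivity)]; linarith)
  refine ⟨(a / (δ / 2) + a) ^ n, by positivity, fun t ht => ?_⟩
  rcases le_total a (δ / 2 * t) with h | h
  · calc (t + a) ^ n ≤ ((1 + δ / 2) * t) ^ n := by gcongr; linarith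
      _ = (1 + δ / 2) ^ n * t ^ n := mul_pow _ _ _
      _ ≤ 3 / 2 * t ^ n := by gcongr
      _ ≤ _ := le_add_of_nonneg_right (by positivity)
  · have : t ≤ a / (δ / 2) := by rw [le_div_iff₀ (by positivity)]; linarith
    calc (t + a) ^ n ≤ (a / (δ / 2) + a) ^ n := by gcongr
      _ ≤ _ := le_add_of_nonneg_left (by positivity)

theorem norm_add_pow_sub_pow_le (x y : ℂ) (n : ℕ) :
    ‖(x + y) ^ n - x ^ n‖ ≤ (‖x‖ + ‖y‖) ^ n - ‖x‖ ^ n := by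
  induction n with
  | zero => simp
  | succ n ih =>
    have : (x + y) ^ (n + 1) - x ^ (n + 1) = (x + y) * ((x + y) ^ n - x ^ n) + y * x ^ n := by ring
    rw [this]
    calc _ ≤ ‖x + y‖ * ‖(x + y) ^ n - x ^ n‖ + ‖y‖ * ‖x‖ ^ n := by
          refine (norm_add_le _ _).trans_eq ?_
          rw [norm_mul, norm_mul, norm_pow]
      _ ≤ (‖x‖ + ‖y‖) * ((‖x‖ + ‖y‖) ^ n - ‖x‖ ^ n) + ‖y‖ * ‖x‖ ^ n := by
          gcongr
          exact norm_add_le _ _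
      _ = _ := by ring

/-- Shifting the line of integration. -/
theorem integral_eq_integral_add_mul_I {g : ℂ → ℂ} (hg : Differentiable ℂ g) (a : ℝ) {B : ℝ → ℝ}
    (hB : Integrable B) (hT : Tendsto B atTop (𝓝 0)) (hBot : Tendsto B atBot (𝓝 0))
    (hb : ∀ ξ η : ℝ, |η| ≤ |a| → ‖g (ξ + η * Complex.I)‖ ≤ B ξ) :
    ∫ ξ : ℝ, g ξ = ∫ ξ : ℝ, g (ξ + a * Complex.I) := by
  have hgc := hg.continuous
  have hint : ∀ η : ℝ, |η| ≤ |a| → Integrable fun ξ : ℝ => g (ξ + η * Complex.I) := by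
    intro η hη
    exact hB.mono' (by fun_prop) (ae_of_all _ fun ξ => hb ξ η hη)
  have h0 : Integrable fun ξ : ℝ => g ξ := by simpa using hint 0 (by simp)
  have ha := hint a le_rfl
  have l0 := intervalIntegral_tendsto_integral h0 tendsto_neg_atTop_atBot tendsto_id
  have la := intervalIntegral_tendsto_integral ha tendsto_neg_atTop_atBot tendsto_id
  have hy : ∀ y ∈ Set.uIoc 0 a, |y| ≤ |a| := fun y hy => by
    have := Set.abs_sub_left_of_mem_uIcc (Set.uIoc_subset_uIcc hy)
    simpa using this
  have lr : Tendsto (fun T : ℝ => Complex.I • ∫ y : ℝ in (0 : ℝ)..a, g ((T : ℝ) + y * Complex.I))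
      atTop (𝓝 0) := by
    refine squeeze_zero_norm (a := fun T => B T * |a - 0|) (fun T => ?_)
      (by simpa using hT.mul_const |a - 0|)
    rw [norm_smul, Complex.norm_I, one_mul]
    exact intervalIntegral.norm_integral_le_of_norm_le_const fun y h => hb T y (hy y h)
  have ll : Tendsto (fun T : ℝ => Complex.I • ∫ y : ℝ in (0 : ℝ)..a,
      g (((-T : ℝ) : ℂ) + y * Complex.I)) atTop (𝓝 0) := by
    refine squeeze_zero_norm (a := fun T => B (-T) * |a - 0|) (fun T => ?_)
      (by simpa using (hBot.comp tendsto_neg_atTop_atBot).mul_const |a - 0|)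
    rw [norm_smul, Complex.norm_I, one_mul]
    exact intervalIntegral.norm_integral_le_of_norm_le_const fun y h => hb (-T) y (hy y h)
  have key := ((l0.sub la).add lr).sub ll
  have hz : ∀ T : ℝ,
      ((∫ x : ℝ in (-T)..(id T), g x) - ∫ x : ℝ in (-T)..(id T), g (x + a * Complex.I)) +
      (Complex.I • ∫ y : ℝ in (0 : ℝ)..a, g ((T : ℝ) + y * Complex.I)) -
      (Complex.I • ∫ y : ℝ in (0 : ℝ)..a, g (((-T : ℝ) : ℂ) + y * Complex.I)) = 0 := by
    intro T
    have := Complex.integral_boundary_rect_eq_zero_of_differentiableOn g (-T : ℝ)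
      (T + a * Complex.I) hg.differentiableOn
    simpa using this
  have := tendsto_nhds_unique (key.congr hz) tendsto_const_nhds
  simpa [sub_eq_zero] using this

/-- On a strip `|exp(-z^n)|` is at most a constant times `exp(-ξ^n / 2)`. Half of this decay pays
for `|2πz|^p / (h^p M_p)`, uniformly in `p`; the other half leaves a Gaussian. -/
theorem exists_norm_pow_mul_exp_le (W : WeightSeqs) : ∃ n : ℕ, Even n ∧ 2 ≤ n ∧
    ∀ a h : ℝ, 0 ≤ a → 0 < h → ∃ C : ℝ, 0 < C ∧ ∀ (p : ℕ) (ξ η : ℝ), |η| ≤ a →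
      ‖(-2 * Real.pi * Complex.I * (ξ + η * Complex.I)) ^ p *
        Complex.exp (-(ξ + η * Complex.I) ^ n)‖ ≤
        C * h ^ p * W.M p * Real.exp (-(1 / 4) * ξ ^ 2) := by
  obtain ⟨n, hne, hn, hfac⟩ := W.exists_factorial_le
  refine ⟨n, hne, hn, fun a h ha hh => ?_⟩
  obtain ⟨C₁, hC₁, hpoly⟩ := exists_add_pow_le n ha
  have hpi := Real.pi_pos
  -- The divisor `6` turns the factor `3/2` of `hpoly` into `1/4`, half of the available exponent
  -- `ξ^n / 2`.
  obtain ⟨C₂, hC₂, hfac⟩ := hfac ((h / (2 * Real.pi)) ^ n / 6) (by positivity)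
  refine ⟨(1 + C₂) * Real.exp (7 / 6 * C₁ + 1 / 4), by positivity, fun p ξ η hη => ?_⟩
  have hM := W.M_pos p
  have hz : ‖(ξ : ℂ) + η * Complex.I‖ ≤ |ξ| + a := by
    refine (norm_add_le _ _).trans ?_
    simpa using hη
  have hx0 : 0 ≤ |ξ| := abs_nonneg ξ
  have hxn : |ξ| ^ n = ξ ^ n := hne.pow_abs ξ
  have hpo := hpoly |ξ| hx0
  have hre : ξ ^ n / 2 - C₁ ≤ (((ξ : ℂ) + η * Complex.I) ^ n).re := by
    have h1 := norm_add_pow_sub_pow_le (ξ : ℂ) (η * Complex.I) n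
    have h2 := (Complex.abs_re_le_norm _).trans h1
    simp only [norm_mul, Complex.norm_real, Real.norm_eq_abs, Complex.norm_I, mul_one] at h2
    have h3 : (|ξ| + |η|) ^ n ≤ (|ξ| + a) ^ n := by gcongr
    have h4 : ((ξ : ℂ) ^ n).re = ξ ^ n := by
      rw [← Complex.ofReal_pow, Complex.ofReal_re]
    rw [Complex.sub_re, h4] at h2
    have h5 := neg_le_of_abs_le h2
    linarith
  have hsq : ξ ^ 2 - 1 ≤ ξ ^ n := by
    rw [← hxn, ← sq_abs ξ]
    rcases le_total 1 |ξ| with h1 | h1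
    · have := pow_le_pow_right₀ h1 hn
      linarith
    · have : |ξ| ^ 2 ≤ 1 := pow_le_one₀ hx0 h1
      have : 0 ≤ |ξ| ^ n := by positivity
      linarith
  set ρ := 2 * Real.pi * (|ξ| + a) / h with hρ
  have hρ0 : 0 ≤ ρ := by positivity
  have hρp : ρ ^ p ≤ W.M p * ((1 + C₂) * Real.exp (ξ ^ n / 4 + C₁ / 6)) := by
    have hexp : (h / (2 * Real.pi)) ^ n / 6 * ρ ^ n ≤ ξ ^ n / 4 + C₁ / 6 := by
      have : (h / (2 * Real.pi)) ^ n / 6 * ρ ^ n = (|ξ| + a) ^ n / 6 := by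
        rw [hρ, div_mul_eq_mul_div, ← mul_pow]
        congr 2
        field_simp
      rw [this]; linarith
    -- The factorial estimate bounds the `n`-th power of `ρ^p / M_p` by a term of the series of
    -- `exp(L ρ^n)`. The power is dropped below by comparing `ρ^p / M_p` with `1`.
    have hx : (ρ ^ p / W.M p) ^ n ≤ C₂ * Real.exp (ξ ^ n / 4 + C₁ / 6) := by
      have h1 := Real.pow_div_factorial_le_exp
        (x := (h / (2 * Real.pi)) ^ n / 6 * ρ ^ n) (by positivity) p
      have h2 := h1.trans (Real.exp_le_exp.2 hexp)
      rw [div_pow, ← pow_mul, mul_comm p n, pow_mul, div_le_iff₀ (by positivity)]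
      rw [div_le_iff₀ (by positivity)] at h2
      set L := (h / (2 * Real.pi)) ^ n / 6 with hL
      have hLp : 0 < L := by positivity
      set e := Real.exp (ξ ^ n / 4 + C₁ / 6)
      have h3 : L ^ p * (ρ ^ n) ^ p ≤ L ^ p * (C₂ * e * W.M p ^ n) := by
        calc L ^ p * (ρ ^ n) ^ p = (L * ρ ^ n) ^ p := (mul_pow _ _ _).symm
          _ ≤ e * p.factorial := h2
          _ ≤ e * (C₂ * L ^ p * W.M p ^ n) := by gcongr; exact hfac p
          _ = _ := by ring
      exact le_of_mul_le_mul_left h3 (by positivity)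
    have he : 1 ≤ Real.exp (ξ ^ n / 4 + C₁ / 6) := by
      refine Real.one_le_exp ?_
      rw [← hxn]; positivity
    rw [← div_le_iff₀' hM]
    rcases le_total 1 (ρ ^ p / W.M p) with h1 | h1
    · refine (le_self_pow₀ h1 (by omega)).trans (hx.trans ?_)
      gcongr; linarith
    · refine h1.trans ?_
      nlinarith
  rw [norm_mul, norm_pow, Complex.norm_exp, Complex.neg_re]
  have hn1 : ‖-2 * (Real.pi : ℂ) * Complex.I * (ξ + η * Complex.I)‖ ≤ h * ρ := by
    rw [norm_mul]
    simp only [norm_mul, norm_neg, Complex.norm_I, mul_one, Complex.norm_real, Real.norm_eq_abs,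
      abs_of_pos hpi, Complex.norm_ofNat]
    rw [hρ, mul_div_cancel₀ _ hh.ne']
    gcongr
  calc _ ≤ (h * ρ) ^ p * Real.exp (-(ξ ^ n / 2 - C₁)) := by gcongr
    _ = h ^ p * Real.exp (-(ξ ^ n / 2 - C₁)) * ρ ^ p := by rw [mul_pow]; ring
    _ ≤ h ^ p * Real.exp (-(ξ ^ n / 2 - C₁)) *
        (W.M p * ((1 + C₂) * Real.exp (ξ ^ n / 4 + C₁ / 6))) := by gcongr
    _ = (1 + C₂) * h ^ p * W.M p *
        Real.exp (-(ξ ^ n / 2 - C₁) + (ξ ^ n / 4 + C₁ / 6)) := by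
        rw [Real.exp_add (-(ξ ^ n / 2 - C₁))]; ring
    _ ≤ (1 + C₂) * h ^ p * W.M p * Real.exp ((7 / 6 * C₁ + 1 / 4) + -(1 / 4) * ξ ^ 2) := by
        refine mul_le_mul_of_nonneg_left (Real.exp_le_exp.2 (by linarith)) (by positivity)
    _ = _ := by rw [Real.exp_add (7 / 6 * C₁ + 1 / 4)]; ring

-- `f p` is the Fourier transform of `(-2πiz)^p exp(-z^n)`, so differentiation raises `p` by one.
-- Its derivatives are controlled by `exists_norm_pow_mul_exp_le`, its decay by moving the line of
-- integration, and its integral is `exp(-0^n) = 1` by Fourier inversion.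
open FourierTransform in
theorem exists_entire_mollifier (W : WeightSeqs) : ∃ f : ℕ → ℝ → ℂ,
    (∀ p x, HasDerivAt (f p) (f (p + 1) x) x) ∧
    (∀ a h : ℝ, 0 ≤ a → 0 < h → ∃ C : ℝ, 0 < C ∧
      ∀ p x, ‖f p x‖ ≤ C * h ^ p * W.M p * Real.exp (-a * |x|)) ∧
    ∫ x, f 0 x = 1 := by
  obtain ⟨n, hne, hn, hb⟩ := exists_norm_pow_mul_exp_le W
  have hpi := Real.pi_pos
  set g : ℕ → ℂ → ℂ := fun p z => (-2 * Real.pi * Complex.I * z) ^ p * Complex.exp (-z ^ n)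
    with hg
  have hgd : ∀ p, Differentiable ℂ (g p) := fun p => by simp only [hg]; fun_prop
  have hgauss : Integrable fun ξ : ℝ => Real.exp (-(1 / 4) * ξ ^ 2) :=
    integrable_exp_neg_mul_sq (by norm_num)
  have hgc : ∀ p, Continuous (g p) := fun p => (hgd p).continuous
  have hgi : ∀ p, Integrable fun ξ : ℝ => g p ξ := by
    intro p
    obtain ⟨C, -, hC⟩ := hb 0 1 le_rfl one_pos
    refine (hgauss.const_mul (C * 1 ^ p * W.M p)).mono' (by have := hgc p; fun_prop)
      (ae_of_all _ fun ξ => ?_)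
    have := hC p ξ 0 (by simp)
    rwa [Complex.ofReal_zero, zero_mul, add_zero] at this
  have hmul : ∀ p (ξ : ℝ), (-2 * ↑Real.pi * Complex.I * ↑ξ) • g p ξ = g (p + 1) ξ := by
    intro p ξ
    simp only [hg, smul_eq_mul, pow_succ]; ring
  have hderiv : ∀ p x, HasDerivAt (𝓕 fun ξ : ℝ => g p ξ) ((𝓕 fun ξ : ℝ => g (p + 1) ξ) x) x := by
    intro p x
    have h1 : Integrable fun ξ : ℝ => ξ • g p ξ := by
      have := (hgi (p + 1)).const_mul ((-2 * Real.pi * Complex.I)⁻¹)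
      refine this.congr (ae_of_all _ fun ξ => ?_)
      simp only
      rw [← hmul, smul_eq_mul, Complex.real_smul]
      field_simp
    have := Real.hasDerivAt_fourier (hgi p) h1 x
    simpa only [hmul] using this
  have hbound : ∀ a h : ℝ, 0 ≤ a → 0 < h → ∃ C : ℝ, 0 < C ∧
      ∀ p x, ‖(𝓕 fun ξ : ℝ => g p ξ) x‖ ≤ C * h ^ p * W.M p * Real.exp (-a * |x|) := by
    intro a h ha hh
    obtain ⟨C, hC, hCb⟩ := hb (a / (2 * Real.pi)) h (by positivity) hh
    have hI : 0 < ∫ ξ : ℝ, Real.exp (-(1 / 4) * ξ ^ 2) := by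
      rw [integral_gaussian]; positivity
    refine ⟨C * ∫ ξ : ℝ, Real.exp (-(1 / 4) * ξ ^ 2), by positivity, fun p x => ?_⟩
    have hM := W.M_pos p
    -- The line is shifted by `a / (2π)` to the side opposite to the sign of `x`, so that the kernel
    -- contributes `exp(-a|x|)`.
    obtain ⟨b, hba, hbx⟩ : ∃ b : ℝ, |b| = a / (2 * Real.pi) ∧ 2 * Real.pi * b * x = -a * |x| := by
      rcases le_total 0 x with hx | hx
      · refine ⟨-(a / (2 * Real.pi)), by rw [abs_neg, abs_of_nonneg (by positivity)], ?_⟩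
        rw [abs_of_nonneg hx]; field_simp
      · refine ⟨a / (2 * Real.pi), abs_of_nonneg (by positivity), ?_⟩
        rw [abs_of_nonpos hx]; field_simp
    set G : ℂ → ℂ := fun z => Complex.exp (-2 * Real.pi * Complex.I * z * x) * g p z with hG
    have hGd : Differentiable ℂ G := by
      have := hgd p
      simp only [hG]; fun_prop
    have hnorm : ∀ ξ η : ℝ, |η| ≤ |b| → ‖G (ξ + η * Complex.I)‖ ≤
        Real.exp (2 * Real.pi * η * x) *
          (C * h ^ p * W.M p * Real.exp (-(1 / 4) * ξ ^ 2)) := by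
      intro ξ η hη
      simp only [hG]
      rw [norm_mul, Complex.norm_exp]
      refine mul_le_mul (le_of_eq ?_) (hCb p ξ η (hη.trans_eq hba)) (norm_nonneg _) (by positivity)
      congr 1
      simp
    have htend : ∀ F : Filter ℝ, Tendsto (fun ξ : ℝ => ξ ^ 2) F atTop → Tendsto (fun ξ : ℝ =>
        Real.exp (2 * Real.pi * |b| * |x|) * (C * h ^ p * W.M p * Real.exp (-(1 / 4) * ξ ^ 2)))
        F (𝓝 0) := by
      intro F hF
      have h1 : Tendsto (fun ξ : ℝ => Real.exp (-(1 / 4) * ξ ^ 2)) F (𝓝 0) :=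
        Real.tendsto_exp_atBot.comp (hF.const_mul_atTop_of_neg (by norm_num))
      simpa using (h1.const_mul (C * h ^ p * W.M p)).const_mul (Real.exp (2 * Real.pi * |b| * |x|))
    have hshift := integral_eq_integral_add_mul_I hGd b
      ((hgauss.const_mul (C * h ^ p * W.M p)).const_mul (Real.exp (2 * Real.pi * |b| * |x|)))
      (htend _ (tendsto_pow_atTop two_ne_zero))
      (htend _ (by
        have := (tendsto_pow_atTop (α := ℝ) two_ne_zero).comp tendsto_neg_atBot_atTop
        simpa [Function.comp_def] using this))
      (fun ξ η hη => (hnorm ξ η hη).trans (by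
        have h1 : η * x ≤ |b| * |x| := by
          refine (le_abs_self _).trans ?_
          rw [abs_mul]
          gcongr
        refine mul_le_mul_of_nonneg_right (Real.exp_le_exp.2 ?_) (by positivity)
        rw [mul_assoc, mul_assoc (2 * Real.pi)]
        gcongr))
    have hF : (𝓕 fun ξ : ℝ => g p ξ) x = ∫ ξ : ℝ, G ξ := by
      rw [Real.fourier_real_eq_integral_exp_smul]
      refine integral_congr_ae (ae_of_all _ fun ξ => ?_)
      simp only [hG, smul_eq_mul]
      congr 2
      push_cast; ring
    rw [hF, hshift]
    refine (norm_integral_le_of_norm_le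
      ((hgauss.const_mul (C * h ^ p * W.M p)).const_mul (Real.exp (2 * Real.pi * b * x)))
      (ae_of_all _ fun ξ => hnorm ξ b le_rfl)).trans_eq ?_
    rw [integral_const_mul, integral_const_mul, hbx]
    ring
  refine ⟨fun p => 𝓕 fun ξ : ℝ => g p ξ, hderiv, hbound, ?_⟩
  have hi : Integrable (𝓕 fun ξ : ℝ => g 0 ξ) := by
    obtain ⟨C, -, hC⟩ := hbound 1 1 zero_le_one one_pos
    have hexp : Integrable fun x : ℝ => Real.exp (-1 * |x|) := by
      have h2 : Integrable fun x : ℝ => (1 + ‖x‖) ^ (-(2 : ℝ)) :=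
        integrable_one_add_norm (by simp)
      refine (h2.const_mul 2).mono' (by fun_prop) (ae_of_all _ fun x => ?_)
      rw [Real.norm_of_nonneg (Real.exp_pos _).le, neg_one_mul, Real.exp_neg,
        Real.rpow_neg (by positivity), ← div_eq_mul_inv, inv_le_comm₀ (Real.exp_pos _)
        (by positivity), inv_div, Real.norm_eq_abs, div_le_iff₀ two_pos,
        show (2 : ℝ) = ((2 : ℕ) : ℝ) by norm_num, Real.rpow_natCast]
      have := Real.quadratic_le_exp_of_nonneg (abs_nonneg x)
      push_cast
      nlinarith [abs_nonneg x]
    refine (hexp.const_mul (C * 1 ^ 0 * W.M 0)).mono'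
      (continuous_iff_continuousAt.2 fun x => (hderiv 0 x).continuousAt).aestronglyMeasurable
      (ae_of_all _ fun x => ?_)
    exact hC 0 x
  have hinv := (hgi 0).fourierInv_fourier_eq hi (v := 0)
    (by have := hgc 0; exact Continuous.continuousAt (by fun_prop))
  have h0 : g 0 ((0 : ℝ) : ℂ) = 1 := by simp [hg, show n ≠ 0 by omega]
  rw [h0, Real.fourierInv_eq] at hinv
  simpa using hinv

end UltraTI

namespace UltraTI

variable {d : ℕ}

/-! ### Estimates in terms of the norms of test functions -/

section Estimates

variable (W : WeightSeqs)

theorem gsScale_le_of_bound {h B : ℝ} (hh : 0 < h) {f : Smooth d}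
    (hf : ∀ α x, ‖(multiDeriv α f).1 x‖ ≤
      B * (W.M (∑ i, α i) / h ^ (∑ i, α i)) * (W.expA (h * ‖x‖))⁻¹) :
    (gsScale W d).toFun h f ≤ ENNReal.ofReal B := by
  refine iSup₂_le fun α x => ?_
  have hM := W.M_pos (∑ i, α i)
  have hE := W.expA_pos (h * ‖x‖)
  rw [← ofReal_norm, ← ENNReal.ofReal_mul (by positivity)]
  refine ENNReal.ofReal_le_ofReal ?_
  calc h ^ (∑ i, α i) * Real.exp (assocFun W.A (h * ‖x‖)) / W.M (∑ i, α i) *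
        ‖(multiDeriv α f).1 x‖
      ≤ h ^ (∑ i, α i) * W.expA (h * ‖x‖) / W.M (∑ i, α i) *
        (B * (W.M (∑ i, α i) / h ^ (∑ i, α i)) * (W.expA (h * ‖x‖))⁻¹) := by
        rw [WeightSeqs.expA] at *
        gcongr
        exact hf α x
    _ = B := by field_simp

theorem enorm_multiDeriv_le {h : ℝ} (hh : 0 < h) (f : Smooth d) (α : Fin d → ℕ)
    (x : EuclideanSpace ℝ (Fin d)) :
    ‖(multiDeriv α f).1 x‖ₑ ≤ (gsScale W d).toFun h f *
      ENNReal.ofReal (W.M (∑ i, α i) / h ^ (∑ i, α i) * (W.expA (h * ‖x‖))⁻¹) := by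
  have hM := W.M_pos (∑ i, α i)
  have hE := W.expA_pos (h * ‖x‖)
  have h1 : ENNReal.ofReal (h ^ (∑ i, α i) * Real.exp (assocFun W.A (h * ‖x‖)) /
      W.M (∑ i, α i)) * ‖(multiDeriv α f).1 x‖ₑ ≤ (gsScale W d).toFun h f :=
    le_iSup₂ (f := fun (α : Fin d → ℕ) (x : EuclideanSpace ℝ (Fin d)) =>
      ENNReal.ofReal (h ^ (∑ i, α i) * Real.exp (assocFun W.A (h * ‖x‖)) / W.M (∑ i, α i)) *
      ‖(multiDeriv α f).1 x‖ₑ) α x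
  refine le_trans (le_of_eq ?_) (mul_le_mul_left h1 _)
  rw [mul_right_comm, ← ENNReal.ofReal_mul (by positivity)]
  have : h ^ (∑ i, α i) * Real.exp (assocFun W.A (h * ‖x‖)) / W.M (∑ i, α i) *
      (W.M (∑ i, α i) / h ^ (∑ i, α i) * (W.expA (h * ‖x‖))⁻¹) = 1 := by
    rw [WeightSeqs.expA] at *
    field_simp
  rw [this, ENNReal.ofReal_one, one_mul]

theorem norm_multiDeriv_le {h : ℝ} (hh : 0 < h) {f : Smooth d}
    (hf : (gsScale W d).toFun h f < ∞) (α : Fin d → ℕ) (x : EuclideanSpace ℝ (Fin d)) :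
    ‖(multiDeriv α f).1 x‖ ≤ ((gsScale W d).toFun h f).toReal *
      (W.M (∑ i, α i) / h ^ (∑ i, α i)) * (W.expA (h * ‖x‖))⁻¹ := by
  have hM := W.M_pos (∑ i, α i)
  have hE := W.expA_pos (h * ‖x‖)
  have := ENNReal.toReal_mono (ENNReal.mul_lt_top hf ENNReal.ofReal_lt_top).ne
    (enorm_multiDeriv_le W hh f α x)
  rwa [toReal_enorm, ENNReal.toReal_mul, ENNReal.toReal_ofReal (by positivity), ← mul_assoc] at this

/-- Stability of `M` splits `M_(α+β)`. The exact dependence `M_|β| / h^|β|` of the constant matters: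
it cancels against the factor `h^|β| / M_|β|` in the norms of `D^*_E`. -/
theorem exists_gsScale_multiDeriv_le : ∃ c₀ H : ℝ, 1 ≤ c₀ ∧ 1 ≤ H ∧
    ∀ (h : ℝ), 0 < h → ∀ (β : Fin d → ℕ) (f : Smooth d),
      (gsScale W d).toFun h (multiDeriv β f) ≤
        ENNReal.ofReal (c₀ * (W.M (∑ i, β i) / h ^ (∑ i, β i))) *
          (gsScale W d).toFun (H * h) f := by
  obtain ⟨c₀, H, hc, hH, hs⟩ := W.M_stable
  refine ⟨c₀, H, hc, hH, fun h hh β f => ?_⟩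
  have hMb := W.M_pos (∑ i, β i)
  have hH0 : 0 < H := by linarith
  by_cases hf : (gsScale W d).toFun (H * h) f = ∞
  · rw [hf, ENNReal.mul_top (by positivity)]
    exact le_top
  have hf := lt_top_iff_ne_top.2 hf
  rw [← ENNReal.ofReal_toReal hf.ne, ← ENNReal.ofReal_mul (by positivity)]
  refine gsScale_le_of_bound W hh fun α x => ?_
  rw [multiDeriv_add]
  refine (norm_multiDeriv_le W (by positivity) hf (α + β) x).trans ?_
  have hsum : ∑ i, (α + β) i = ∑ i, α i + ∑ i, β i := Finset.sum_add_distrib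
  rw [hsum]
  have h1 := hs (∑ i, α i) (∑ i, β i)
  have h2 : (W.expA (H * h * ‖x‖))⁻¹ ≤ (W.expA (h * ‖x‖))⁻¹ := by
    refine inv_anti₀ (W.expA_pos _) (W.expA_mono (by positivity) ?_)
    gcongr
    exact le_mul_of_one_le_left hh.le hH
  generalize ∑ i, α i = a at *
  generalize ∑ i, β i = b at *
  have hE := W.expA_pos (h * ‖x‖)
  have hMa := W.M_pos a
  calc _ ≤ ((gsScale W d).toFun (H * h) f).toReal *
        (c₀ * H ^ (a + b) * (W.M a * W.M b) / (H * h) ^ (a + b)) * (W.expA (h * ‖x‖))⁻¹ := by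
        have := W.expA_pos (H * h * ‖x‖)
        gcongr
    _ = _ := by
        rw [mul_pow, pow_add h]
        field_simp

theorem sum_add_single (α : Fin d → ℕ) (i : Fin d) :
    ∑ j, (α + Pi.single i 1 : Fin d → ℕ) j = ∑ j, α j + 1 := by
  simp only [Pi.add_apply, Finset.sum_add_distrib]
  simp

/-- The mean value inequality on the segment from `x` to `x + k` costs one derivative, and the
weight at `x` is compared with that at points at distance at most `1`. -/
theorem exists_gsScale_translate_sub_le : ∃ K : ℝ, 0 < K ∧ ∀ h, 0 < h → ∃ C : ℝ, 0 ≤ C ∧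
    ∀ f : Smooth d, (gsScale W d).toFun (K * h) f < ∞ →
      ∀ k : EuclideanSpace ℝ (Fin d), ‖k‖ ≤ 1 →
        (gsScale W d).toFun h (translateSmooth k f - f) ≤ ENNReal.ofReal
          (C * ‖k‖ * ((gsScale W d).toFun (K * h) f).toReal) := by
  obtain ⟨c₀, H, hc, hH, hs⟩ := W.M_stable
  have hH0 : 0 < H := by linarith
  -- `H` absorbs the extra derivative through `M_(a+1) ≤ c₀ H^(a+1) M_a`; `2` comes from splitting
  -- `A` over a sum.
  refine ⟨2 * H, by positivity, fun h hh => ⟨d * c₀ * W.expA (2 * h) / h, ?_, ?_⟩⟩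
  · have := W.expA_pos (2 * h)
    positivity
  intro f hf k hk
  set S := ((gsScale W d).toFun (2 * H * h) f).toReal with hS
  have hS0 : 0 ≤ S := ENNReal.toReal_nonneg
  refine gsScale_le_of_bound W hh fun α x => ?_
  have hE := W.expA_pos (h * ‖x‖)
  have hE2 := W.expA_pos (2 * h)
  rw [map_sub, multiDeriv_translate]
  change ‖(multiDeriv α f).1 (x + k) - (multiDeriv α f).1 x‖ ≤ _
  set a := ∑ i, α i with ha
  have hMa := W.M_pos a
  have hy : ∀ y ∈ segment ℝ x (x + k), (W.expA (2 * H * h * ‖y‖))⁻¹ ≤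
      W.expA (2 * h) * (W.expA (h * ‖x‖))⁻¹ := by
    intro y hy
    have h1 : ‖x‖ ≤ 1 + ‖y‖ := by
      obtain ⟨t, ⟨ht0, ht1⟩, rfl⟩ := (segment_eq_image' ℝ x (x + k)) ▸ hy
      simp only [add_sub_cancel_left]
      have h2 : ‖t • k‖ ≤ 1 := by
        rw [norm_smul, Real.norm_of_nonneg ht0]
        exact mul_le_one₀ ht1 (norm_nonneg _) hk
      have h3 := norm_sub_le (x + t • k) (t • k)
      rw [add_sub_cancel_right] at h3
      linarith
    have h2 : W.expA (h * ‖x‖) ≤ W.expA (2 * h) * W.expA (2 * H * h * ‖y‖) := by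
      refine (W.expA_mono (by positivity) (?_ : h * ‖x‖ ≤ h + h * ‖y‖)).trans ?_
      · nlinarith
      refine (W.expA_add_le hh.le (by positivity)).trans ?_
      refine mul_le_mul_of_nonneg_left (W.expA_mono (by positivity) ?_) hE2.le
      nlinarith [mul_nonneg hh.le (norm_nonneg y)]
    have hE3 := W.expA_pos (2 * H * h * ‖y‖)
    rw [← div_eq_mul_inv, le_div_iff₀ hE, inv_mul_le_iff₀ hE3]
    linarith
  refine (Convex.norm_image_sub_le_of_norm_hasFDerivWithin_le (C := d * (S *
    (c₀ * W.M a / h ^ (a + 1)) * (W.expA (2 * h) * (W.expA (h * ‖x‖))⁻¹)))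
    (fun y _ => (isDerivFamily_multiDeriv f α y).hasFDerivWithinAt) (fun y hys => ?_)
    (convex_segment x (x + k)) (left_mem_segment ℝ _ _) (right_mem_segment ℝ _ _)).trans_eq ?_
  · refine (norm_gradForm_le _).trans ?_
    have : ∀ i ∈ (Finset.univ : Finset (Fin d)), ‖(multiDeriv (α + Pi.single i 1) f).1 y‖ ≤ S *
        (c₀ * W.M a / h ^ (a + 1)) * (W.expA (2 * h) * (W.expA (h * ‖x‖))⁻¹) := by
      intro i _
      refine (norm_multiDeriv_le W (by positivity) hf _ y).trans ?_
      rw [sum_add_single, ← ha]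
      have h1 := hs a 1
      rw [W.M_one, mul_one] at h1
      have hM1 := W.M_pos (a + 1)
      have hexp := hy y hys
      have hE3 := W.expA_pos (2 * H * h * ‖y‖)
      refine mul_le_mul (mul_le_mul_of_nonneg_left ?_ hS0) hexp (by positivity) (by positivity)
      rw [div_le_div_iff₀ (by positivity) (by positivity)]
      have h2 : (1 : ℝ) ≤ 2 ^ (a + 1) := one_le_pow₀ (by norm_num)
      calc W.M (a + 1) * h ^ (a + 1) ≤ (c₀ * H ^ (a + 1) * W.M a) * h ^ (a + 1) * 2 ^ (a + 1) := by
            exact (mul_le_mul_of_nonneg_right h1 (by positivity)).trans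
              (le_mul_of_one_le_right (by positivity) h2)
        _ = _ := by rw [mul_pow, mul_pow]; ring
    simpa using Finset.sum_le_card_nsmul _ _ _ this
  · rw [add_sub_cancel_left, pow_succ]
    field_simp

end Estimates

/-! ### Rapidly decreasing smooth functions -/

/-- Finiteness of one of the norms. -/
def IsRapid (W : WeightSeqs) (f : Smooth d) : Prop := ∃ h, 0 < h ∧ (gsScale W d).toFun h f < ∞

namespace IsRapid

variable {W : WeightSeqs} {f g : Smooth d}

theorem multiDeriv (hf : IsRapid W f) (α : Fin d → ℕ) : IsRapid W (multiDeriv α f) := by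
  obtain ⟨h, hh, hf⟩ := hf
  obtain ⟨c₀, H, hc, hH, hb⟩ := exists_gsScale_multiDeriv_le (d := d) W
  have hH0 : 0 < H := by linarith
  refine ⟨h / H, by positivity, (hb _ (by positivity) α f).trans_lt ?_⟩
  rw [mul_div_cancel₀ h hH0.ne']
  exact ENNReal.mul_lt_top ENNReal.ofReal_lt_top hf

theorem exists_bound (hf : IsRapid W f) : ∃ h C, 0 < h ∧ 0 ≤ C ∧
    ∀ x, ‖f.1 x‖ ≤ C * (W.expA (h * ‖x‖))⁻¹ := by
  obtain ⟨h, hh, hf⟩ := hf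
  refine ⟨h, ((gsScale W d).toFun h f).toReal, hh, ENNReal.toReal_nonneg, fun x => ?_⟩
  have := norm_multiDeriv_le W hh hf 0 x
  rw [multiDeriv_zero] at this
  simpa [W.M_zero] using this

theorem exists_norm_le (hf : IsRapid W f) : ∃ C, 0 ≤ C ∧ ∀ x, ‖f.1 x‖ ≤ C := by
  obtain ⟨h, C, hh, hC, hb⟩ := hf.exists_bound
  refine ⟨C, hC, fun x => (hb x).trans (mul_le_of_le_one_right hC ?_)⟩
  exact inv_le_one_of_one_le₀ (W.one_le_expA _)

theorem continuous (f : Smooth d) : Continuous f.1 := (Smooth.contDiff f).continuous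

theorem integrable (hf : IsRapid W f) : Integrable f.1 := by
  obtain ⟨h, C, hh, hC, hb⟩ := hf.exists_bound
  exact ((W.integrable_inv_expA hh).const_mul C).mono' (continuous f).aestronglyMeasurable
    (ae_of_all _ hb)

theorem integrable_mul (hf : IsRapid W f) (hg : IsRapid W g) :
    Integrable fun x => f.1 x * g.1 x := by
  obtain ⟨C, hC, hb⟩ := hg.exists_norm_le
  exact hf.integrable.mul_bdd (continuous g).aestronglyMeasurable (ae_of_all _ hb)

theorem integral_mul_partialDeriv (hf : IsRapid W f) (hg : IsRapid W g) (i : Fin d) :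
    ∫ x, f.1 x * (partialDeriv i g).1 x = -∫ x, (partialDeriv i f).1 x * g.1 x := by
  have hf' : IsRapid W (partialDeriv i f) := multiDeriv_single i f ▸ hf.multiDeriv _
  have hg' : IsRapid W (partialDeriv i g) := multiDeriv_single i g ▸ hg.multiDeriv _
  refine integral_mul_fderiv_eq_neg_fderiv_mul_of_integrable (hf'.integrable_mul hg)
    (hf.integrable_mul hg') (hf.integrable_mul hg) (fun x _ => ?_) (fun x _ => ?_)
  · exact (Smooth.contDiff f).differentiable (by simp) x
  · exact (Smooth.contDiff g).differentiable (by simp) x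

/-- Induction on `|α|`: one coordinate derivative at a time is split off and integrated by parts. -/
theorem integral_multiDeriv_mul (hf : IsRapid W f) (hg : IsRapid W g) (α : Fin d → ℕ) :
    ∫ x, (UltraTI.multiDeriv α f).1 x * g.1 x =
      (-1) ^ (∑ i, α i) * ∫ x, f.1 x * (UltraTI.multiDeriv α g).1 x := by
  induction hn : ∑ i, α i generalizing α g with
  | zero =>
    have : α = 0 := by
      funext i
      exact (Finset.sum_eq_zero_iff.1 hn) i (Finset.mem_univ i)
    simp [this, multiDeriv_zero]
  | succ n ih =>
    obtain ⟨i, -, hi⟩ : ∃ i ∈ Finset.univ, α i ≠ 0 := by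
      by_contra! h
      rw [Finset.sum_eq_zero h] at hn
      omega
    obtain ⟨β, rfl⟩ : ∃ β : Fin d → ℕ, α = β + Pi.single i 1 := by
      refine ⟨α - Pi.single i 1, (tsub_add_cancel_of_le ?_).symm⟩
      intro j
      rcases eq_or_ne j i with rfl | hj
      · simpa using Nat.one_le_iff_ne_zero.2 hi
      · simp [hj]
    have hβ : ∑ j, β j = n := by
      rw [sum_add_single] at hn
      omega
    have hg' : IsRapid W (partialDeriv i g) := multiDeriv_single i g ▸ hg.multiDeriv _
    have h1 := (hf.multiDeriv β).integral_mul_partialDeriv hg i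
    have h2 := ih hg' β hβ
    have h3 : UltraTI.multiDeriv (β + Pi.single i 1) f =
        partialDeriv i (UltraTI.multiDeriv β f) := by
      rw [add_comm, ← multiDeriv_add, multiDeriv_single]
    have h4 : UltraTI.multiDeriv (β + Pi.single i 1) g =
        UltraTI.multiDeriv β (partialDeriv i g) := by
      rw [← multiDeriv_add, multiDeriv_single]
    rw [h3, h4, pow_succ, mul_neg_one, neg_mul, ← h2, h1, neg_neg]

end IsRapid

/-! ### Convolution with a rapidly decreasing smooth function -/

/-- Differentiation under the integral, with `‖f y‖` times the bounds for the next derivatives as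
dominating function; `f` itself need not be smooth. -/
theorem IsDerivFamily.convolution {D : (Fin d → ℕ) → EuclideanSpace ℝ (Fin d) → ℂ}
    (hD : IsDerivFamily D) {C : (Fin d → ℕ) → ℝ} (hC : ∀ α x, ‖D α x‖ ≤ C α)
    {f : EuclideanSpace ℝ (Fin d) → ℂ} (hf : Integrable f) :
    IsDerivFamily fun α x => ∫ y, f y * D α (x - y) := by
  intro α x
  have hDc : ∀ β, Continuous (D β) := fun β => (hD.contDiff β).continuous
  have hint : ∀ β z, Integrable fun y => f y * D β (z - y) := fun β z => by
    have := hDc β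
    exact hf.mul_bdd (by fun_prop) (ae_of_all _ fun y => hC β (z - y))
  have hint' : ∀ i, Integrable fun y =>
      (EuclideanSpace.proj i : EuclideanSpace ℝ (Fin d) →L[ℝ] ℝ).smulRight
        (f y * D (α + Pi.single i 1) (x - y)) := fun i =>
    (ContinuousLinearMap.smulRightL ℝ (EuclideanSpace ℝ (Fin d)) ℂ
      (EuclideanSpace.proj i)).integrable_comp (hint (α + Pi.single i 1) x)
  have hF' : ∀ y z, HasFDerivAt (fun z => f y * D α (z - y))
      (gradForm fun i => f y * D (α + Pi.single i 1) (z - y)) z := by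
    intro y z
    refine (((hD α (z - y)).comp z ((hasFDerivAt_id z).sub_const y)).const_mul
      (f y)).congr_fderiv ?_
    ext v
    simp only [gradForm_apply, ContinuousLinearMap.comp_id, FunLike.coe_smul,
      Pi.smul_apply, smul_eq_mul, Finset.mul_sum]
    exact Finset.sum_congr rfl fun i _ => by ring
  have hbound : ∀ y z, ‖gradForm fun i => f y * D (α + Pi.single i 1) (z - y)‖ ≤
      ∑ i, ‖f y‖ * C (α + Pi.single i 1) := by
    intro y z
    refine (norm_gradForm_le _).trans (Finset.sum_le_sum fun i _ => ?_)
    rw [norm_mul]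
    exact mul_le_mul_of_nonneg_left (hC _ _) (norm_nonneg _)
  have hsm : AEStronglyMeasurable (fun y =>
      gradForm fun i => f y * D (α + Pi.single i 1) (x - y)) volume := by
    simp only [gradForm_def]
    exact Finset.aestronglyMeasurable_fun_sum _ fun i _ => (hint' i).aestronglyMeasurable
  have hbi : Integrable fun y => ∑ i, ‖f y‖ * C (α + Pi.single i 1) :=
    integrable_finsetSum _ fun i _ => hf.norm.mul_const _
  have key := hasFDerivAt_integral_of_dominated_of_fderiv_le (μ := volume) (𝕜 := ℝ)
    (F := fun z y => f y * D α (z - y)) (x₀ := x) (s := Set.univ)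
    univ_mem (Eventually.of_forall fun z => (hint α z).aestronglyMeasurable) (hint α x)
    hsm (ae_of_all _ fun y z _ => hbound y z) hbi (ae_of_all _ fun y z _ => hF' y z)
  refine key.congr_fderiv ?_
  simp only [gradForm_def]
  rw [integral_finsetSum _ fun i _ => hint' i]
  refine Finset.sum_congr rfl fun i _ => ?_
  exact (ContinuousLinearMap.smulRightL ℝ (EuclideanSpace ℝ (Fin d)) ℂ
    (EuclideanSpace.proj i)).integral_comp_comm (hint (α + Pi.single i 1) x)

theorem isDerivFamily_convolution {W : WeightSeqs} {f : EuclideanSpace ℝ (Fin d) → ℂ}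
    (hf : Integrable f) {g : Smooth d} (hg : IsRapid W g) :
    IsDerivFamily fun α x => ∫ y, f y * (multiDeriv α g).1 (x - y) := by
  choose C hC0 hC using fun β => (hg.multiDeriv β).exists_norm_le
  exact (isDerivFamily_multiDeriv g).convolution hC hf

/-- The convolution `f * g` as a smooth function. -/
def smoothConv {W : WeightSeqs} {f : EuclideanSpace ℝ (Fin d) → ℂ} (hf : Integrable f)
    {g : Smooth d} (hg : IsRapid W g) : Smooth d :=
  ⟨_, (isDerivFamily_convolution hf hg).contDiff 0⟩

section Convolution

variable {W : WeightSeqs} {f : EuclideanSpace ℝ (Fin d) → ℂ} (hf : Integrable f)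
  {g : Smooth d} (hg : IsRapid W g)

theorem multiDeriv_smoothConv (α : Fin d → ℕ) (x : EuclideanSpace ℝ (Fin d)) :
    (multiDeriv α (smoothConv hf hg)).1 x = ∫ y, f y * (multiDeriv α g).1 (x - y) := by
  rw [smoothConv, (isDerivFamily_convolution hf hg).multiDeriv_zero_eq]

theorem smoothConv_apply (x : EuclideanSpace ℝ (Fin d)) :
    (smoothConv hf hg).1 x = ∫ y, f y * g.1 (x - y) := by
  have := multiDeriv_smoothConv hf hg 0 x
  simpa only [multiDeriv_zero] using this

/-- All derivatives fall on `g`, while the weight is shared: `A(h|x|) ≤ A(2h|y|) + A(2h|x-y|)`.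
Hence `f` only has to decay. -/
theorem gsScale_smoothConv_le {h : ℝ} (hh : 0 < h)
    (hfi : Integrable fun y => W.expA (2 * h * ‖y‖) * ‖f y‖)
    (hgh : (gsScale W d).toFun (2 * h) g < ∞) :
    (gsScale W d).toFun h (smoothConv hf hg) ≤ ENNReal.ofReal
      ((∫ y, W.expA (2 * h * ‖y‖) * ‖f y‖) * ((gsScale W d).toFun (2 * h) g).toReal) := by
  set S := ((gsScale W d).toFun (2 * h) g).toReal with hS
  have hS0 : 0 ≤ S := ENNReal.toReal_nonneg
  refine gsScale_le_of_bound W hh fun α x => ?_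
  rw [multiDeriv_smoothConv]
  have hM := W.M_pos (∑ i, α i)
  have hE := W.expA_pos (h * ‖x‖)
  have hb : ∀ y, ‖f y * (multiDeriv α g).1 (x - y)‖ ≤
      (W.expA (2 * h * ‖y‖) * ‖f y‖) *
        (S * (W.M (∑ i, α i) / h ^ (∑ i, α i)) * (W.expA (h * ‖x‖))⁻¹) := by
    intro y
    have h1 := norm_multiDeriv_le W (by positivity) hgh α (x - y)
    have h2 : W.expA (h * ‖x‖) ≤ W.expA (2 * h * ‖y‖) * W.expA (2 * h * ‖x - y‖) := by
      refine (W.expA_mono (by positivity) (?_ : h * ‖x‖ ≤ h * ‖y‖ + h * ‖x - y‖)).trans ?_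
      · rw [← mul_add]
        gcongr
        simpa using norm_add_le y (x - y)
      · rw [mul_assoc 2 h, mul_assoc 2 h]
        exact W.expA_add_le (by positivity) (by positivity)
    have hE1 := W.expA_pos (2 * h * ‖y‖)
    have hE2 := W.expA_pos (2 * h * ‖x - y‖)
    have h3 : (W.expA (2 * h * ‖x - y‖))⁻¹ ≤ W.expA (2 * h * ‖y‖) * (W.expA (h * ‖x‖))⁻¹ := by
      rw [← div_eq_mul_inv, le_div_iff₀ hE, inv_mul_le_iff₀ hE2]
      linarith
    rw [norm_mul]
    calc _ ≤ ‖f y‖ * (S * (W.M (∑ i, α i) / h ^ (∑ i, α i)) *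
          (W.expA (2 * h * ‖y‖) * (W.expA (h * ‖x‖))⁻¹)) := by
          gcongr
          refine h1.trans ?_
          gcongr
          linarith
      _ = _ := by ring
  refine (norm_integral_le_of_norm_le (hfi.mul_const _) (ae_of_all _ hb)).trans_eq ?_
  rw [integral_mul_const]
  ring

end Convolution

/-! ### Approximate identities -/

theorem euclidean_norm_le_sum (x : EuclideanSpace ℝ (Fin d)) : ‖x‖ ≤ ∑ i, |x i| := by
  have h := (EuclideanSpace.basisFun (Fin d) ℝ).sum_repr x
  calc ‖x‖ = ‖∑ i, x i • EuclideanSpace.basisFun (Fin d) ℝ i‖ := by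
        conv_lhs => rw [← h]
        simp
    _ ≤ ∑ i, |x i| := (norm_sum_le _ _).trans (le_of_eq (by simp [norm_smul]))

/-- The tensor product of one-dimensional mollifiers. Log-convexity gives `∏ M_(α_i) ≤ M_|α|`, and
`‖x‖ ≤ ∑ |x_i|` gives the decay. -/
theorem exists_mollifier (W : WeightSeqs) (d : ℕ) :
    ∃ G : (Fin d → ℕ) → EuclideanSpace ℝ (Fin d) → ℂ, IsDerivFamily G ∧
    (∀ a h : ℝ, 0 ≤ a → 0 < h → ∃ C : ℝ, 0 < C ∧ ∀ α x,
      ‖G α x‖ ≤ C * h ^ (∑ i, α i) * W.M (∑ i, α i) * Real.exp (-a * ‖x‖)) ∧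
    ∫ x, G 0 x = 1 := by
  obtain ⟨f, hf, hb, hI⟩ := exists_entire_mollifier W
  refine ⟨fun α x => ∏ i, f (α i) (x i), fun α x => ?_, fun a h ha hh => ?_, ?_⟩
  · have h1 : ∀ i ∈ Finset.univ, HasFDerivAt (fun y : EuclideanSpace ℝ (Fin d) => f (α i) (y i))
        ((EuclideanSpace.proj i : EuclideanSpace ℝ (Fin d) →L[ℝ] ℝ).smulRight
          (f (α i + 1) (x i))) x := by
      intro i _
      exact (hf (α i) (x i)).hasFDerivAt.comp x
        (EuclideanSpace.proj i : EuclideanSpace ℝ (Fin d) →L[ℝ] ℝ).hasFDerivAt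
    refine (HasFDerivAt.finsetProd h1).congr_fderiv ?_
    rw [gradForm_def]
    refine Finset.sum_congr rfl fun i _ => ?_
    have h2 : ∏ j, f ((α + Pi.single i 1 : Fin d → ℕ) j) (x j) =
        f (α i + 1) (x i) * ∏ j ∈ Finset.univ.erase i, f (α j) (x j) := by
      rw [← Finset.mul_prod_erase _ _ (Finset.mem_univ i)]
      congr 1
      · simp
      · exact Finset.prod_congr rfl fun j hj => by simp [(Finset.mem_erase.1 hj).1]
    ext v
    simp only [h2, smul_apply, ContinuousLinearMap.smulRight_apply,
      Complex.real_smul, smul_eq_mul]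
    ring
  · obtain ⟨C, hC, hCb⟩ := hb a h ha hh
    refine ⟨C ^ d, by positivity, fun α x => ?_⟩
    have hMp : ∀ p, 0 < W.M p := W.M_pos
    calc ‖∏ i, f (α i) (x i)‖ = ∏ i, ‖f (α i) (x i)‖ := norm_prod _ _
      _ ≤ ∏ i, (C * h ^ α i * W.M (α i) * Real.exp (-a * |x i|)) :=
          Finset.prod_le_prod (fun _ _ => norm_nonneg _) fun i _ => hCb _ _
      _ = C ^ d * h ^ (∑ i, α i) * (∏ i, W.M (α i)) * Real.exp (-a * ∑ i, |x i|) := by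
          simp only [Finset.prod_mul_distrib, Finset.prod_const, Finset.card_univ, Fintype.card_fin,
            Finset.prod_pow_eq_pow_sum, ← Real.exp_sum, Finset.mul_sum]
      _ ≤ _ := by
          have h1 := W.prod_M_le Finset.univ α
          have h2 : 0 ≤ ∏ i, W.M (α i) := Finset.prod_nonneg fun i _ => (hMp _).le
          have h3 : Real.exp (-a * ∑ i, |x i|) ≤ Real.exp (-a * ‖x‖) := by
            refine Real.exp_le_exp.2 ?_
            nlinarith [euclidean_norm_le_sum x]
          have := hMp (∑ i, α i)
          gcongr
  · have h1 := (EuclideanSpace.volume_preserving_symm_measurableEquiv_toLp (Fin d)).integral_comp'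
      (g := fun y : Fin d → ℝ => ∏ i, f 0 (y i))
    have h2 : ∫ y : Fin d → ℝ, ∏ i, f 0 (y i) = 1 := by
      rw [integral_fintype_prod_volume_eq_prod fun _ => f 0]
      simp [hI]
    rw [h2] at h1
    exact h1

theorem exists_approxIdentity (W : WeightSeqs) (d : ℕ) :
    ∃ (ψ : ℕ → Smooth d) (ψ₀ : EuclideanSpace ℝ (Fin d) → ℂ),
      (∀ n h, 0 < h → (gsScale W d).toFun h (ψ n) < ∞) ∧
      (∀ n x, (ψ n).1 x = (n + 1) ^ d * ψ₀ (((n : ℝ) + 1) • x)) ∧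
      Continuous ψ₀ ∧ (∀ h : ℝ, 0 < h → Integrable fun y => W.expA (h * ‖y‖) * ‖ψ₀ y‖) ∧
      ∫ y, ψ₀ y = 1 := by
  obtain ⟨G, hG, hb, hI⟩ := exists_mollifier W d
  obtain ⟨C₁, L, hC₁, hL, hexp⟩ := W.exists_expA_le_exp
  have hfam : ∀ n : ℕ, IsDerivFamily fun α (x : EuclideanSpace ℝ (Fin d)) =>
      ((n : ℂ) + 1) ^ (d + ∑ i, α i) * G α (((n : ℝ) + 1) • x) := by
    intro n α x
    refine (((hG α (((n : ℝ) + 1) • x)).comp x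
      ((hasFDerivAt_id x).const_smul ((n : ℝ) + 1))).const_mul
        (((n : ℂ) + 1) ^ (d + ∑ i, α i))).congr_fderiv ?_
    ext v
    simp only [gradForm_apply, FunLike.coe_smul, ContinuousLinearMap.comp_smul,
      ContinuousLinearMap.comp_id, Pi.smul_apply, smul_eq_mul, Finset.mul_sum,
      Complex.real_smul]
    refine Finset.sum_congr rfl fun i _ => ?_
    rw [sum_add_single]
    push_cast
    ring
  have hdecay : ∀ h : ℝ, 0 < h → ∃ C, 0 < C ∧ ∀ x, ‖G 0 x‖ ≤ C * (W.expA (h * ‖x‖))⁻¹ := by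
    intro h hh
    obtain ⟨C, hC, hCb⟩ := hb (L * h) 1 (by positivity) one_pos
    refine ⟨C * C₁, by positivity, fun x => (hCb 0 x).trans ?_⟩
    have h1 := hexp (h * ‖x‖) (by positivity)
    have hE := W.expA_pos (h * ‖x‖)
    rw [← div_eq_mul_inv, le_div_iff₀ hE]
    simp only [Pi.zero_apply, Finset.sum_const_zero, pow_zero, W.M_zero, mul_one]
    calc C * Real.exp (-(L * h) * ‖x‖) * W.expA (h * ‖x‖)
        ≤ C * Real.exp (-(L * h) * ‖x‖) * (C₁ * Real.exp (L * (h * ‖x‖))) := by gcongr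
      _ = C * C₁ * Real.exp (-(L * h) * ‖x‖ + L * (h * ‖x‖)) := by rw [Real.exp_add]; ring
      _ = C * C₁ := by simp [mul_assoc]
  refine ⟨fun n => ⟨_, (hfam n).contDiff 0⟩, G 0, fun n h hh => ?_, fun n x => ?_,
    (hG.contDiff 0).continuous, fun h hh => ?_, hI⟩
  · set N : ℝ := (n : ℝ) + 1 with hN
    have hN1 : 1 ≤ N := by rw [hN]; linarith [n.cast_nonneg (α := ℝ)]
    have hN0 : 0 < N := by linarith
    -- The decay rate `L h` compensates `e^{A(h|x|)}`. The parameter `1 / (N h)` absorbs the factor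
    -- `N^|α|` produced by the dilation and leaves `h^(-|α|)`.
    obtain ⟨C, hC, hCb⟩ := hb (L * h) (1 / (N * h)) (by positivity) (by positivity)
    refine (gsScale_le_of_bound W hh (B := N ^ d * C * C₁) fun α x => ?_).trans_lt
      ENNReal.ofReal_lt_top
    have hM := W.M_pos (∑ i, α i)
    have hE := W.expA_pos (h * ‖x‖)
    rw [(hfam n).multiDeriv_zero_eq]
    simp only
    have hnN : ‖((n : ℂ) + 1)‖ = N := by
      have : ((n : ℂ) + 1) = ((N : ℝ) : ℂ) := by rw [hN]; push_cast; ring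
      rw [this, Complex.norm_real, Real.norm_of_nonneg hN0.le]
    rw [norm_mul, norm_pow, hnN, ← div_eq_mul_inv, le_div_iff₀ hE]
    have h1 := hexp (h * ‖x‖) (by positivity)
    have h2 := hCb α (N • x)
    rw [norm_smul, Real.norm_of_nonneg hN0.le] at h2
    calc N ^ (d + ∑ i, α i) * ‖G α (N • x)‖ * W.expA (h * ‖x‖)
        ≤ N ^ (d + ∑ i, α i) * (C * (1 / (N * h)) ^ (∑ i, α i) * W.M (∑ i, α i) *
            Real.exp (-(L * h) * (N * ‖x‖))) * (C₁ * Real.exp (L * (h * ‖x‖))) := by gcongr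
      _ = N ^ d * C * C₁ * (W.M (∑ i, α i) / h ^ (∑ i, α i)) *
            Real.exp (-(L * h) * (N * ‖x‖) + L * (h * ‖x‖)) := by
          rw [Real.exp_add, pow_add, div_pow, mul_pow, one_pow]
          field_simp
      _ ≤ N ^ d * C * C₁ * (W.M (∑ i, α i) / h ^ (∑ i, α i)) * 1 := by
          refine mul_le_mul_of_nonneg_left (Real.exp_le_one_iff.2 ?_) (by positivity)
          have : 0 ≤ L * h * ‖x‖ := by positivity
          nlinarith
      _ = _ := mul_one _
  · simp
  · obtain ⟨C₂, H, hC₂, hH, hsq⟩ := W.exists_expA_sq_le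
    have hH0 : 0 < H := by linarith
    obtain ⟨C, hC, hCb⟩ := hdecay (H * h) (by positivity)
    refine ((W.integrable_inv_expA hh).const_mul (C * C₂)).mono' ?_ (ae_of_all _ fun x => ?_)
    · exact ((W.measurable_expA.comp (by fun_prop)).mul
        (hG.contDiff 0).continuous.norm.measurable).aestronglyMeasurable
    · have hE := W.expA_pos (h * ‖x‖)
      have hE2 := W.expA_pos (H * h * ‖x‖)
      rw [Real.norm_of_nonneg (by positivity), ← div_eq_mul_inv, le_div_iff₀ hE]
      have h1 := hsq (h * ‖x‖) (by positivity)
      have h2 := hCb x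
      rw [← div_eq_mul_inv, le_div_iff₀ hE2] at h2
      rw [← mul_assoc] at h1
      calc W.expA (h * ‖x‖) * ‖G 0 x‖ * W.expA (h * ‖x‖)
          = ‖G 0 x‖ * (W.expA (h * ‖x‖) * W.expA (h * ‖x‖)) := by ring
        _ ≤ ‖G 0 x‖ * (C₂ * W.expA (H * h * ‖x‖)) := by gcongr
        _ = C₂ * (‖G 0 x‖ * W.expA (H * h * ‖x‖)) := by ring
        _ ≤ C₂ * C := by gcongr
        _ = _ := mul_comm _ _

/-! ### Test functions as smooth functions with finite norms. -/

namespace TestSpace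

variable {W : WeightSeqs} {c : UltraClass}

/-- The smooth function underlying a test function. -/
def toSmooth (φ : TestSpace W c d) : Smooth d := (gsScale W d).limIncl c φ

/-- A smooth function with the appropriate finite norms as a test function. -/
def ofSmooth (f : Smooth d) (hf : c.ProjInd fun h => (gsScale W d).toFun h f < ∞) :
    TestSpace W c d :=
  ⟨f, ((gsScale W d).mem_limSubmodule_iff f).2 hf⟩

theorem toSmooth_ofSmooth (f : Smooth d) (hf : c.ProjInd fun h => (gsScale W d).toFun h f < ∞) :
    toSmooth (ofSmooth f hf) = f := rfl

theorem finite (φ : TestSpace W c d) :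
    c.ProjInd fun h => (gsScale W d).toFun h φ.toSmooth < ∞ :=
  (gsScale W d).lim_finite φ

theorem isRapid (φ : TestSpace W c d) : IsRapid W φ.toSmooth := by
  have h := φ.finite
  cases c with
  | beurling => exact ⟨1, one_pos, h 1 one_pos⟩
  | roumieu => exact h

theorem ext_fn {φ ψ : TestSpace W c d} (h : ∀ x, fn φ x = fn ψ x) : φ = ψ :=
  (gsScale W d).limIncl_injective (Subtype.ext (funext h))

theorem fn_translate (k : EuclideanSpace ℝ (Fin d)) (φ : TestSpace W c d)
    (x : EuclideanSpace ℝ (Fin d)) : fn (translate k φ) x = fn φ (x + k) := rfl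

theorem toSmooth_deriv (β : Fin d → ℕ) (φ : TestSpace W c d) :
    (deriv β φ).toSmooth = multiDeriv β φ.toSmooth := rfl

theorem fn_eq (φ : TestSpace W c d) : fn φ = φ.toSmooth.1 := rfl

theorem continuous_fn (φ : TestSpace W c d) : Continuous (fn φ) :=
  (Smooth.contDiff φ.toSmooth).continuous

theorem translate_zero (φ : TestSpace W c d) : translate 0 φ = φ :=
  ext_fn fun x => by rw [fn_translate, add_zero]

theorem translate_translate (k l : EuclideanSpace ℝ (Fin d)) (φ : TestSpace W c d) :
    translate k (translate l φ) = translate (k + l) φ :=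
  ext_fn fun x => by rw [fn_translate, fn_translate, fn_translate, add_assoc]

theorem deriv_translate (k : EuclideanSpace ℝ (Fin d)) (β : Fin d → ℕ) (φ : TestSpace W c d) :
    deriv β (translate k φ) = translate k (deriv β φ) :=
  (gsScale W d).limIncl_injective (multiDeriv_translate k β φ.toSmooth)

/-- Ensures `E ≠ 0`, without which the weight would vanish. -/
theorem exists_ne_zero (W : WeightSeqs) (c : UltraClass) (d : ℕ) :
    ∃ φ : TestSpace W c d, φ ≠ 0 := by
  obtain ⟨ψ, ψ₀, hfin, hval, -, -, hI⟩ := exists_approxIdentity W d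
  refine ⟨ofSmooth (ψ 0) (UltraClass.projInd_of_forall (hfin 0)), fun h => ?_⟩
  have h0 : ∀ x, ψ₀ x = 0 := by
    intro x
    have h1 : fn (ofSmooth (ψ 0) (UltraClass.projInd_of_forall (c := c) (hfin 0))) x = 0 := by
      rw [h]; rfl
    rw [fn_eq, toSmooth_ofSmooth, hval] at h1
    simpa using h1
  simp [h0] at hI

end TestSpace

namespace TIBSpace

variable {W : WeightSeqs} {c : UltraClass} {E : Type*} [NormedAddCommGroup E] [NormedSpace ℂ E]
  (X : TIBSpace W c d E)

/-! ### The translation group -/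

/-- Evaluation of the elements of `E` at a test function. -/
def pairing (ψ : TestSpace W c d) : E →L[ℂ] ℂ where
  toFun g := X.toUltra g ψ
  map_add' g g' := by rw [map_add, add_apply]
  map_smul' a g := by rw [map_smul, smul_apply]; rfl
  cont := (continuous_eval_const ψ).comp X.toUltra.continuous

theorem pairing_apply (ψ : TestSpace W c d) (g : E) : X.pairing ψ g = X.toUltra g ψ := rfl

theorem translate_ofTest (k : EuclideanSpace ℝ (Fin d)) (φ : TestSpace W c d) :
    X.translate k (X.ofTest φ) = X.ofTest (TestSpace.translate k φ) := by
  refine X.eq_of_toUltra fun ψ => ?_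
  rw [X.toUltra_translate, X.toUltra_ofTest, X.toUltra_ofTest,
    ← integral_add_right_eq_self _ k]
  simp only [TestSpace.fn_translate, add_neg_cancel_right]

theorem translate_zero (g : E) : X.translate 0 g = g :=
  X.eq_of_toUltra fun φ => by rw [X.toUltra_translate, neg_zero, TestSpace.translate_zero]

theorem translate_add (k l : EuclideanSpace ℝ (Fin d)) (g : E) :
    X.translate (k + l) g = X.translate k (X.translate l g) :=
  X.eq_of_toUltra fun φ => by
    rw [X.toUltra_translate, X.toUltra_translate, X.toUltra_translate,
      TestSpace.translate_translate, neg_add_rev]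

theorem isDeriv_ofTest (α : Fin d → ℕ) (φ : TestSpace W c d) :
    X.IsDeriv α (X.ofTest φ) (X.ofTest (TestSpace.deriv α φ)) := by
  intro ψ
  rw [X.toUltra_ofTest, X.toUltra_ofTest]
  exact φ.isRapid.integral_multiDeriv_mul ψ.isRapid α

theorem ofTest_bound : c.IndProj fun h => ∃ C : ℝ≥0, C ≠ 0 ∧ ∀ φ : TestSpace W c d,
    ‖X.ofTest φ‖ₑ ≤ C * (gsScale W d).toFun h φ.toSmooth := by
  have h := (gsScale W d).exists_bound_of_continuous
    ((normSeminorm ℂ E).comp (X.ofTest : TestSpace W c d →ₗ[ℂ] E))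
    (continuous_norm.comp X.ofTest.continuous)
  refine h.rescale one_pos fun h _ ⟨C, hC, hb⟩ => ⟨C, hC, fun φ => ?_⟩
  rw [one_mul, ← ofReal_norm]
  exact hb φ

/-- The inclusion into `E` is bounded by one norm `σ_h` that the rescaled estimate for `T_k φ - φ`
also controls; that estimate is linear in `‖k‖`. -/
theorem tendsto_translate_ofTest (φ : TestSpace W c d) :
    Tendsto (fun k => X.translate k (X.ofTest φ)) (𝓝 0) (𝓝 (X.ofTest φ)) := by
  obtain ⟨K, hK, hb⟩ := exists_gsScale_translate_sub_le (d := d) W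
  obtain ⟨h, hh, hfin, C, hC, hE⟩ := φ.finite.exists_and X.ofTest_bound hK
  obtain ⟨C', hC', hb⟩ := hb h hh
  rw [tendsto_iff_edist_tendsto_0]
  have ht : Tendsto (fun k : EuclideanSpace ℝ (Fin d) => (C : ℝ≥0∞) * ENNReal.ofReal
      (C' * ‖k‖ * ((gsScale W d).toFun (K * h) φ.toSmooth).toReal)) (𝓝 0) (𝓝 0) := by
    have h1 : Tendsto (fun k : EuclideanSpace ℝ (Fin d) => ENNReal.ofReal
        (C' * ‖k‖ * ((gsScale W d).toFun (K * h) φ.toSmooth).toReal)) (𝓝 0) (𝓝 0) := by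
      rw [← ENNReal.ofReal_zero]
      refine (ENNReal.continuous_ofReal.tendsto 0).comp ?_
      have : Continuous fun k : EuclideanSpace ℝ (Fin d) =>
        C' * ‖k‖ * ((gsScale W d).toFun (K * h) φ.toSmooth).toReal := by fun_prop
      simpa using this.tendsto 0
    simpa using ENNReal.Tendsto.const_mul h1 (Or.inr (by simp : (C : ℝ≥0∞) ≠ ∞))
  refine tendsto_of_tendsto_of_tendsto_of_le_of_le' tendsto_const_nhds ht
    (Eventually.of_forall fun _ => zero_le) ?_
  filter_upwards [Metric.closedBall_mem_nhds (0 : EuclideanSpace ℝ (Fin d)) one_pos] with k hk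
  rw [mem_closedBall_zero_iff] at hk
  rw [X.translate_ofTest, edist_eq_enorm_sub, ← map_sub]
  refine (hE _).trans ?_
  gcongr
  exact hb _ hfin k hk

theorem weight_bound : c.IndProj fun τ => ∃ C : ℝ, 0 < C ∧ ∀ k,
    X.weight k ≤ C * W.expA (τ * ‖k‖) := by
  have key : ∀ τ C : ℝ, 0 < C → (∀ (k : EuclideanSpace ℝ (Fin d)) (g g' : E),
      (∀ φ, X.toUltra g' φ = X.toUltra g (TestSpace.translate (-k) φ)) →
        ‖g'‖ ≤ C * ‖g‖ * Real.exp (assocFun W.A (τ * ‖k‖))) →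
      ∃ C : ℝ, 0 < C ∧ ∀ k, X.weight k ≤ C * W.expA (τ * ‖k‖) := by
    refine fun τ C hC h => ⟨C, hC, fun k => ?_⟩
    have hE := W.expA_pos (τ * ‖k‖)
    refine ContinuousLinearMap.opNorm_le_bound _ (by positivity) fun g => ?_
    refine (h (-k) g _ (X.toUltra_translate _ _)).trans_eq ?_
    rw [norm_neg, WeightSeqs.expA]
    ring
  have hb := X.translate_bound
  cases c with
  | beurling =>
    obtain ⟨τ, C, hτ, hC, h⟩ := hb
    exact ⟨τ, hτ, key τ C hC h⟩
  | roumieu =>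
    intro τ hτ
    obtain ⟨C, hC, h⟩ := hb τ hτ
    exact key τ C hC h

theorem exists_weight_bound : ∃ τ C : ℝ, 0 < τ ∧ 0 < C ∧ ∀ k,
    X.weight k ≤ C * W.expA (τ * ‖k‖) := by
  have := X.weight_bound
  cases c with
  | beurling => obtain ⟨τ, hτ, C, hC, h⟩ := this; exact ⟨τ, C, hτ, hC, h⟩
  | roumieu => obtain ⟨C, hC, h⟩ := this 1 one_pos; exact ⟨1, C, one_pos, hC, h⟩

theorem weight_nonneg (k : EuclideanSpace ℝ (Fin d)) : 0 ≤ X.weight k := norm_nonneg _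

theorem norm_translate_neg_le (k : EuclideanSpace ℝ (Fin d)) (g : E) :
    ‖X.translate (-k) g‖ ≤ X.weight k * ‖g‖ := (X.translate (-k)).le_opNorm g

/-- Approximation of `g` by test functions; on the unit ball `‖T_k‖` is at most `D = C e^{A(τ)}`. -/
theorem tendsto_translate (g : E) :
    Tendsto (fun k => X.translate k g) (𝓝 0) (𝓝 g) := by
  obtain ⟨τ, C, hτ, hC, hb⟩ := X.exists_weight_bound
  set D := C * W.expA τ with hD
  have hDp : 0 < D := mul_pos hC (W.expA_pos τ)
  rw [Metric.tendsto_nhds]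
  intro ε hε
  obtain ⟨φ, hφ⟩ := X.ofTest_dense.exists_dist_lt g (show 0 < ε / (2 * (D + 1)) by positivity)
  rw [dist_eq_norm] at hφ
  filter_upwards [Metric.closedBall_mem_nhds (0 : EuclideanSpace ℝ (Fin d)) one_pos,
    Metric.tendsto_nhds.1 (X.tendsto_translate_ofTest φ) (ε / 2) (by positivity)] with k hk hk2
  rw [mem_closedBall_zero_iff] at hk
  rw [dist_eq_norm] at hk2 ⊢
  have h1 : ‖X.translate k (g - X.ofTest φ)‖ ≤ D * ‖g - X.ofTest φ‖ := by
    have h2 := X.norm_translate_neg_le (-k) (g - X.ofTest φ)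
    rw [neg_neg] at h2
    refine h2.trans ?_
    gcongr
    refine (hb _).trans ?_
    rw [norm_neg, hD]
    gcongr
    exact W.expA_mono (by positivity) (mul_le_of_le_one_right hτ.le hk)
  have h3 : X.translate k g - g = X.translate k (g - X.ofTest φ) +
      (X.translate k (X.ofTest φ) - X.ofTest φ) - (g - X.ofTest φ) := by
    rw [map_sub]; abel
  rw [h3]
  calc _ ≤ D * ‖g - X.ofTest φ‖ + ‖X.translate k (X.ofTest φ) - X.ofTest φ‖ +
        ‖g - X.ofTest φ‖ := (norm_sub_le _ _).trans
          (add_le_add_left ((norm_add_le _ _).trans (add_le_add_left h1 _)) _)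
    _ = (D + 1) * ‖g - X.ofTest φ‖ + ‖X.translate k (X.ofTest φ) - X.ofTest φ‖ := by ring
    _ < (D + 1) * (ε / (2 * (D + 1))) + ε / 2 := by gcongr
    _ = ε := by field_simp; norm_num

theorem continuous_translate (g : E) : Continuous fun k => X.translate k g := by
  refine continuous_iff_continuousAt.2 fun k₀ => ?_
  have h1 : Tendsto (fun k => X.translate (k - k₀) g) (𝓝 k₀) (𝓝 g) := by
    refine (X.tendsto_translate g).comp ?_
    have : Continuous fun k : EuclideanSpace ℝ (Fin d) => k - k₀ := by fun_prop
    simpa using this.tendsto k₀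
  have h2 := ((X.translate k₀).continuous.tendsto g).comp h1
  refine h2.congr fun k => ?_
  rw [Function.comp_apply, ← X.translate_add, add_sub_cancel]

theorem continuous_translate_neg (g : E) : Continuous fun k => X.translate (-k) g :=
  (X.continuous_translate g).comp continuous_neg

/-- An operator norm is a supremum over vectors, so each superlevel set is a union of open sets. The
union may be uncountable, which openness tolerates. -/
theorem measurable_weight : Measurable X.weight := by
  refine measurable_of_Ioi fun a => IsOpen.measurableSet ?_
  rcases lt_or_ge a 0 with ha | ha
  · have : X.weight ⁻¹' Set.Ioi a = Set.univ :=
      Set.eq_univ_of_forall fun k => ha.trans_le (X.weight_nonneg k)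
    rw [this]
    exact isOpen_univ
  · have : X.weight ⁻¹' Set.Ioi a = ⋃ g : E, {k | a * ‖g‖ < ‖X.translate (-k) g‖} := by
      ext k
      simp only [Set.mem_preimage, Set.mem_Ioi, Set.mem_iUnion, Set.mem_ofPred_eq]
      constructor
      · intro h
        by_contra! h'
        exact absurd (ContinuousLinearMap.opNorm_le_bound _ ha h') (not_le.2 h)
      · rintro ⟨g, hg⟩
        by_contra! h'
        exact absurd ((X.norm_translate_neg_le k g).trans
          (mul_le_mul_of_nonneg_right h' (norm_nonneg g))) (not_le.2 hg)
    rw [this]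
    exact isOpen_iUnion fun g => isOpen_lt continuous_const (X.continuous_translate_neg g).norm

theorem weight_add_le (k l : EuclideanSpace ℝ (Fin d)) :
    X.weight (k + l) ≤ X.weight k * X.weight l := by
  refine ContinuousLinearMap.opNorm_le_bound _
    (mul_nonneg (X.weight_nonneg k) (X.weight_nonneg l)) fun g => ?_
  rw [neg_add, X.translate_add, mul_assoc]
  refine (X.norm_translate_neg_le _ _).trans ?_
  exact mul_le_mul_of_nonneg_left (X.norm_translate_neg_le _ _) (X.weight_nonneg k)

/-- `T_{-k}` is invertible on a nonzero space. Positivity makes `ω dx` and `dx` have the same null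
sets. -/
theorem weight_pos (k : EuclideanSpace ℝ (Fin d)) : 0 < X.weight k := by
  refine (X.weight_nonneg k).lt_of_ne fun h => ?_
  obtain ⟨φ, hφ⟩ := TestSpace.exists_ne_zero W c d
  have h1 := X.norm_translate_neg_le k (X.translate k (X.ofTest φ))
  rw [← h, zero_mul, ← X.translate_add, neg_add_cancel, X.translate_zero, norm_le_zero_iff] at h1
  exact hφ (X.ofTest_injective (h1.trans (map_zero _).symm))

/-! ### The Beurling algebra -/

theorem ae_weightMeasure {p : EuclideanSpace ℝ (Fin d) → Prop} :
    (∀ᵐ x ∂X.weightMeasure, p x) ↔ ∀ᵐ x, p x := by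
  constructor
  · intro h
    refine (withDensity_absolutelyContinuous' ?_ ?_).ae_le h
    · exact X.measurable_weight.ennreal_ofReal.aemeasurable
    · exact ae_of_all _ fun x => (ENNReal.ofReal_pos.2 (X.weight_pos x)).ne'
  · intro h
    exact (withDensity_absolutelyContinuous _ _).ae_le h

theorem aestronglyMeasurable_of_weightMeasure {F : Type*} [TopologicalSpace F]
    {u : EuclideanSpace ℝ (Fin d) → F}
    (hu : AEStronglyMeasurable u X.weightMeasure) : AEStronglyMeasurable u volume :=
  hu.mono_ac (withDensity_absolutelyContinuous'
    X.measurable_weight.ennreal_ofReal.aemeasurable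
    (ae_of_all _ fun x => (ENNReal.ofReal_pos.2 (X.weight_pos x)).ne'))

theorem integrable_weightMeasure_iff {u : EuclideanSpace ℝ (Fin d) → ℂ} :
    Integrable u X.weightMeasure ↔
      AEStronglyMeasurable u volume ∧ Integrable fun x => X.weight x * ‖u x‖ := by
  have h := integrable_withDensity_iff_integrable_smul' (μ := volume)
    (f := fun x => ENNReal.ofReal (X.weight x)) (g := u) X.measurable_weight.ennreal_ofReal
    (ae_of_all _ fun x => ENNReal.ofReal_lt_top)
  have hn : ∀ x, ‖(ENNReal.ofReal (X.weight x)).toReal • u x‖ = X.weight x * ‖u x‖ := fun x => by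
    rw [ENNReal.toReal_ofReal (X.weight_nonneg x), norm_smul,
      Real.norm_of_nonneg (X.weight_nonneg x)]
  constructor
  · intro hu
    refine ⟨X.aestronglyMeasurable_of_weightMeasure hu.aestronglyMeasurable, ?_⟩
    exact (h.1 hu).norm.congr (ae_of_all _ hn)
  · rintro ⟨hm, hu⟩
    refine h.2 (hu.mono' ?_ (ae_of_all _ fun x => (hn x).le))
    exact X.measurable_weight.ennreal_ofReal.ennreal_toReal.aestronglyMeasurable.smul hm

theorem integral_norm_weightMeasure (u : EuclideanSpace ℝ (Fin d) → ℂ) :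
    ∫ x, ‖u x‖ ∂X.weightMeasure = ∫ x, X.weight x * ‖u x‖ := by
  rw [weightMeasure, integral_withDensity_eq_integral_toReal_smul
    X.measurable_weight.ennreal_ofReal (ae_of_all _ fun x => ENNReal.ofReal_lt_top)]
  refine integral_congr_ae (ae_of_all _ fun x => ?_)
  simp only [ENNReal.toReal_ofReal (X.weight_nonneg x), smul_eq_mul]

theorem Beurling.norm_eq (u : X.Beurling) : ‖u‖ = ∫ x, X.weight x * ‖u x‖ := by
  rw [L1.norm_eq_integral_norm, X.integral_norm_weightMeasure]

theorem Beurling.integrable (u : X.Beurling) : Integrable u X.weightMeasure :=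
  L1.integrable_coeFn u

/-! ### The convolution `L¹_ω × E → E` as a vector-valued integral. -/

section Convolution

variable {u : EuclideanSpace ℝ (Fin d) → ℂ}

theorem integrable_smul_translate (hu : Integrable u X.weightMeasure) (g : E) :
    Integrable fun y => u y • X.translate (-y) g := by
  obtain ⟨hm, hi⟩ := X.integrable_weightMeasure_iff.1 hu
  refine (hi.mul_const ‖g‖).mono'
    (hm.smul (X.continuous_translate_neg g).aestronglyMeasurable) (ae_of_all _ fun y => ?_)
  rw [norm_smul, mul_comm (X.weight y), mul_assoc]
  exact mul_le_mul_of_nonneg_left (X.norm_translate_neg_le y g) (norm_nonneg _)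

theorem norm_integral_smul_translate_le (hu : Integrable u X.weightMeasure) (g : E) :
    ‖∫ y, u y • X.translate (-y) g‖ ≤ (∫ y, X.weight y * ‖u y‖) * ‖g‖ := by
  obtain ⟨hm, hi⟩ := X.integrable_weightMeasure_iff.1 hu
  rw [← integral_mul_const]
  refine norm_integral_le_of_norm_le (hi.mul_const ‖g‖) (ae_of_all _ fun y => ?_)
  rw [norm_smul, mul_comm (X.weight y), mul_assoc]
  exact mul_le_mul_of_nonneg_left (X.norm_translate_neg_le y g) (norm_nonneg _)

end Convolution

/-- The convolution `u * g = ∫ u(y) T_{-y} g dy`. -/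
def conv : X.Beurling →L[ℂ] E →L[ℂ] E :=
  LinearMap.mkContinuous₂
    (LinearMap.mk₂ ℂ (fun (u : X.Beurling) (g : E) => ∫ y, u y • X.translate (-y) g)
      (fun u v g => by
        rw [← integral_add (X.integrable_smul_translate u.integrable g)
          (X.integrable_smul_translate v.integrable g)]
        refine integral_congr_ae ?_
        filter_upwards [X.ae_weightMeasure.1 (Lp.coeFn_add u v)] with y hy
        rw [hy, Pi.add_apply, add_smul])
      (fun a u g => by
        rw [← integral_smul]
        refine integral_congr_ae ?_
        filter_upwards [X.ae_weightMeasure.1 (Lp.coeFn_smul a u)] with y hy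
        rw [hy, Pi.smul_apply, smul_assoc])
      (fun u g g' => by
        rw [← integral_add (X.integrable_smul_translate u.integrable g)
          (X.integrable_smul_translate u.integrable g')]
        simp only [map_add, smul_add])
      (fun a u g => by
        rw [← integral_smul]
        simp only [map_smul, smul_comm a]))
    1 (fun u g => by
      rw [one_mul, Beurling.norm_eq]
      exact X.norm_integral_smul_translate_le u.integrable g)

theorem conv_apply (u : X.Beurling) (g : E) : X.conv u g = ∫ y, u y • X.translate (-y) g := rfl

theorem conv_apply_of_ae {u : X.Beurling} {f : EuclideanSpace ℝ (Fin d) → ℂ}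
    (h : u =ᵐ[X.weightMeasure] f) (g : E) : X.conv u g = ∫ y, f y • X.translate (-y) g := by
  rw [conv_apply]
  refine integral_congr_ae ?_
  filter_upwards [X.ae_weightMeasure.1 h] with y hy
  rw [hy]

theorem norm_conv_le (u : X.Beurling) (g : E) : ‖X.conv u g‖ ≤ ‖u‖ * ‖g‖ := by
  rw [conv_apply, Beurling.norm_eq]
  exact X.norm_integral_smul_translate_le u.integrable g

section Complete

variable [CompleteSpace E]

/-- Evaluation at a test function passes under the Bochner integral. Since elements of `E` are
separated by these evaluations, identities for `*` reduce to scalar integrals. -/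
theorem toUltra_conv (u : X.Beurling) (g : E) (ψ : TestSpace W c d) :
    X.toUltra (X.conv u g) ψ = ∫ y, u y * X.toUltra g (TestSpace.translate y ψ) := by
  rw [conv_apply, ← pairing_apply,
    ← (X.pairing ψ).integral_comp_comm (X.integrable_smul_translate u.integrable g)]
  refine integral_congr_ae (ae_of_all _ fun y => ?_)
  simp only [map_smul, smul_eq_mul, pairing_apply, X.toUltra_translate, neg_neg]

/-- Derivatives commute with the translations under the integral. -/
theorem IsDeriv.conv {α : Fin d → ℕ} {g g' : E} (h : X.IsDeriv α g g') (u : X.Beurling) :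
    X.IsDeriv α (X.conv u g) (X.conv u g') := by
  intro φ
  rw [X.toUltra_conv, X.toUltra_conv, ← integral_const_mul]
  refine integral_congr_ae (ae_of_all _ fun y => ?_)
  simp only
  rw [h, TestSpace.deriv_translate]
  ring

theorem translate_conv (k : EuclideanSpace ℝ (Fin d)) (u : X.Beurling) (g : E) :
    X.translate k (X.conv u g) = X.conv u (X.translate k g) := by
  rw [conv_apply, ← (X.translate k).integral_comp_comm
    (X.integrable_smul_translate u.integrable g), conv_apply]
  refine integral_congr_ae (ae_of_all _ fun y => ?_)
  simp only [map_smul]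
  rw [← X.translate_add, ← X.translate_add, add_comm]

/-- `∂^α (u * g) = u * ∂^α g` allows the bound on `E` to be applied term by term, so neither the
parameter nor the constant deteriorates. -/
theorem derivNorm_conv_le (m : ℝ) (u : X.Beurling) (g : E) :
    X.derivNorm m (X.conv u g) ≤ ‖u‖ₑ * X.derivNorm m g := by
  by_cases hg : ∃ G : (Fin d → ℕ) → E, ∀ α, X.IsDeriv α g (G α)
  · obtain ⟨G, hG⟩ := hg
    rw [X.derivNorm_eq m hG, X.derivNorm_eq m fun α => (hG α).conv X u]
    refine iSup_le fun α => ?_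
    refine le_trans ?_ (mul_le_mul_right (le_iSup _ α) _)
    rw [mul_left_comm]
    gcongr
    have h := ENNReal.ofReal_le_ofReal (X.norm_conv_le u (G α))
    rwa [ENNReal.ofReal_mul (norm_nonneg _), ofReal_norm, ofReal_norm, ofReal_norm] at h
  · rw [X.derivNorm_eq_top m hg]
    -- If `g` lacks a derivative in `E`, the right side is `∞` except when `u = 0`, where `0 * ∞ =
    -- 0`.
    rcases eq_or_ne u 0 with rfl | hu
    · rw [map_zero, zero_apply]
      simpa using (show X.derivNorm m 0 = 0 from X.derivScale.map_zero m).le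
    · rw [ENNReal.mul_top (by simpa using hu)]
      exact le_top

end Complete

end TIBSpace

/-! ### Approximate identities -/

/-- `ψ n = (n + 1) ^ d ψ₀((n + 1) ·)` is an approximate identity of test functions. -/
structure IsApproxIdentity (W : WeightSeqs) (ψ : ℕ → Smooth d)
    (ψ₀ : EuclideanSpace ℝ (Fin d) → ℂ) : Prop where
  finite : ∀ n h, 0 < h → (gsScale W d).toFun h (ψ n) < ∞
  apply_eq : ∀ n x, (ψ n).1 x = (n + 1) ^ d * ψ₀ (((n : ℝ) + 1) • x)
  continuous : Continuous ψ₀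
  integrable_expA : ∀ h : ℝ, 0 < h → Integrable fun y => W.expA (h * ‖y‖) * ‖ψ₀ y‖
  integral_eq_one : ∫ y, ψ₀ y = 1

theorem exists_isApproxIdentity (W : WeightSeqs) (d : ℕ) :
    ∃ (ψ : ℕ → Smooth d) (ψ₀ : EuclideanSpace ℝ (Fin d) → ℂ), IsApproxIdentity W ψ ψ₀ := by
  obtain ⟨ψ, ψ₀, h1, h2, h3, h4, h5⟩ := exists_approxIdentity W d
  exact ⟨ψ, ψ₀, h1, h2, h3, h4, h5⟩

theorem integral_dilate {F : Type*} [NormedAddCommGroup F] [NormedSpace ℝ F] (n : ℕ)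
    (Φ : EuclideanSpace ℝ (Fin d) → F) :
    ∫ y, (((n : ℝ) + 1) ^ d) • Φ (((n : ℝ) + 1) • y) = ∫ z, Φ z := by
  have hn : (0 : ℝ) < (n : ℝ) + 1 := by positivity
  rw [integral_smul, Measure.integral_comp_smul, finrank_euclideanSpace, Fintype.card_fin,
    abs_of_pos (by positivity), smul_smul, mul_inv_cancel₀ (by positivity), one_smul]

namespace IsApproxIdentity

variable {W : WeightSeqs} {ψ : ℕ → Smooth d} {ψ₀ : EuclideanSpace ℝ (Fin d) → ℂ}

theorem integral_smul_eq (hψ : IsApproxIdentity W ψ ψ₀) {F : Type*} [NormedAddCommGroup F]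
    [NormedSpace ℂ F] (n : ℕ) (f : EuclideanSpace ℝ (Fin d) → F) :
    ∫ y, (ψ n).1 y • f y = ∫ z, ψ₀ z • f (((n : ℝ) + 1)⁻¹ • z) := by
  have hn : (0 : ℝ) < (n : ℝ) + 1 := by positivity
  rw [← integral_dilate n fun z => ψ₀ z • f (((n : ℝ) + 1)⁻¹ • z)]
  refine integral_congr_ae (ae_of_all _ fun y => ?_)
  simp only
  rw [hψ.apply_eq, smul_smul (((n : ℝ) + 1)⁻¹), inv_mul_cancel₀ hn.ne', one_smul, mul_smul,
    ← Complex.coe_smul]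
  push_cast
  rfl

theorem norm_inv_smul_le (n : ℕ) (z : EuclideanSpace ℝ (Fin d)) :
    ‖((n : ℝ) + 1)⁻¹ • z‖ ≤ ‖z‖ := by
  rw [norm_smul, Real.norm_of_nonneg (by positivity)]
  refine mul_le_of_le_one_left (norm_nonneg _) (inv_le_one_of_one_le₀ ?_)
  linarith [n.cast_nonneg (α := ℝ)]

/-- After the substitution `z = (n + 1) y`, dominated convergence applies: shrinking `z` does not
increase the weight, so `C e^{A(τ|z|)} |ψ₀(z)|` dominates for all `n`. -/
theorem tendsto_integral_smul (hψ : IsApproxIdentity W ψ ψ₀) {F : Type*} [NormedAddCommGroup F]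
    [NormedSpace ℂ F] [CompleteSpace F] {f : EuclideanSpace ℝ (Fin d) → F} (hf : Continuous f)
    {C τ : ℝ} (hτ : 0 < τ) (hC : 0 ≤ C) (hb : ∀ y, ‖f y‖ ≤ C * W.expA (τ * ‖y‖)) :
    Tendsto (fun n => ∫ y, (ψ n).1 y • f y) atTop (𝓝 (f 0)) := by
  simp only [hψ.integral_smul_eq]
  have h0 : f 0 = ∫ z, ψ₀ z • f 0 := by
    rw [integral_smul_const, hψ.integral_eq_one, one_smul]
  rw [h0]
  have hc := hψ.continuous
  refine tendsto_integral_of_dominated_convergence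
    (fun z => C * (W.expA (τ * ‖z‖) * ‖ψ₀ z‖)) (fun n => ?_)
    ((hψ.integrable_expA τ hτ).const_mul C) (fun n => ae_of_all _ fun z => ?_)
    (ae_of_all _ fun z => ?_)
  · exact Continuous.aestronglyMeasurable (by fun_prop)
  · rw [norm_smul]
    have h1 := hb (((n : ℝ) + 1)⁻¹ • z)
    have h2 : W.expA (τ * ‖((n : ℝ) + 1)⁻¹ • z‖) ≤ W.expA (τ * ‖z‖) :=
      W.expA_mono (by positivity) (by gcongr; exact norm_inv_smul_le n z)
    calc _ ≤ ‖ψ₀ z‖ * (C * W.expA (τ * ‖z‖)) := by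
          gcongr
          exact h1.trans (by gcongr)
      _ = _ := by ring
  · refine (Tendsto.smul tendsto_const_nhds ((hf.tendsto 0).comp ?_))
    have h1 : Tendsto (fun n : ℕ => ((n : ℝ) + 1)⁻¹) atTop (𝓝 0) := by
      simpa using tendsto_one_div_add_atTop_nhds_zero_nat (𝕜 := ℝ)
    simpa using h1.smul_const z

end IsApproxIdentity

/-! ### Weighted integrability of test functions -/

theorem integrable_expA_anti {W : WeightSeqs} {f : EuclideanSpace ℝ (Fin d) → ℂ}
    (hm : AEStronglyMeasurable f volume) {h k : ℝ} (hh : 0 < h) (hk : h ≤ k)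
    (hf : Integrable fun y => W.expA (k * ‖y‖) * ‖f y‖) :
    Integrable fun y => W.expA (h * ‖y‖) * ‖f y‖ := by
  refine hf.mono' ?_ (ae_of_all _ fun y => ?_)
  · have := W.measurable_expA.comp (f := fun y : EuclideanSpace ℝ (Fin d) => h * ‖y‖)
      (by fun_prop)
    exact this.aestronglyMeasurable.mul hm.norm
  · have := W.expA_pos (h * ‖y‖)
    rw [Real.norm_of_nonneg (by positivity)]
    refine mul_le_mul_of_nonneg_right (W.expA_mono (by positivity) ?_) (norm_nonneg _)
    gcongr

namespace TestSpace

variable {W : WeightSeqs} {c : UltraClass}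

/-- Finiteness of the norm with parameter `H h` gives decay `e^{-2A(h|y|)}` up to a constant; one
factor offsets the weight, the other is integrable. -/
theorem integrable_expA (φ : TestSpace W c d) :
    c.ProjInd fun h => Integrable fun y => W.expA (h * ‖y‖) * ‖fn φ y‖ := by
  obtain ⟨C, H, hC, hH, hsq⟩ := W.exists_expA_sq_le
  have hH0 : 0 < H := by linarith
  refine φ.finite.rescale hH0 fun h hh hfin => ?_
  refine ((W.integrable_inv_expA hh).const_mul
    (((gsScale W d).toFun (H * h) φ.toSmooth).toReal * C)).mono' ?_ (ae_of_all _ fun x => ?_)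
  · exact ((W.measurable_expA.comp (by fun_prop)).mul
      φ.continuous_fn.norm.measurable).aestronglyMeasurable
  · have h1 := norm_multiDeriv_le W (by positivity) hfin 0 x
    have h2 := hsq (h * ‖x‖) (by positivity)
    have hE := W.expA_pos (h * ‖x‖)
    have hE2 := W.expA_pos (H * h * ‖x‖)
    rw [multiDeriv_zero] at h1
    simp only [Pi.zero_apply, Finset.sum_const_zero, W.M_zero, pow_zero, div_one, mul_one] at h1
    set S := ((gsScale W d).toFun (H * h) φ.toSmooth).toReal
    rw [← div_eq_mul_inv, le_div_iff₀ hE2] at h1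
    rw [Real.norm_of_nonneg (by positivity), ← div_eq_mul_inv, le_div_iff₀ hE]
    rw [← mul_assoc] at h2
    calc W.expA (h * ‖x‖) * ‖fn φ x‖ * W.expA (h * ‖x‖)
        = ‖fn φ x‖ * (W.expA (h * ‖x‖) * W.expA (h * ‖x‖)) := by ring
      _ ≤ ‖fn φ x‖ * (C * W.expA (H * h * ‖x‖)) := by gcongr
      _ = C * (‖fn φ x‖ * W.expA (H * h * ‖x‖)) := by ring
      _ ≤ C * S := by gcongr; exact h1
      _ = _ := mul_comm _ _

/-- The convolution `f * ψ` of a function with sufficient decay and a test function. -/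
theorem exists_convolution {f : EuclideanSpace ℝ (Fin d) → ℂ} (hfi : Integrable f)
    (hf : c.ProjInd fun h => Integrable fun y => W.expA (h * ‖y‖) * ‖f y‖)
    (ψ : TestSpace W c d) :
    ∃ χ : TestSpace W c d, χ.toSmooth = smoothConv hfi ψ.isRapid := by
  refine ⟨ofSmooth (smoothConv hfi ψ.isRapid) ?_, rfl⟩
  refine (hf.and ψ.finite (fun h k hh hk => integrable_expA_anti hfi.aestronglyMeasurable hh hk)
    (fun h k hh hk hlt => ((gsScale W d).mono hh hk _).trans_lt hlt)).rescale two_pos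
    fun h hh ⟨h1, h2⟩ => ?_
  exact (gsScale_smoothConv_le hfi ψ.isRapid hh h1 h2).trans_lt ENNReal.ofReal_lt_top

end TestSpace

/-! ### Test functions in the Beurling algebra and the extension of their convolution. -/

namespace TIBSpace

variable {W : WeightSeqs} {c : UltraClass} {E : Type*} [NormedAddCommGroup E] [NormedSpace ℂ E]
  (X : TIBSpace W c d E)

theorem integrable_weight_mul_inv_expA :
    c.IndProj fun h => Integrable fun x => X.weight x * (W.expA (h * ‖x‖))⁻¹ := by
  obtain ⟨C, H, hC, hH, hsq⟩ := W.exists_expA_sq_le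
  have hH0 : 0 < H := by linarith
  refine X.weight_bound.rescale hH0 fun τ hτ ⟨D, hD, hb⟩ => ?_
  refine ((W.integrable_inv_expA hτ).const_mul (D * C)).mono' ?_ (ae_of_all _ fun x => ?_)
  · exact (X.measurable_weight.mul
      (W.measurable_expA.comp (by fun_prop)).inv).aestronglyMeasurable
  · have hE := W.expA_pos (τ * ‖x‖)
    have hE2 := W.expA_pos (H * τ * ‖x‖)
    have hw := X.weight_nonneg x
    have h2 := hsq (τ * ‖x‖) (by positivity)
    rw [← mul_assoc] at h2
    rw [Real.norm_of_nonneg (by positivity), ← div_eq_mul_inv, ← div_eq_mul_inv,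
      div_le_div_iff₀ hE2 hE]
    calc X.weight x * W.expA (τ * ‖x‖) ≤ D * W.expA (τ * ‖x‖) * W.expA (τ * ‖x‖) := by
          gcongr; exact hb x
      _ = D * (W.expA (τ * ‖x‖) * W.expA (τ * ‖x‖)) := by ring
      _ ≤ D * (C * W.expA (H * τ * ‖x‖)) := by gcongr
      _ = _ := by ring

theorem integrable_weightMeasure_of_expA {f : EuclideanSpace ℝ (Fin d) → ℂ}
    (hm : AEStronglyMeasurable f volume)
    (hf : c.ProjInd fun h => Integrable fun y => W.expA (h * ‖y‖) * ‖f y‖) :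
    Integrable f X.weightMeasure := by
  obtain ⟨h, hh, hi, C, hC, hb⟩ := hf.exists_and X.weight_bound one_pos
  rw [one_mul] at hi
  refine X.integrable_weightMeasure_iff.2 ⟨hm, (hi.const_mul C).mono'
    (X.measurable_weight.aestronglyMeasurable.mul hm.norm) (ae_of_all _ fun y => ?_)⟩
  rw [Real.norm_of_nonneg (mul_nonneg (X.weight_nonneg y) (norm_nonneg _)), ← mul_assoc]
  exact mul_le_mul_of_nonneg_right (hb y) (norm_nonneg _)

theorem integrable_fn (φ : TestSpace W c d) : Integrable (TestSpace.fn φ) X.weightMeasure :=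
  X.integrable_weightMeasure_of_expA φ.continuous_fn.aestronglyMeasurable φ.integrable_expA

/-- A test function as an element of the Beurling algebra. -/
def toBeurling (φ : TestSpace W c d) : X.Beurling := (X.integrable_fn φ).toL1 _

theorem coeFn_toBeurling (φ : TestSpace W c d) :
    X.toBeurling φ =ᵐ[X.weightMeasure] TestSpace.fn φ := Integrable.coeFn_toL1 _

theorem norm_eq_of_ae {u : X.Beurling} {f : EuclideanSpace ℝ (Fin d) → ℂ}
    (h : u =ᵐ[X.weightMeasure] f) : ‖u‖ = ∫ x, X.weight x * ‖f x‖ := by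
  rw [Beurling.norm_eq]
  refine integral_congr_ae ?_
  filter_upwards [X.ae_weightMeasure.1 h] with x hx
  rw [hx]

/-- Continuity of the inclusion of test functions into `L¹_ω`, in the form of norm estimates. -/
theorem toBeurling_bound : c.IndProj fun h => ∃ C : ℝ≥0, C ≠ 0 ∧ ∀ φ : TestSpace W c d,
    ‖X.toBeurling φ‖ₑ ≤ C * (gsScale W d).toFun h φ.toSmooth := by
  refine X.integrable_weight_mul_inv_expA.rescale one_pos fun h hh hi => ?_
  rw [one_mul]
  have hI : 0 ≤ ∫ x, X.weight x * (W.expA (h * ‖x‖))⁻¹ :=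
    integral_nonneg fun x => mul_nonneg (X.weight_nonneg x) (inv_nonneg.2 (W.expA_pos _).le)
  -- Adding `1` keeps the constant nonzero, for test functions whose norm with this parameter is
  -- `∞`.
  refine ⟨Real.toNNReal ((∫ x, X.weight x * (W.expA (h * ‖x‖))⁻¹) + 1),
    (Real.toNNReal_pos.2 (by linarith)).ne', fun φ => ?_⟩
  by_cases hfin : (gsScale W d).toFun h φ.toSmooth = ∞
  · rw [hfin, ENNReal.mul_top]
    · exact le_top
    · simpa using by linarith
  have hfin' := lt_top_iff_ne_top.2 hfin
  set S := ((gsScale W d).toFun h φ.toSmooth).toReal with hS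
  have hS0 : 0 ≤ S := ENNReal.toReal_nonneg
  rw [← ENNReal.ofReal_toReal hfin, ← hS, ← ofReal_norm, X.norm_eq_of_ae (X.coeFn_toBeurling φ)]
  change _ ≤ ENNReal.ofReal _ * _
  rw [← ENNReal.ofReal_mul (by positivity)]
  refine ENNReal.ofReal_le_ofReal ?_
  have h1 : ∫ x, X.weight x * ‖TestSpace.fn φ x‖ ≤
      ∫ x, (X.weight x * (W.expA (h * ‖x‖))⁻¹) * S := by
    refine integral_mono (X.integrable_weightMeasure_iff.1 (X.integrable_fn φ)).2
      (hi.mul_const S) fun x => ?_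
    simp only
    rw [mul_assoc]
    refine mul_le_mul_of_nonneg_left ?_ (X.weight_nonneg x)
    have h2 := norm_multiDeriv_le W hh hfin' 0 x
    rw [multiDeriv_zero] at h2
    simp only [Pi.zero_apply, Finset.sum_const_zero, W.M_zero, pow_zero, div_one, mul_one] at h2
    rw [mul_comm]
    exact h2
  rw [integral_mul_const] at h1
  nlinarith

section Complete

variable [CompleteSpace E]

/-- Both sides are paired with a test function `θ`; Fubini moves the translation from `ψ` to `θ`. -/
theorem conv_ofTest {f : EuclideanSpace ℝ (Fin d) → ℂ} (hfi : Integrable f) {u : X.Beurling}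
    (hu : u =ᵐ[X.weightMeasure] f) {ψ χ : TestSpace W c d}
    (hχ : χ.toSmooth = smoothConv hfi ψ.isRapid) :
    X.conv u (X.ofTest ψ) = X.ofTest χ := by
  refine X.eq_of_toUltra fun θ => ?_
  rw [X.toUltra_conv, X.toUltra_ofTest]
  have h1 : ∀ x, TestSpace.fn χ x * TestSpace.fn θ x =
      ∫ y, f y * TestSpace.fn ψ (x - y) * TestSpace.fn θ x := by
    intro x
    rw [integral_mul_const, TestSpace.fn_eq χ, hχ, smoothConv_apply]
    rfl
  simp only [h1]
  obtain ⟨C, -, hC⟩ := ψ.isRapid.exists_norm_le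
  rw [integral_integral_swap]
  · refine integral_congr_ae ?_
    filter_upwards [X.ae_weightMeasure.1 hu] with y hy
    rw [hy, X.toUltra_ofTest, ← integral_const_mul, ← integral_sub_right_eq_self _ y]
    refine integral_congr_ae (ae_of_all _ fun x => ?_)
    simp only [TestSpace.fn_translate, sub_add_cancel, mul_assoc]
  · have h2 : Integrable (fun p : EuclideanSpace ℝ (Fin d) × EuclideanSpace ℝ (Fin d) =>
        TestSpace.fn θ p.1 * f p.2) (volume.prod volume) :=
      θ.isRapid.integrable.mul_prod hfi
    have hc := ψ.continuous_fn
    refine (h2.mul_bdd (g := fun p => TestSpace.fn ψ (p.1 - p.2)) (c := C)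
      (Continuous.aestronglyMeasurable (by fun_prop)) (ae_of_all _ fun p => hC _)).congr
      (ae_of_all _ fun p => ?_)
    simp only [Function.uncurry]
    ring

theorem extendsConvolution_conv : X.ExtendsConvolution X.conv := by
  intro φ ψ
  obtain ⟨χ, hχ⟩ := TestSpace.exists_convolution φ.isRapid.integrable φ.integrable_expA ψ
  refine ⟨X.toBeurling φ, χ, X.coeFn_toBeurling φ, fun x => ?_, ?_⟩
  · rw [TestSpace.fn_eq χ, hχ, smoothConv_apply]
    rfl
  · exact X.conv_ofTest φ.isRapid.integrable (X.coeFn_toBeurling φ) hχ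

end Complete

/-! ### Density of the test functions in the Beurling algebra -/

/-- Makes compactly supported continuous functions dense in `L¹_ω`; the weight is locally bounded by
the growth estimate for translations. -/
instance : IsLocallyFiniteMeasure X.weightMeasure := by
  obtain ⟨τ, C, hτ, hC, hb⟩ := X.exists_weight_bound
  refine ⟨fun x => ⟨Metric.ball x 1, Metric.ball_mem_nhds x one_pos, ?_⟩⟩
  rw [weightMeasure, withDensity_apply _ measurableSet_ball]
  refine (setLIntegral_mono (g := fun _ => ENNReal.ofReal (C * W.expA (τ * (‖x‖ + 1))))
    measurable_const fun y hy => ENNReal.ofReal_le_ofReal ((hb y).trans ?_)).trans_lt ?_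
  · rw [mem_ball_iff_norm] at hy
    refine mul_le_mul_of_nonneg_left (W.expA_mono (by positivity) ?_) hC.le
    have := norm_le_norm_add_norm_sub' y x
    gcongr
    linarith
  · rw [setLIntegral_const]
    exact ENNReal.mul_lt_top ENNReal.ofReal_lt_top measure_ball_lt_top

/-- The approximants are `f * ψ_n`. Smoothness comes from `ψ_n`, and `f` has every weighted
integrability by compact support, so they are test functions in both classes. -/
theorem exists_toBeurling_near {f : EuclideanSpace ℝ (Fin d) → ℂ} (hfc : Continuous f)
    (hfs : HasCompactSupport f) {u : X.Beurling} (hu : u =ᵐ[X.weightMeasure] f) {ε : ℝ}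
    (hε : 0 < ε) : ∃ φ : TestSpace W c d, ‖X.toBeurling φ - u‖ < ε := by
  obtain ⟨ψ, ψ₀, hψ⟩ := exists_isApproxIdentity W d
  obtain ⟨R, hR⟩ := hfs.isBounded.exists_norm_le
  obtain ⟨B, hB⟩ := hfc.bounded_above_of_compact_support hfs
  have hB0 : 0 ≤ B := (norm_nonneg _).trans (hB 0)
  have hfi : Integrable f := hfc.integrable_of_hasCompactSupport hfs
  have hR0 : ∀ x, f x ≠ 0 → ‖x‖ ≤ max R 0 := fun x hx =>
    (hR x (subset_tsupport _ hx)).trans (le_max_left _ _)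
  have hdec : ∀ h, 0 < h → ∀ y, W.expA (h * ‖y‖) * ‖f y‖ ≤ W.expA (h * max R 0) * B := by
    intro h hh y
    have h1 := W.expA_pos (h * max R 0)
    have h2 := W.expA_pos (h * ‖y‖)
    by_cases hy : f y = 0
    · rw [hy, norm_zero, mul_zero]
      positivity
    · refine mul_le_mul (W.expA_mono (by positivity) ?_) (hB y) (norm_nonneg _) h1.le
      have := hR0 y hy
      gcongr
  have hfw : ∀ h, 0 < h → Integrable fun y => W.expA (h * ‖y‖) * ‖f y‖ := by
    intro h hh
    refine (hfi.norm.const_mul (W.expA (h * max R 0))).mono' ?_ (ae_of_all _ fun y => ?_)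
    · exact ((W.measurable_expA.comp (by fun_prop)).mul
        hfc.norm.measurable).aestronglyMeasurable
    · have h2 := W.expA_pos (h * ‖y‖)
      rw [Real.norm_of_nonneg (by positivity)]
      by_cases hy : f y = 0
      · simp [hy]
      · refine mul_le_mul_of_nonneg_right (W.expA_mono (by positivity) ?_) (norm_nonneg _)
        have := hR0 y hy
        gcongr
  choose χ hχ using fun n => TestSpace.exists_convolution (c := c) hfi
    (UltraClass.projInd_of_forall hfw)
    (TestSpace.ofSmooth (ψ n) (UltraClass.projInd_of_forall (hψ.finite n)))
  have hval : ∀ n x, TestSpace.fn (χ n) x = ∫ y, (ψ n).1 y • f (x - y) := by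
    intro n x
    rw [TestSpace.fn_eq, hχ, smoothConv_apply, ← integral_sub_left_eq_self _ volume x]
    simp only [sub_sub_cancel, smul_eq_mul]
    exact integral_congr_ae (ae_of_all _ fun y => mul_comm _ _)
  have hlim : ∀ x, Tendsto (fun n => TestSpace.fn (χ n) x) atTop (𝓝 (f x)) := by
    intro x
    simp only [hval]
    have := hψ.tendsto_integral_smul (f := fun y => f (x - y)) (by fun_prop) one_pos hB0
      (fun y => (hB _).trans (le_mul_of_one_le_right hB0 (W.one_le_expA _)))
    simpa using this
  -- The trivial predicate only serves to extract one parameter with `ω e^{-A(h|·|)}` integrable.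
  obtain ⟨h, hh, -, hwi⟩ := (UltraClass.projInd_of_forall (c := c) (P := fun _ => True)
    fun _ _ => trivial).exists_and X.integrable_weight_mul_inv_expA one_pos
  set I := ∫ z, W.expA (2 * h * ‖z‖) * ‖ψ₀ z‖ with hI
  -- A bound independent of `n`, so that dominated convergence applies with a multiple of `ω
  -- e^{-A(h|·|)}`.
  have hbound : ∀ n x, ‖TestSpace.fn (χ n) x‖ ≤
      I * (W.expA (2 * h * max R 0) * B) * (W.expA (h * ‖x‖))⁻¹ := by
    intro n x
    rw [hval, hψ.integral_smul_eq, hI, mul_assoc, ← integral_mul_const]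
    refine norm_integral_le_of_norm_le
      ((hψ.integrable_expA (2 * h) (by positivity)).mul_const _) (ae_of_all _ fun z => ?_)
    set w := ((n : ℝ) + 1)⁻¹ • z with hw
    have hwz : ‖w‖ ≤ ‖z‖ := IsApproxIdentity.norm_inv_smul_le n z
    have h1 := hdec (2 * h) (by positivity) (x - w)
    have hE := W.expA_pos (h * ‖x‖)
    have hEz := W.expA_pos (2 * h * ‖z‖)
    have h2 : W.expA (h * ‖x‖) ≤ W.expA (2 * h * ‖z‖) * W.expA (2 * h * ‖x - w‖) := by
      refine (W.expA_mono (by positivity) (?_ : h * ‖x‖ ≤ h * ‖z‖ + h * ‖x - w‖)).trans ?_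
      · rw [← mul_add]
        gcongr
        have := norm_le_norm_add_norm_sub' x w
        linarith
      · rw [mul_assoc 2 h, mul_assoc 2 h]
        exact W.expA_add_le (by positivity) (by positivity)
    rw [norm_smul, ← div_eq_mul_inv, mul_div_assoc', le_div_iff₀ hE]
    calc ‖ψ₀ z‖ * ‖f (x - w)‖ * W.expA (h * ‖x‖)
        ≤ ‖ψ₀ z‖ * ‖f (x - w)‖ * (W.expA (2 * h * ‖z‖) * W.expA (2 * h * ‖x - w‖)) := by gcongr
      _ = W.expA (2 * h * ‖z‖) * ‖ψ₀ z‖ * (W.expA (2 * h * ‖x - w‖) * ‖f (x - w)‖) := by ring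
      _ ≤ _ := by gcongr
  set D := I * (W.expA (2 * h * max R 0) * B) with hD
  have hufw : Integrable fun x => X.weight x * ‖f x‖ :=
    (X.integrable_weightMeasure_iff.1 (X.integrable_weightMeasure_of_expA
      hfc.aestronglyMeasurable (UltraClass.projInd_of_forall hfw))).2
  have hmain : Tendsto (fun n => ‖X.toBeurling (χ n) - u‖) atTop (𝓝 0) := by
    have heq : ∀ n, ‖X.toBeurling (χ n) - u‖ =
        ∫ x, X.weight x * ‖TestSpace.fn (χ n) x - f x‖ := fun n =>
      X.norm_eq_of_ae ((Lp.coeFn_sub _ _).trans ((X.coeFn_toBeurling (χ n)).sub hu))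
    simp only [heq]
    have h0 : (0 : ℝ) = ∫ x : EuclideanSpace ℝ (Fin d), X.weight x * ‖f x - f x‖ := by simp
    rw [h0]
    refine tendsto_integral_of_dominated_convergence
      (fun x => D * (X.weight x * (W.expA (h * ‖x‖))⁻¹) + X.weight x * ‖f x‖) (fun n => ?_)
      ((hwi.const_mul D).add hufw) (fun n => ae_of_all _ fun x => ?_) (ae_of_all _ fun x => ?_)
    · exact (X.measurable_weight.mul
        ((χ n).continuous_fn.sub hfc).norm.measurable).aestronglyMeasurable
    · have hw := X.weight_nonneg x
      rw [Real.norm_of_nonneg (by positivity)]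
      calc X.weight x * ‖TestSpace.fn (χ n) x - f x‖
          ≤ X.weight x * (D * (W.expA (h * ‖x‖))⁻¹ + ‖f x‖) := by
            gcongr
            exact (norm_sub_le _ _).trans (add_le_add_left (hbound n x) _)
        _ = _ := by ring
    · exact ((hlim x).sub_const (f x)).norm.const_mul _
  obtain ⟨n, hn⟩ := (hmain.eventually (gt_mem_nhds hε)).exists
  exact ⟨χ n, hn⟩

theorem denseRange_toBeurling : DenseRange (X.toBeurling) := by
  intro u
  rw [Metric.mem_closure_range_iff]
  intro ε hε
  obtain ⟨f, hfs, hfu, hfc, hfm⟩ := (Lp.memLp u).exists_hasCompactSupport_eLpNorm_sub_le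
    ENNReal.one_ne_top (ε := ENNReal.ofReal (ε / 2)) (by simpa using half_pos hε)
  have hv := hfm.coeFn_toLp
  obtain ⟨φ, hφ⟩ := X.exists_toBeurling_near hfc hfs hv (half_pos hε)
  refine ⟨φ, ?_⟩
  have h1 : dist u (hfm.toLp f) ≤ ε / 2 := by
    rw [dist_edist, Lp.edist_def]
    refine ENNReal.toReal_le_of_le_ofReal (by positivity) ?_
    rw [eLpNorm_congr_ae ((ae_eq_refl _).sub hv)]
    exact hfu
  calc dist u (X.toBeurling φ) ≤ dist u (hfm.toLp f) + dist (hfm.toLp f) (X.toBeurling φ) :=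
        dist_triangle _ _ _
    _ < ε / 2 + ε / 2 := by
        refine add_lt_add_of_le_of_lt h1 ?_
        rw [dist_comm, dist_eq_norm]
        exact hφ
    _ = ε := add_halves ε

/-- Two density arguments: test functions in `E` for a fixed test function on the left, then test
functions in `L¹_ω`. -/
theorem ExtendsConvolution.unique {conv₁ conv₂ : X.Beurling →L[ℂ] E →L[ℂ] E}
    (h₁ : X.ExtendsConvolution conv₁) (h₂ : X.ExtendsConvolution conv₂) : conv₁ = conv₂ := by
  have key : ∀ φ : TestSpace W c d, conv₁ (X.toBeurling φ) = conv₂ (X.toBeurling φ) := by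
    intro φ
    refine DFunLike.coe_injective (X.ofTest_dense.equalizer (ContinuousLinearMap.continuous _)
      (ContinuousLinearMap.continuous _) (funext fun ψ => ?_))
    obtain ⟨u₁, χ₁, hu₁, hχ₁, e₁⟩ := h₁ φ ψ
    obtain ⟨u₂, χ₂, hu₂, hχ₂, e₂⟩ := h₂ φ ψ
    have hu₁' : X.toBeurling φ = u₁ := Lp.ext ((X.coeFn_toBeurling φ).trans hu₁.symm)
    have hu₂' : X.toBeurling φ = u₂ := Lp.ext ((X.coeFn_toBeurling φ).trans hu₂.symm)
    have hχ : χ₁ = χ₂ := TestSpace.ext_fn fun x => (hχ₁ x).trans (hχ₂ x).symm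
    simp only [Function.comp_apply]
    conv_lhs => rw [hu₁', e₁, hχ, ← e₂, ← hu₂']
  exact DFunLike.coe_injective (X.denseRange_toBeurling.equalizer conv₁.continuous
    conv₂.continuous (funext key))

end TIBSpace

/-- In contrast to `exists_and`, the conclusion is needed for all parameters in the Beurling class
although `P` is given for one only. As `P` persists for larger parameters and `R` for smaller ones,
the parameter may be enlarged. -/
theorem UltraClass.ProjInd.of_indProj {c : UltraClass} {P Q R : ℝ → Prop} (hQ : c.ProjInd Q)
    (hP : c.IndProj P) {K : ℝ} (hK : 0 < K) (mP : ∀ h k, 0 < h → h ≤ k → P h → P k)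
    (mR : ∀ h k, 0 < h → h ≤ k → R k → R h) (hR : ∀ h, 0 < h → P h → Q (K * h) → R h) :
    c.ProjInd R := by
  cases c with
  | beurling =>
    obtain ⟨k, hk, hP⟩ := hP
    intro h hh
    have hm : 0 < max h k := lt_max_of_lt_left hh
    exact mR _ _ hh (le_max_left _ _)
      (hR _ hm (mP _ _ hk (le_max_right _ _) hP) (hQ _ (mul_pos hK hm)))
  | roumieu =>
    obtain ⟨h, hh, hQ⟩ := hQ
    have hd := div_pos hh hK
    exact ⟨h / K, hd, hR _ hd (hP _ hd) (by rwa [mul_div_cancel₀ h hK.ne'])⟩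

theorem UltraClass.IndProj.and {c : UltraClass} {P Q : ℝ → Prop} (hP : c.IndProj P)
    (hQ : c.IndProj Q) (mP : ∀ h k, 0 < h → h ≤ k → P h → P k)
    (mQ : ∀ h k, 0 < h → h ≤ k → Q h → Q k) : c.IndProj fun h => P h ∧ Q h := by
  cases c with
  | beurling =>
    obtain ⟨h, hh, hP⟩ := hP
    obtain ⟨k, hk, hQ⟩ := hQ
    exact ⟨max h k, lt_max_of_lt_left hh, mP _ _ hh (le_max_left _ _) hP,
      mQ _ _ hk (le_max_right _ _) hQ⟩
  | roumieu => exact fun h hh => ⟨hP h hh, hQ h hh⟩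

theorem NormScale.bound_mono {V : Type*} [AddCommGroup V] [Module ℂ V] (N : NormScale V)
    {ι : Type*} {p : ι → ℝ≥0∞} {v : ι → V} (h k : ℝ) (hh : 0 < h) (hk : h ≤ k)
    (hp : ∃ C : ℝ≥0, C ≠ 0 ∧ ∀ i, p i ≤ C * N.toFun h (v i)) :
    ∃ C : ℝ≥0, C ≠ 0 ∧ ∀ i, p i ≤ C * N.toFun k (v i) := by
  obtain ⟨C, hC, hb⟩ := hp
  refine ⟨C, hC, fun i => (hb i).trans ?_⟩
  gcongr
  exact N.mono hh hk _

namespace TIBSpace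

variable {W : WeightSeqs} {c : UltraClass} {E : Type*} [NormedAddCommGroup E] [NormedSpace ℂ E]
  (X : TIBSpace W c d E)

/-! ### The algebra structure -/

section Algebra

variable (u v : X.Beurling)

theorem Beurling.integrable_weight_smul : Integrable fun x => (X.weight x : ℂ) * u x := by
  refine ((X.integrable_weightMeasure_iff.1 (Beurling.integrable X u)).2).mono' ?_
    (ae_of_all _ fun x => ?_)
  · exact (X.measurable_weight.complex_ofReal.aestronglyMeasurable).mul
      (Lp.stronglyMeasurable u).aestronglyMeasurable
  · rw [norm_mul, Complex.norm_real, Real.norm_of_nonneg (X.weight_nonneg x)]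

/-- The integrand of the weighted convolution. -/
def convKernel (p : EuclideanSpace ℝ (Fin d) × EuclideanSpace ℝ (Fin d)) : ℂ :=
  (X.weight p.2 * u p.2) * (X.weight (p.1 - p.2) * v (p.1 - p.2))

/-- This is the ordinary convolution integrand of `ω u` and `ω v`, both in `L¹`. By
submultiplicativity it dominates `ω(x) |u(y) v(x-y)|`, so it serves integrability, the norm
inequality and associativity alike. -/
theorem integrable_convKernel : Integrable (X.convKernel u v) (volume.prod volume) :=
  Integrable.convolution_integrand (ContinuousLinearMap.mul ℂ ℂ)
    (Beurling.integrable_weight_smul X u) (Beurling.integrable_weight_smul X v)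

theorem stronglyMeasurable_mul_sub : StronglyMeasurable
    fun p : EuclideanSpace ℝ (Fin d) × EuclideanSpace ℝ (Fin d) => u p.2 * v (p.1 - p.2) :=
  ((Lp.stronglyMeasurable u).comp_measurable measurable_snd).mul
    ((Lp.stronglyMeasurable v).comp_measurable (measurable_fst.sub measurable_snd))

theorem weight_mul_norm_le (p : EuclideanSpace ℝ (Fin d) × EuclideanSpace ℝ (Fin d)) :
    X.weight p.1 * ‖u p.2 * v (p.1 - p.2)‖ ≤ ‖X.convKernel u v p‖ := by
  have h := X.weight_add_le p.2 (p.1 - p.2)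
  rw [add_sub_cancel] at h
  simp only [convKernel, norm_mul, Complex.norm_real, Real.norm_of_nonneg (X.weight_nonneg _)]
  calc X.weight p.1 * (‖u p.2‖ * ‖v (p.1 - p.2)‖)
      ≤ (X.weight p.2 * X.weight (p.1 - p.2)) * (‖u p.2‖ * ‖v (p.1 - p.2)‖) := by gcongr
    _ = _ := by ring

theorem weight_mul_norm_integral_le (x : EuclideanSpace ℝ (Fin d))
    (hx : Integrable fun y => X.convKernel u v (x, y)) :
    X.weight x * ‖∫ y, u y * v (x - y)‖ ≤ ∫ y, ‖X.convKernel u v (x, y)‖ := by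
  have h1 : X.weight x * ‖∫ y, u y * v (x - y)‖ =
      ‖∫ y, (X.weight x : ℂ) * (u y * v (x - y))‖ := by
    rw [integral_const_mul, norm_mul, Complex.norm_real,
      Real.norm_of_nonneg (X.weight_nonneg x)]
  rw [h1]
  refine norm_integral_le_of_norm_le hx.norm (ae_of_all _ fun y => ?_)
  rw [norm_mul, Complex.norm_real, Real.norm_of_nonneg (X.weight_nonneg x)]
  exact X.weight_mul_norm_le u v (x, y)

theorem integrable_convolution :
    Integrable (fun x => ∫ y, u y * v (x - y)) X.weightMeasure := by
  have hm := (X.stronglyMeasurable_mul_sub u v).integral_prod_right'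
    (ν := (volume : Measure (EuclideanSpace ℝ (Fin d))))
  refine X.integrable_weightMeasure_iff.2 ⟨hm.aestronglyMeasurable,
    (X.integrable_convKernel u v).integral_norm_prod_left.mono' ?_ ?_⟩
  · exact X.measurable_weight.aestronglyMeasurable.mul hm.norm.aestronglyMeasurable
  · filter_upwards [(X.integrable_convKernel u v).prod_right_ae] with x hx
    rw [Real.norm_of_nonneg (mul_nonneg (X.weight_nonneg x) (norm_nonneg _))]
    exact X.weight_mul_norm_integral_le u v x hx

theorem integral_weight_mul_norm_convolution_le :
    ∫ x, X.weight x * ‖∫ y, u y * v (x - y)‖ ≤ ‖u‖ * ‖v‖ := by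
  have hK := X.integrable_convKernel u v
  have h1 : ∫ x, X.weight x * ‖∫ y, u y * v (x - y)‖ ≤
      ∫ x, ∫ y, ‖X.convKernel u v (x, y)‖ := by
    refine integral_mono_ae (X.integrable_weightMeasure_iff.1 (X.integrable_convolution u v)).2
      hK.integral_norm_prod_left ?_
    filter_upwards [hK.prod_right_ae] with x hx
    exact X.weight_mul_norm_integral_le u v x hx
  refine h1.trans_eq ?_
  rw [integral_integral_swap hK.norm, Beurling.norm_eq, Beurling.norm_eq, ← integral_mul_const]
  refine integral_congr_ae (ae_of_all _ fun y => ?_)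
  simp only [convKernel, norm_mul, Complex.norm_real, Real.norm_of_nonneg (X.weight_nonneg _)]
  rw [integral_const_mul, integral_sub_right_eq_self (fun z => X.weight z * ‖v z‖) y]

/-- Fubini in `E`, then the substitution `x ↦ x + y` and `T_{-y} (v * g) = v * T_{-y} g`. -/
theorem conv_convolution [CompleteSpace E] {w : X.Beurling} (hw : X.IsConvolution u v w) (g : E) :
    X.conv w g = X.conv u (X.conv v g) := by
  have hK := X.integrable_convKernel u v
  rw [X.conv_apply_of_ae hw]
  simp only [← integral_smul_const]
  have hint : Integrable (fun p : EuclideanSpace ℝ (Fin d) × EuclideanSpace ℝ (Fin d) =>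
      (u p.2 * v (p.1 - p.2)) • X.translate (-p.1) g) (volume.prod volume) := by
    refine (hK.norm.mul_const ‖g‖).mono' ?_ (ae_of_all _ fun p => ?_)
    · exact (X.stronglyMeasurable_mul_sub u v).aestronglyMeasurable.smul
        ((X.continuous_translate_neg g).comp continuous_fst).aestronglyMeasurable
    · rw [norm_smul]
      calc ‖u p.2 * v (p.1 - p.2)‖ * ‖X.translate (-p.1) g‖
          ≤ ‖u p.2 * v (p.1 - p.2)‖ * (X.weight p.1 * ‖g‖) := by
            gcongr
            exact X.norm_translate_neg_le _ _
        _ = X.weight p.1 * ‖u p.2 * v (p.1 - p.2)‖ * ‖g‖ := by ring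
        _ ≤ _ := by
            gcongr
            exact X.weight_mul_norm_le u v p
  rw [integral_integral_swap hint, X.conv_apply]
  refine integral_congr_ae (ae_of_all _ fun y => ?_)
  simp only
  rw [X.translate_conv, X.conv_apply, ← integral_smul,
    ← integral_add_right_eq_self (fun x => (u y * v (x - y)) • X.translate (-x) g) y]
  refine integral_congr_ae (ae_of_all _ fun x => ?_)
  simp only
  rw [add_sub_cancel_right, mul_smul, neg_add, X.translate_add]

theorem exists_isConvolution [CompleteSpace E] : ∃ w : X.Beurling, X.IsConvolution u v w ∧
    ‖w‖ ≤ ‖u‖ * ‖v‖ ∧ ∀ g, X.conv w g = X.conv u (X.conv v g) := by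
  have hw : X.IsConvolution u v ((X.integrable_convolution u v).toL1 _) :=
    Integrable.coeFn_toL1 _
  refine ⟨_, hw, ?_, X.conv_convolution u v hw⟩
  rw [X.norm_eq_of_ae hw]
  exact X.integral_weight_mul_norm_convolution_le u v

end Algebra

/-! ### Test functions in `D^*_E` -/

theorem incl_injective : Function.Injective X.incl := X.derivScale.limIncl_injective

theorem isDeriv_zero (g : E) : X.IsDeriv 0 g g := by
  intro φ
  have : TestSpace.deriv 0 φ = φ :=
    (gsScale W d).limIncl_injective (multiDeriv_zero φ.toSmooth)
  simp [this]

theorem enorm_le_derivNorm (m : ℝ) (g : E) : ‖g‖ₑ ≤ X.derivNorm m g := by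
  refine le_iInf₂ fun G hG => ?_
  rw [(X.isDeriv_zero g).unique X (hG 0)]
  refine le_trans (le_of_eq ?_) (le_iSup (fun α : Fin d → ℕ =>
    ENNReal.ofReal (m ^ (∑ i, α i) / W.M (∑ i, α i)) * ‖G α‖ₑ) 0)
  simp [W.M_zero]

theorem continuous_incl : Continuous X.incl := by
  have h : Continuous ((normSeminorm ℂ E).comp X.incl) := by
    refine X.derivScale.seminorm_continuous_of_bound ?_
    have key : ∀ h : ℝ, ∃ C : ℝ≥0, C ≠ 0 ∧ ∀ x : X.DSpace,
        ENNReal.ofReal (((normSeminorm ℂ E).comp X.incl) x) ≤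
          C * X.derivScale.toFun h (X.derivScale.limIncl c x) := by
      refine fun h => ⟨1, one_ne_zero, fun x => ?_⟩
      rw [ENNReal.coe_one, one_mul, Seminorm.comp_apply, coe_normSeminorm, ofReal_norm]
      exact X.enorm_le_derivNorm h _
    cases c with
    | beurling => exact ⟨1, one_pos, key 1⟩
    | roumieu => exact fun h _ => key h
  refine continuous_of_continuousAt_zero X.incl ?_
  rw [ContinuousAt, map_zero, tendsto_zero_iff_norm_tendsto_zero]
  have := h.tendsto 0
  rwa [map_zero] at this

/-- With the same parameter `h` on both sides, the weights `h^|α| / M_|α|` and `M_|α| / h^|α|`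
cancel, leaving a bound uniform in `α`. -/
theorem exists_derivNorm_ofTest_le : ∃ H : ℝ, 0 < H ∧ ∀ h, 0 < h →
    (∃ C : ℝ≥0, C ≠ 0 ∧ ∀ φ : TestSpace W c d,
      ‖X.ofTest φ‖ₑ ≤ C * (gsScale W d).toFun h φ.toSmooth) →
    ∃ C : ℝ≥0, C ≠ 0 ∧ ∀ φ : TestSpace W c d,
      X.derivNorm h (X.ofTest φ) ≤ C * (gsScale W d).toFun (H * h) φ.toSmooth := by
  obtain ⟨c₀, H, hc, hH, hb⟩ := exists_gsScale_multiDeriv_le (d := d) W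
  refine ⟨H, by linarith, fun h hh ⟨C, hC, hE⟩ =>
    ⟨C * Real.toNNReal c₀, mul_ne_zero hC (Real.toNNReal_pos.2 (by linarith)).ne', fun φ => ?_⟩⟩
  rw [X.derivNorm_eq h fun α => X.isDeriv_ofTest α φ]
  refine iSup_le fun α => ?_
  have hM := W.M_pos (∑ i, α i)
  calc _ ≤ ENNReal.ofReal (h ^ (∑ i, α i) / W.M (∑ i, α i)) * (C *
        (ENNReal.ofReal (c₀ * (W.M (∑ i, α i) / h ^ (∑ i, α i))) *
          (gsScale W d).toFun (H * h) φ.toSmooth)) := by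
        gcongr
        refine (hE _).trans ?_
        gcongr
        exact hb h hh α φ.toSmooth
    _ = C * (ENNReal.ofReal (h ^ (∑ i, α i) / W.M (∑ i, α i)) *
          ENNReal.ofReal (c₀ * (W.M (∑ i, α i) / h ^ (∑ i, α i)))) *
          (gsScale W d).toFun (H * h) φ.toSmooth := by ring
    _ = _ := by
        rw [← ENNReal.ofReal_mul (by positivity), ENNReal.coe_mul]
        congr 3
        field_simp

theorem ofTest_mem (φ : TestSpace W c d) : X.ofTest φ ∈ X.derivScale.limSubmodule c := by
  rw [NormScale.mem_limSubmodule_iff]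
  obtain ⟨H, hH, hb⟩ := X.exists_derivNorm_ofTest_le
  refine φ.finite.of_indProj X.ofTest_bound hH (fun h k => NormScale.bound_mono _ h k)
    (fun h k hh hk hlt => (X.derivScale.mono hh hk _).trans_lt hlt) fun h hh hP hQ => ?_
  obtain ⟨C, -, hC⟩ := hb h hh hP
  exact (hC φ).trans_lt (ENNReal.mul_lt_top ENNReal.coe_lt_top hQ)

/-- The inclusion of the test functions into `D^*_E`. -/
def testIncl : TestSpace W c d →L[ℂ] X.DSpace where
  toLinearMap := (X.ofTest : TestSpace W c d →ₗ[ℂ] E).codRestrict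
    (X.derivScale.limSubmodule c) X.ofTest_mem
  cont := by
    refine (X.derivScale.withSeminorms c).continuous_of_continuous_comp _ fun p => ?_
    obtain ⟨H, hH, hb⟩ := X.exists_derivNorm_ofTest_le
    refine (gsScale W d).seminorm_continuous_of_bound ?_
    refine ((X.derivScale.exists_bound_of_continuous _
      (X.derivScale.continuous_seminorm_family p)).and X.ofTest_bound
      (fun h k => NormScale.bound_mono _ h k) (fun h k => NormScale.bound_mono _ h k)).rescale hH ?_
    rintro h hh ⟨⟨C, hC, hp⟩, hE⟩
    obtain ⟨C', hC', hb⟩ := hb h hh hE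
    refine ⟨C * C', mul_ne_zero hC hC', fun φ => (hp _).trans ?_⟩
    rw [ENNReal.coe_mul, mul_assoc]
    gcongr
    exact hb φ

theorem incl_testIncl (φ : TestSpace W c d) : X.incl (X.testIncl φ) = X.ofTest φ := rfl

/-! ### Regularization and density -/

theorem denseRange_incl : DenseRange X.incl := by
  refine X.ofTest_dense.mono ?_
  rintro _ ⟨φ, rfl⟩
  exact ⟨X.testIncl φ, X.incl_testIncl φ⟩

theorem inclStep_injective (m : ℝ) : Function.Injective (X.inclStep m) := Subtype.val_injective

section Complete

variable [CompleteSpace E]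

/-- Derivatives may fall on the smooth factor, so `ψ * g` has all derivatives in `E` for every `g`
in `E`. -/
theorem isDeriv_conv_toBeurling (α : Fin d → ℕ) (ψ : TestSpace W c d) (g : E) :
    X.IsDeriv α (X.conv (X.toBeurling ψ) g) (X.conv (X.toBeurling (TestSpace.deriv α ψ)) g) := by
  intro θ
  have h1 : Continuous fun g => X.pairing θ (X.conv (X.toBeurling (TestSpace.deriv α ψ)) g) := by
    fun_prop
  have h2 : Continuous fun g => (-1) ^ (∑ i, α i) *
      X.pairing (TestSpace.deriv α θ) (X.conv (X.toBeurling ψ) g) := by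
    fun_prop
  -- Both sides are continuous in `g`, so `g` may be taken to be a test function; there
  -- commutativity of convolution moves the derivative to the other factor.
  refine congrFun (X.ofTest_dense.equalizer h1 h2 (funext fun χ => ?_)) g
  simp only [Function.comp_apply, pairing_apply]
  obtain ⟨ξ, hξ⟩ := TestSpace.exists_convolution ψ.isRapid.integrable ψ.integrable_expA χ
  obtain ⟨ξ', hξ'⟩ := TestSpace.exists_convolution
    (TestSpace.deriv α ψ).isRapid.integrable (TestSpace.deriv α ψ).integrable_expA χ
  rw [X.conv_ofTest ψ.isRapid.integrable (X.coeFn_toBeurling ψ) hξ,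
    X.conv_ofTest (TestSpace.deriv α ψ).isRapid.integrable (X.coeFn_toBeurling _) hξ']
  have hcomm : ∀ f g : EuclideanSpace ℝ (Fin d) → ℂ, ∀ x,
      ∫ y, f y * g (x - y) = ∫ y, g y * f (x - y) := by
    intro f g x
    rw [← integral_sub_left_eq_self _ volume x]
    simp only [sub_sub_cancel]
    exact integral_congr_ae (ae_of_all _ fun y => mul_comm _ _)
  have hsw : ξ.toSmooth = smoothConv χ.isRapid.integrable ψ.isRapid := by
    rw [hξ]
    refine Subtype.ext (funext fun x => ?_)
    rw [smoothConv_apply, smoothConv_apply, hcomm]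
  have hd : ξ' = TestSpace.deriv α ξ := by
    refine TestSpace.ext_fn fun x => ?_
    rw [TestSpace.fn_eq, TestSpace.fn_eq, TestSpace.toSmooth_deriv, hsw, hξ', smoothConv_apply,
      multiDeriv_smoothConv, hcomm]
    rfl
  rw [hd]
  exact X.isDeriv_ofTest α ξ θ

/-- The bound involves only `‖g‖`, so regularization is continuous from `E`, not merely from
`D^*_E`, into the limit. -/
theorem projInd_derivNorm_conv_toBeurling (ψ : TestSpace W c d) :
    c.ProjInd fun h => ∃ C : ℝ≥0∞, C ≠ ∞ ∧ ∀ g : E,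
      X.derivNorm h (X.conv (X.toBeurling ψ) g) ≤ C * ‖g‖ₑ := by
  obtain ⟨c₀, H, hc, hH, hb⟩ := exists_gsScale_multiDeriv_le (d := d) W
  refine ψ.finite.of_indProj X.toBeurling_bound (K := H) (by linarith)
    (fun h k => NormScale.bound_mono _ h k) ?_ ?_
  · rintro h k hh hk ⟨C, hC, hg⟩
    exact ⟨C, hC, fun g => (X.derivScale.mono hh hk _).trans (hg g)⟩
  · rintro h hh ⟨C, hC, hB⟩ hfin
    refine ⟨C * ENNReal.ofReal c₀ * (gsScale W d).toFun (H * h) ψ.toSmooth,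
      (ENNReal.mul_lt_top (ENNReal.mul_lt_top ENNReal.coe_lt_top ENNReal.ofReal_lt_top)
        hfin).ne, fun g => ?_⟩
    rw [X.derivNorm_eq h fun α => X.isDeriv_conv_toBeurling α ψ g]
    refine iSup_le fun α => ?_
    have hM := W.M_pos (∑ i, α i)
    have hn : ‖X.conv (X.toBeurling (TestSpace.deriv α ψ)) g‖ₑ ≤
        ‖X.toBeurling (TestSpace.deriv α ψ)‖ₑ * ‖g‖ₑ := by
      have h := ENNReal.ofReal_le_ofReal (X.norm_conv_le (X.toBeurling (TestSpace.deriv α ψ)) g)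
      rwa [ENNReal.ofReal_mul (norm_nonneg _), ofReal_norm, ofReal_norm, ofReal_norm] at h
    calc _ ≤ ENNReal.ofReal (h ^ (∑ i, α i) / W.M (∑ i, α i)) * ((C *
          (ENNReal.ofReal (c₀ * (W.M (∑ i, α i) / h ^ (∑ i, α i))) *
            (gsScale W d).toFun (H * h) ψ.toSmooth)) * ‖g‖ₑ) := by
          gcongr
          refine hn.trans ?_
          gcongr
          refine (hB _).trans ?_
          gcongr
          exact hb h hh α ψ.toSmooth
      _ = C * (ENNReal.ofReal (h ^ (∑ i, α i) / W.M (∑ i, α i)) *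
            ENNReal.ofReal (c₀ * (W.M (∑ i, α i) / h ^ (∑ i, α i)))) *
            (gsScale W d).toFun (H * h) ψ.toSmooth * ‖g‖ₑ := by ring
      _ = _ := by
          rw [← ENNReal.ofReal_mul (by positivity)]
          congr 4
          field_simp

/-- The regularization `ψ * g ∈ D^*_E` of `g ∈ E`. -/
def regularize (ψ : TestSpace W c d) (g : E) : X.DSpace :=
  ⟨X.conv (X.toBeurling ψ) g, (X.derivScale.mem_limSubmodule_iff _).2
    ((X.projInd_derivNorm_conv_toBeurling ψ).rescale one_pos fun h _ ⟨C, hC, hb⟩ => by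
      rw [one_mul] at hb
      exact (hb g).trans_lt (ENNReal.mul_lt_top hC.lt_top (by simp)))⟩

theorem incl_regularize (ψ : TestSpace W c d) (g : E) :
    X.incl (X.regularize ψ g) = X.conv (X.toBeurling ψ) g := rfl

theorem continuous_regularize (ψ : TestSpace W c d) : Continuous (X.regularize ψ) := by
  refine continuous_iff_continuousAt.2 fun g₀ => X.derivScale.tendsto_lim ?_
  refine (X.projInd_derivNorm_conv_toBeurling ψ).rescale one_pos fun h _ ⟨C, hC, hb⟩ => ?_
  rw [one_mul] at hb
  have h1 : Tendsto (fun g => C * ‖g - g₀‖ₑ) (𝓝 g₀) (𝓝 0) := by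
    have h2 : Tendsto (fun g => ‖g - g₀‖ₑ) (𝓝 g₀) (𝓝 0) := by
      have : Continuous fun g : E => ‖g - g₀‖ₑ := by fun_prop
      simpa using this.tendsto g₀
    simpa using ENNReal.Tendsto.const_mul h2 (Or.inr hC)
  refine tendsto_of_tendsto_of_tendsto_of_le_of_le tendsto_const_nhds h1
    (fun _ => zero_le) fun g => ?_
  have h3 : X.derivScale.limIncl c (X.regularize ψ g - X.regularize ψ g₀) =
      X.conv (X.toBeurling ψ) (g - g₀) := by
    rw [map_sub, map_sub]; rfl
  simp only
  rw [h3]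
  exact hb _

/-- A continuous map sends the closure of the test functions, which is all of `E`, into the closure
of their images, and `ψ * χ` is a test function. -/
theorem regularize_mem_closure (ψ : TestSpace W c d) (g : E) :
    X.regularize ψ g ∈ closure (Set.range X.testIncl) := by
  have h1 : X.regularize ψ '' closure (Set.range X.ofTest) ⊆ closure (Set.range X.testIncl) := by
    refine (image_closure_subset_closure_image (X.continuous_regularize ψ)).trans
      (closure_mono ?_)
    rintro _ ⟨_, ⟨χ, rfl⟩, rfl⟩
    obtain ⟨ξ, hξ⟩ := TestSpace.exists_convolution ψ.isRapid.integrable ψ.integrable_expA χ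
    refine ⟨ξ, X.incl_injective ?_⟩
    rw [X.incl_testIncl, X.incl_regularize,
      X.conv_ofTest ψ.isRapid.integrable (X.coeFn_toBeurling ψ) hξ]
  exact h1 ⟨g, X.ofTest_dense g, rfl⟩

/-- The members of an approximate identity as test functions. -/
def approx {ψ : ℕ → Smooth d} {ψ₀ : EuclideanSpace ℝ (Fin d) → ℂ} (hψ : IsApproxIdentity W ψ ψ₀)
    (n : ℕ) : TestSpace W c d :=
  TestSpace.ofSmooth (ψ n) (UltraClass.projInd_of_forall (hψ.finite n))

section Approx

variable {ψ : ℕ → Smooth d} {ψ₀ : EuclideanSpace ℝ (Fin d) → ℂ} (hψ : IsApproxIdentity W ψ ψ₀)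

theorem tendsto_conv_approx (g : E) :
    Tendsto (fun n => X.conv (X.toBeurling (approx hψ n)) g) atTop (𝓝 g) := by
  obtain ⟨τ, C, hτ, hC, hb⟩ := X.exists_weight_bound
  have h := hψ.tendsto_integral_smul (X.continuous_translate_neg g) hτ
    (C := C * ‖g‖) (by positivity) (fun y => ?_)
  · rw [neg_zero, X.translate_zero] at h
    refine h.congr fun n => ?_
    rw [X.conv_apply_of_ae (X.coeFn_toBeurling _)]
    rfl
  · refine (X.norm_translate_neg_le y g).trans ?_
    calc X.weight y * ‖g‖ ≤ C * W.expA (τ * ‖y‖) * ‖g‖ := by gcongr; exact hb y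
      _ = _ := by ring

/-- Since `‖y‖ ≤ (n + 1) ‖y‖`, the weight may be evaluated at the dilated point; undoing the
dilation leaves an integral independent of `n`. -/
theorem exists_norm_toBeurling_approx_le : ∃ D : ℝ, 0 ≤ D ∧
    ∀ n, ‖X.toBeurling (approx hψ n)‖ ≤ D := by
  obtain ⟨τ, C, hτ, hC, hb⟩ := X.exists_weight_bound
  have hi := (hψ.integrable_expA τ hτ).const_mul C
  refine ⟨∫ z, C * (W.expA (τ * ‖z‖) * ‖ψ₀ z‖), integral_nonneg fun z => ?_, fun n => ?_⟩
  · have := W.expA_pos (τ * ‖z‖)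
    simp only [Pi.zero_apply]
    positivity
  have hn : (0 : ℝ) < (n : ℝ) + 1 := by positivity
  have hnn : ‖((n : ℂ) + 1)‖ = (n : ℝ) + 1 := by
    have : ((n : ℂ) + 1) = (((n : ℝ) + 1 : ℝ) : ℂ) := by push_cast; ring
    rw [this, Complex.norm_real, Real.norm_of_nonneg hn.le]
  rw [X.norm_eq_of_ae (X.coeFn_toBeurling _),
    ← integral_dilate n fun z => C * (W.expA (τ * ‖z‖) * ‖ψ₀ z‖)]
  have hint : Integrable fun y : EuclideanSpace ℝ (Fin d) => (((n : ℝ) + 1) ^ d) •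
      (C * (W.expA (τ * ‖((n : ℝ) + 1) • y‖) * ‖ψ₀ (((n : ℝ) + 1) • y)‖)) :=
    (hi.comp_smul hn.ne').const_mul (((n : ℝ) + 1) ^ d)
  refine integral_mono (X.integrable_weightMeasure_iff.1 (X.integrable_fn _)).2 hint fun y => ?_
  have hy : TestSpace.fn (approx (c := c) hψ n) y =
      (n + 1) ^ d * ψ₀ (((n : ℝ) + 1) • y) := hψ.apply_eq n y
  simp only [hy, norm_mul, norm_pow, hnn, smul_eq_mul]
  have h1 : X.weight y ≤ C * W.expA (τ * ‖((n : ℝ) + 1) • y‖) := by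
    refine (hb y).trans (mul_le_mul_of_nonneg_left (W.expA_mono (by positivity) ?_) hC.le)
    rw [norm_smul, Real.norm_of_nonneg hn.le]
    have : ‖y‖ ≤ ((n : ℝ) + 1) * ‖y‖ :=
      le_mul_of_one_le_left (norm_nonneg _) (by linarith [n.cast_nonneg (α := ℝ)])
    gcongr
  calc X.weight y * (((n : ℝ) + 1) ^ d * ‖ψ₀ (((n : ℝ) + 1) • y)‖)
      ≤ (C * W.expA (τ * ‖((n : ℝ) + 1) • y‖)) *
        (((n : ℝ) + 1) ^ d * ‖ψ₀ (((n : ℝ) + 1) • y)‖) := by gcongr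
    _ = _ := by ring

/-- Convergence in `E` of each derivative is not uniform in `α`. Halving the parameter supplies the
factor `2^(-|α|)`, which makes large `|α|` uniformly negligible and leaves finitely many terms. -/
theorem tendsto_derivNorm_conv_approx {m : ℝ} (hm : 0 < m) {g : E}
    (hg : X.derivNorm (2 * m) g < ∞) :
    Tendsto (fun n => X.derivNorm m (X.conv (X.toBeurling (approx hψ n)) g - g)) atTop (𝓝 0) := by
  obtain ⟨D, hD, hDb⟩ := X.exists_norm_toBeurling_approx_le hψ
  have hex : ∃ G : (Fin d → ℕ) → E, ∀ α, X.IsDeriv α g (G α) := by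
    by_contra h
    exact hg.ne (X.derivNorm_eq_top _ h)
  obtain ⟨G, hG⟩ := hex
  rw [X.derivNorm_eq _ hG] at hg
  set S := ⨆ α : Fin d → ℕ, ENNReal.ofReal ((2 * m) ^ (∑ i, α i) / W.M (∑ i, α i)) * ‖G α‖ₑ
    with hS
  have hdiff : ∀ n α, X.IsDeriv α (X.conv (X.toBeurling (approx hψ n)) g - g)
      (X.conv (X.toBeurling (approx hψ n)) (G α) - G α) := by
    intro n α φ
    rw [map_sub, map_sub, sub_apply, sub_apply, (hG α).conv X _ φ, hG α φ, mul_sub]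
  simp only [fun n => X.derivNorm_eq m (hdiff n)]
  have hterm : ∀ n (α : Fin d → ℕ), ENNReal.ofReal (m ^ (∑ i, α i) / W.M (∑ i, α i)) *
      ‖X.conv (X.toBeurling (approx hψ n)) (G α) - G α‖ₑ ≤
      ENNReal.ofReal ((1 / 2) ^ (∑ i, α i)) * (ENNReal.ofReal (D + 1) * S) := by
    intro n α
    have hM := W.M_pos (∑ i, α i)
    have h1 : ‖X.conv (X.toBeurling (approx hψ n)) (G α) - G α‖ₑ ≤
        ENNReal.ofReal (D + 1) * ‖G α‖ₑ := by
      rw [← ofReal_norm, ← ofReal_norm, ← ENNReal.ofReal_mul (by positivity)]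
      refine ENNReal.ofReal_le_ofReal ((norm_sub_le _ _).trans ?_)
      rw [add_mul, one_mul]
      gcongr
      exact (X.norm_conv_le _ _).trans (mul_le_mul_of_nonneg_right (hDb n) (norm_nonneg _))
    have h2 : ENNReal.ofReal (m ^ (∑ i, α i) / W.M (∑ i, α i)) =
        ENNReal.ofReal ((1 / 2) ^ (∑ i, α i)) *
          ENNReal.ofReal ((2 * m) ^ (∑ i, α i) / W.M (∑ i, α i)) := by
      rw [← ENNReal.ofReal_mul (by positivity), mul_pow, div_pow, one_pow]
      congr 1
      field_simp
    calc _ ≤ ENNReal.ofReal (m ^ (∑ i, α i) / W.M (∑ i, α i)) *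
          (ENNReal.ofReal (D + 1) * ‖G α‖ₑ) := by gcongr
      _ = ENNReal.ofReal ((1 / 2) ^ (∑ i, α i)) * (ENNReal.ofReal (D + 1) *
          (ENNReal.ofReal ((2 * m) ^ (∑ i, α i) / W.M (∑ i, α i)) * ‖G α‖ₑ)) := by
          rw [h2]; ring
      _ ≤ _ := by
          gcongr
          exact le_iSup (fun α : Fin d → ℕ =>
            ENNReal.ofReal ((2 * m) ^ (∑ i, α i) / W.M (∑ i, α i)) * ‖G α‖ₑ) α
  have hgeom : Tendsto (fun N : ℕ => ENNReal.ofReal ((1 / 2) ^ N) * (ENNReal.ofReal (D + 1) * S))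
      atTop (𝓝 0) := by
    have h1 : Tendsto (fun N : ℕ => ENNReal.ofReal ((1 / 2) ^ N)) atTop (𝓝 0) := by
      rw [← ENNReal.ofReal_zero]
      exact (ENNReal.continuous_ofReal.tendsto 0).comp
        (tendsto_pow_atTop_nhds_zero_of_lt_one (by norm_num) (by norm_num))
    simpa using ENNReal.Tendsto.mul_const h1
      (Or.inr (ENNReal.mul_lt_top ENNReal.ofReal_lt_top hg).ne)
  rw [ENNReal.tendsto_nhds_zero]
  intro ε hε
  obtain ⟨N, hN⟩ := (ENNReal.tendsto_nhds_zero.1 hgeom ε hε).exists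
  -- The box `[0, N)^d` is a finite set containing every `α` with `|α| < N`.
  have hfin : ∀ᶠ n in atTop, ∀ α ∈ Fintype.piFinset fun _ : Fin d => Finset.range N,
      ENNReal.ofReal (m ^ (∑ i, α i) / W.M (∑ i, α i)) *
        ‖X.conv (X.toBeurling (approx hψ n)) (G α) - G α‖ₑ ≤ ε := by
    rw [Filter.eventually_all_finset]
    intro α _
    refine ENNReal.tendsto_nhds_zero.1 ?_ ε hε
    have h1 : Tendsto (fun n => ‖X.conv (X.toBeurling (approx hψ n)) (G α) - G α‖ₑ)
        atTop (𝓝 0) := by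
      have := ((X.tendsto_conv_approx hψ (G α)).sub_const (G α)).enorm
      simpa using this
    simpa using ENNReal.Tendsto.const_mul h1 (Or.inr ENNReal.ofReal_ne_top)
  filter_upwards [hfin] with n hn
  refine iSup_le fun α => ?_
  by_cases hα : ∑ i, α i < N
  · refine hn α (Fintype.mem_piFinset.2 fun i => Finset.mem_range.2 (lt_of_le_of_lt ?_ hα))
    exact Finset.single_le_sum (fun _ _ => Nat.zero_le _) (Finset.mem_univ i)
  · refine (hterm n α).trans (le_trans ?_ hN)
    refine mul_le_mul_left (ENNReal.ofReal_le_ofReal ?_) _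
    exact pow_le_pow_of_le_one (by norm_num) (by norm_num) (not_lt.1 hα)

end Approx

/-- The regularizations converge to `φ` and lie in the closure of the test functions. The loss of a
factor `2` in the parameter is harmless in either limit. -/
theorem denseRange_testIncl : DenseRange X.testIncl := by
  intro φ
  obtain ⟨ψ, ψ₀, hψ⟩ := exists_isApproxIdentity W d
  have ht : Tendsto (fun n => X.regularize (approx hψ n) (X.incl φ)) atTop (𝓝 φ) := by
    refine X.derivScale.tendsto_lim ?_
    refine (X.derivScale.lim_finite φ).rescale two_pos fun m hm hfin => ?_
    refine (X.tendsto_derivNorm_conv_approx hψ hm hfin).congr fun n => ?_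
    rw [map_sub]
    rfl
  exact closure_closure (s := Set.range X.testIncl) ▸
    mem_closure_of_tendsto ht (Eventually.of_forall fun n => X.regularize_mem_closure _ _)

/-! ### The convolution on `D^*_E` and on its steps -/

/-- The convolution `L¹_ω × D^*_E → D^*_E`. -/
def convLim : X.Beurling →ₗ[ℂ] X.DSpace →ₗ[ℂ] X.DSpace :=
  LinearMap.mk₂ ℂ
    (fun u φ => ⟨X.conv u (X.incl φ), (X.derivScale.mem_limSubmodule_iff _).2
      ((X.derivScale.lim_finite φ).rescale one_pos fun h _ hfin =>
        (X.derivNorm_conv_le h u (X.incl φ)).trans_lt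
          (ENNReal.mul_lt_top (by simp) (by rwa [one_mul] at hfin)))⟩)
    (fun u v φ => X.incl_injective (show X.conv (u + v) (X.incl φ) =
      X.conv u (X.incl φ) + X.conv v (X.incl φ) by rw [map_add, add_apply]))
    (fun a u φ => X.incl_injective (show X.conv (a • u) (X.incl φ) = a • X.conv u (X.incl φ) by
      rw [map_smul, smul_apply]))
    (fun u φ φ' => X.incl_injective (map_add (X.conv u) (X.incl φ) (X.incl φ')))
    (fun a u φ => X.incl_injective (map_smul (X.conv u) a (X.incl φ)))

theorem incl_convLim (u : X.Beurling) (φ : X.DSpace) :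
    X.incl (X.convLim u φ) = X.conv u (X.incl φ) := rfl

theorem continuous_convLim : Continuous fun q : X.Beurling × X.DSpace => X.convLim q.1 q.2 :=
  X.derivScale.continuous_bilinear X.convLim fun h _ u φ => X.derivNorm_conv_le h u (X.incl φ)

/-- The convolution `L¹_ω × D^{M_p,m}_E → D^{M_p,m}_E`. -/
def convStep (m : ℝ) : X.Beurling →ₗ[ℂ] X.DStep m →ₗ[ℂ] X.DStep m :=
  LinearMap.mk₂ ℂ
    (fun u φ => ⟨X.conv u (X.inclStep m φ), (X.derivNorm_conv_le m u (X.inclStep m φ)).trans_lt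
      (ENNReal.mul_lt_top (by simp) φ.2)⟩)
    (fun u v φ => X.inclStep_injective m (show X.conv (u + v) (X.inclStep m φ) =
      X.conv u (X.inclStep m φ) + X.conv v (X.inclStep m φ) by rw [map_add, add_apply]))
    (fun a u φ => X.inclStep_injective m (show X.conv (a • u) (X.inclStep m φ) =
      a • X.conv u (X.inclStep m φ) by
      rw [map_smul, smul_apply]))
    (fun u φ φ' => X.inclStep_injective m (map_add (X.conv u) (X.inclStep m φ) (X.inclStep m φ')))
    (fun a u φ => X.inclStep_injective m (map_smul (X.conv u) a (X.inclStep m φ)))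

theorem inclStep_convStep (m : ℝ) (u : X.Beurling) (φ : X.DStep m) :
    X.inclStep m (X.convStep m u φ) = X.conv u (X.inclStep m φ) := rfl

theorem norm_convStep_le (m : ℝ) (u : X.Beurling) (φ : X.DStep m) :
    ‖X.convStep m u φ‖ ≤ ‖u‖ * ‖φ‖ := by
  have h := ENNReal.toReal_mono (ENNReal.mul_lt_top (by simp) φ.2).ne
    (X.derivNorm_conv_le m u (X.inclStep m φ))
  rw [ENNReal.toReal_mul, toReal_enorm] at h
  exact h

theorem continuous_convStep (m : ℝ) :
    Continuous fun q : X.Beurling × X.DStep m => X.convStep m q.1 q.2 := by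
  let B : X.Beurling →L[ℂ] X.DStep m →L[ℂ] X.DStep m :=
    LinearMap.mkContinuous₂ (X.convStep m) 1 fun u φ => by
      rw [one_mul]; exact X.norm_convStep_le m u φ
  exact B.continuous₂

end Complete

end TIBSpace

end UltraTI

end

/-! ### The main theorem. -/

theorem mainTheorem2 (W : UltraTI.WeightSeqs) (c : UltraTI.UltraClass) (d : ℕ) {E : Type*}
    [NormedAddCommGroup E] [NormedSpace ℂ E] [CompleteSpace E] (X : UltraTI.TIBSpace W c d E) :
    -- the dense continuous inclusions
    (∃ ι : UltraTI.TestSpace W c d →L[ℂ] X.DSpace,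
      Function.Injective ι ∧ DenseRange ι ∧ ∀ φ, X.incl (ι φ) = X.ofTest φ) ∧
    (Continuous X.incl ∧ Function.Injective X.incl ∧ DenseRange X.incl) ∧
    (Continuous X.toUltra ∧ Function.Injective X.toUltra ∧ DenseRange X.toUltra) ∧
    -- the convolution on `L¹_ω × E`, the unique continuous bilinear extension
    ∃ conv : X.Beurling →L[ℂ] E →L[ℂ] E, X.ExtendsConvolution conv ∧
      (∀ conv' : X.Beurling →L[ℂ] E →L[ℂ] E, X.ExtendsConvolution conv' → conv' = conv) ∧
      -- it restricts to a continuous module structure on `D^*_E`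
      (∃ B : X.Beurling →ₗ[ℂ] X.DSpace →ₗ[ℂ] X.DSpace,
        (∀ u φ, X.incl (B u φ) = conv u (X.incl φ)) ∧
        Continuous (fun q : X.Beurling × X.DSpace => B q.1 q.2) ∧
        (∀ u v : X.Beurling, ∃ w : X.Beurling, X.IsConvolution u v w ∧ ‖w‖ ≤ ‖u‖ * ‖v‖ ∧
          ∀ φ, B w φ = B u (B v φ))) ∧
      -- and to a continuous bilinear map on each `D^{M_p,m}_E`, with the norm estimate
      ∀ m : ℝ, 0 < m → ∃ B : X.Beurling →ₗ[ℂ] X.DStep m →ₗ[ℂ] X.DStep m,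
        (∀ u φ, X.inclStep m (B u φ) = conv u (X.inclStep m φ)) ∧
        Continuous (fun q : X.Beurling × X.DStep m => B q.1 q.2) ∧
        ∀ u φ, ‖B u φ‖ ≤ ‖u‖ * ‖φ‖ := by
  refine ⟨⟨X.testIncl, fun φ ψ h => X.ofTest_injective (congrArg X.incl h), X.denseRange_testIncl,
      X.incl_testIncl⟩, ⟨X.continuous_incl, X.incl_injective, X.denseRange_incl⟩,
    ⟨X.toUltra.continuous, X.toUltra_injective, X.toUltra_dense⟩,
    X.conv, X.extendsConvolution_conv,
    fun conv' h => UltraTI.TIBSpace.ExtendsConvolution.unique X h X.extendsConvolution_conv,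
    ⟨X.convLim, X.incl_convLim, X.continuous_convLim, fun u v => ?_⟩,
    fun m _ => ⟨X.convStep m, X.inclStep_convStep m, X.continuous_convStep m,
      X.norm_convStep_le m⟩⟩
  obtain ⟨w, hw, hn, h⟩ := X.exists_isConvolution u v
  exact ⟨w, hw, hn, fun φ => X.incl_injective (h (X.incl φ))⟩
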